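/- **Setting.** Let $d,N\in\mathbb N$, and let $B$ be the open unit ball of $\mathbb R^d$. For an open set $U$, $C^1(\overline U,\mathbb R^N)$ denotes the maps that are $C^1$ in $U$ and that extend continuously, together with their gradients, to $\overline U$; the same convention applies to maps on $\overline U\cap B(x_0,r)$. *Polytopes.* A closed convex polytope in $\mathbb R^d$ is a bounded intersection of $q\ge d+1$ closed half-spaces $\{x: x\cdot m_i\le b_i\}$, $|m_i|=1$. A polytope $\mathcal P\subset\mathbb R^d$ is an open connected set that is the interior of a finite union of closed convex polytopes. Its $(d-1)$-faces with outward unit normal $m$ are the closures of the connected components of the set of those $q\in\partial\mathcal P$ near which $\mathcal P$ coincides with $\{x:(x-q)\cdot m<0\}$. For $p\in\partial\mathcal P$ let $M(p)$ be the set of outward unit normals of the $(d-1)$-faces containing $p$. The $(d-k)$-faces are the closures of the connected components of $\{p\in\partial\mathcal P:\dim\operatorname{span}M(p)=k\}$. The face with $p$ in its relative interior is *outwards* (respectively *inwards*) pointing if there is a neighbourhood $V$ of $p$ such that every convex combination $x$ of two points of $V$ lying on $(d-1)$-faces containing $p$ satisfies $(x-p)\cdot m\le 0$ (respectively $\ge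 0$) for all $m\in M(p)$. *Domains.* An open bounded set $\Omega\subset\mathbb R^d$ is locally diffeomorphic to a polytope if for every $x_0\in\partial\Omega$ there are $r>0$, a polytope $\mathcal P$ and a $C^1$ diffeomorphism $g$ (up to the boundary, with $C^1$ inverse) from $B(x_0,r)\cap\overline\Omega$ onto a subset of $\overline{\mathcal P}$, such that $\det\nabla g>0$, $g(B(x_0,r)\cap\Omega)\subset\mathcal P$, $g(B(x_0,r)\cap\partial\Omega)\subset\partial\mathcal P$, and, among the faces of $\mathcal P$ that meet the image of $g$, there is exactly one of lowest dimension. Given such a $g$ at $x_0$, the point $x_0$ is *$(d-k)$-facelike* if $g(x_0)$ lies on a $(d-k)$-face of $\mathcal P$ and on no face of lower dimension. Its associated normals are the vectors $n=\nabla g(x_0)^Tm/|\nabla g(x_0)^Tm|$, $m\in M(g(x_0))$. If the face of $\mathcal P$ with $g(x_0)$ in its relative interior is outwards pointing, set $B_{d-k,x_0}=\{x\in B: x\cdot n<0\text{ for all associated normals }n\}$; if it is inwards pointing, set $B_{d-k,x_0}=\{x\in B: x\cdot n<0\text{ for some associated normal }n\}$. Let $$V_{d-k,x_0}=\{\varphi\in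 C^1(\overline{B_{d-k,x_0}},\mathbb R^N):\ \varphi=0\text{ on }\partial B\cap\overline{B_{d-k,x_0}}\}.$$ *The variational problem.* Let $\Gamma_D\subseteq\partial\Omega$, $\Gamma_N=\partial\Omega\setminus\overline{\Gamma_D}$, let $\bar u$ be $C^1$ (with values in $\mathbb R^N$) on an open set containing $\overline{\Gamma_D}$, and put $\mathcal A=\{u\in C^1(\overline\Omega,\mathbb R^N):u=\bar u\text{ on }\Gamma_D\}$, $\mathrm{Var}(\mathcal A)=\{\varphi\in C^1(\overline\Omega,\mathbb R^N):\varphi=0\text{ on }\Gamma_D\}$, $I(u)=\int_\Omega F(x,u,\nabla u)\,dx$. A map $u_0\in\mathcal A$ is a strong local minimiser of $I$ in $\mathcal A$ if there is $\varepsilon>0$ such that $I(u)\ge I(u_0)$ for all $u\in\mathcal A$ with $\|u-u_0\|_\infty<\varepsilon$. Let $p\in[2,\infty)$. The hypotheses on $F:\overline\Omega\times\mathbb R^N\times\mathbb R^{N\times d}\to\mathbb R$ are: * **[H0]** the partial derivatives $F_y,F_z,F_{yy},F_{yz},F_{zz}$ of $F(x,y,z)$ exist and are continuous on $\overline\Omega\times\mathcal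 U$ for some bounded open neighbourhood $\mathcal U$ of $\{(u_0(x),\nabla u_0(x)):x\in\overline\Omega\}$; * **[H1]** for all $(x,y,z)$, $F_y$ and $F_z$ exist and $|F|,|F_y|\le C(y)(1+|z|^p)$, $|F_z|\le C(y)(1+|z|^{p-1})$, where $C>0$ is in $L^\infty_{\rm loc}(\mathbb R^N)$. **Theorem.** Let $\Omega$ be locally diffeomorphic to a polytope, let $u_0\in\mathcal A$, and let $F$ be continuous and satisfy [H0] and [H1]. If $u_0$ is a strong local minimiser of $I$ in $\mathcal A$, then the following hold, where the derivatives of $F$ in (I) and (II) are evaluated at $(x,u_0(x),\nabla u_0(x))$. * (I) $\int_\Omega [F_y\cdot\varphi+F_z\cdot\nabla\varphi]\,dx=0$ for all $\varphi\in\mathrm{Var}(\mathcal A)$. * (II) $\int_\Omega [F_{yy}\varphi\cdot\varphi+2F_{yz}\nabla\varphi\cdot\varphi+F_{zz}\nabla\varphi\cdot\nabla\varphi]\,dx\ge0$ for all $\varphi\in\mathrm{Var}(\mathcal A)$. * (III) For every $x_0\in\overline\Omega$ and every $\varphi\in C^1_c(B,\mathbb R^N)$, $\int_B[F(x_0,u_0(x_0),\nabla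 u_0(x_0)+\nabla\varphi(x))-F(x_0,u_0(x_0),\nabla u_0(x_0))]\,dx\ge0$. * (IV)$_k$ For every $k=1,\dots,d$, every $x_0\in\Gamma_N$ and every $g$ as above at $x_0$ for which $x_0$ is $(d-k)$-facelike and the face of $\mathcal P$ with $g(x_0)$ in its relative interior is outwards or inwards pointing, $\int_{B_{d-k,x_0}}[F(x_0,u_0(x_0),\nabla u_0(x_0)+\nabla\varphi(x))-F(x_0,u_0(x_0),\nabla u_0(x_0))]\,dx\ge0$ for all $\varphi\in V_{d-k,x_0}$. -/

import Mathlib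

set_option maxSynthPendingDepth 3

open Set Filter Topology MeasureTheory Metric Module

namespace PolyMin

/-- Euclidean space `ℝⁿ`. -/
abbrev Vec (n : ℕ) : Type := EuclideanSpace ℝ (Fin n)

/-- The space `ℝ^{N × d}` of `N × d` matrices, as linear maps `ℝᵈ → ℝᴺ`; the norm used on it is
the operator norm, which is equivalent to the Euclidean one. -/
abbrev Mat (N d : ℕ) : Type := Vec d →L[ℝ] Vec N

noncomputable section

/-! ### Functions that are continuously differentiable up to the boundary -/

/-- `f` is `C¹` on the open set `U`, and `f` and its derivative on `U` extend continuously to the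
points of `S`, where `U ⊆ S ⊆ closure U`. For `S = closure U` this is `f ∈ C¹(closure U)`. -/
def C1UpTo {n m : ℕ} (U S : Set (Vec n)) (f : Vec n → Vec m) : Prop :=
  ContDiffOn ℝ 1 f U ∧ ContinuousOn f S ∧
    ∀ x ∈ S, ∃ L : Mat m n, Tendsto (fderiv ℝ f) (𝓝[U] x) (𝓝 L)

/-- The gradient of `f` on the open set `U`, extended by continuity to the boundary of `U`. -/
def grad {n m : ℕ} (U : Set (Vec n)) (f : Vec n → Vec m) : Vec n → Mat m n :=
  extendFrom U (fderiv ℝ f)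

/-! ### Polytopes and their faces -/

/-- Closed convex polytopes: bounded intersections of `q ≥ d + 1` closed half-spaces. -/
def IsConvexPolytope {d : ℕ} (C : Set (Vec d)) : Prop :=
  Bornology.IsBounded C ∧
    ∃ q : ℕ, d + 1 ≤ q ∧ ∃ (m : Fin q → Vec d) (b : Fin q → ℝ), (∀ i, ‖m i‖ = 1) ∧
      C = {x | ∀ i, inner ℝ x (m i) ≤ b i}

/-- Polytopes (not necessarily convex): open connected sets that are the interior of a finite
union of closed convex polytopes. -/
def IsPolytope {d : ℕ} (P : Set (Vec d)) : Prop :=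
  IsOpen P ∧ IsConnected P ∧
    ∃ (n : ℕ) (C : Fin n → Set (Vec d)), (∀ i, IsConvexPolytope (C i)) ∧ P = interior (⋃ i, C i)

/-- The boundary points of `P` near which `P` is one side of a hyperplane, with outward unit
normal `m`. -/
def flatPart {d : ℕ} (P : Set (Vec d)) (m : Vec d) : Set (Vec d) :=
  {q | q ∈ frontier P ∧ ‖m‖ = 1 ∧
    ∃ r > 0, P ∩ ball q r = {x | x ∈ ball q r ∧ inner ℝ (x - q) m < 0}}

/-- `G` is a (closed) `(d-1)`-face of `P` with outward unit normal `m`. -/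
def IsFacet {d : ℕ} (P : Set (Vec d)) (m : Vec d) (G : Set (Vec d)) : Prop :=
  ∃ q ∈ flatPart P m, G = closure (connectedComponentIn (flatPart P m) q)

/-- The outward unit normals of the `(d-1)`-faces of `P` that meet at `p`. -/
def normalsAt {d : ℕ} (P : Set (Vec d)) (p : Vec d) : Set (Vec d) :=
  {m | ∃ G, IsFacet P m G ∧ p ∈ G}

/-- The union of the `(d-1)`-faces of `P` that meet at `p`. -/
def facetsThrough {d : ℕ} (P : Set (Vec d)) (p : Vec d) : Set (Vec d) :=
  {a | ∃ m G, IsFacet P m G ∧ p ∈ G ∧ a ∈ G}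

/-- The boundary points of `P` in the relative interior of a `(d-k)`-face: the normals of the
`(d-1)`-faces that meet there span a space of dimension `k`. -/
def stratum {d : ℕ} (P : Set (Vec d)) (k : ℕ) : Set (Vec d) :=
  {p | p ∈ frontier P ∧ finrank ℝ (Submodule.span ℝ (normalsAt P p)) = k}

/-- `G` is a (closed) face of `P` of codimension `k`, that is, a `(d-k)`-face. -/
def IsFace {d : ℕ} (P : Set (Vec d)) (k : ℕ) (G : Set (Vec d)) : Prop :=
  ∃ q ∈ stratum P k, G = closure (connectedComponentIn (stratum P k) q)

/-- The face of `P` with `p` in its relative interior is outwards pointing: relative to `p`, any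
convex combination `x` of two points, close to `p`, of the `(d-1)`-faces that meet at `p`
satisfies `x · m ≤ 0` for all their outward normals `m`. -/
def IsOutwardAt {d : ℕ} (P : Set (Vec d)) (p : Vec d) : Prop :=
  ∃ V ∈ 𝓝 p, ∀ a ∈ facetsThrough P p ∩ V, ∀ b ∈ facetsThrough P p ∩ V, ∀ x ∈ segment ℝ a b,
    ∀ m ∈ normalsAt P p, inner ℝ (x - p) m ≤ 0

/-- The face of `P` with `p` in its relative interior is inwards pointing. -/
def IsInwardAt {d : ℕ} (P : Set (Vec d)) (p : Vec d) : Prop :=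
  ∃ V ∈ 𝓝 p, ∀ a ∈ facetsThrough P p ∩ V, ∀ b ∈ facetsThrough P p ∩ V, ∀ x ∈ segment ℝ a b,
    ∀ m ∈ normalsAt P p, 0 ≤ inner ℝ (x - p) m

/-! ### Domains that are locally diffeomorphic to a polytope -/

/-- An orientation preserving diffeomorphism `g` from a neighbourhood of `x₀` in `closure Ω` onto
a subset of `closure P`, for a polytope `P`, with inverse `h`. -/
structure Chart {d : ℕ} (Ω : Set (Vec d)) (x₀ : Vec d) where
  r : ℝ
  P : Set (Vec d)
  g : Vec d → Vec d
  h : Vec d → Vec d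
  r_pos : 0 < r
  isPolytope : IsPolytope P
  mapsTo_closure : MapsTo g (ball x₀ r ∩ closure Ω) (closure P)
  g_C1 : C1UpTo (ball x₀ r ∩ Ω) (ball x₀ r ∩ closure Ω) g
  leftInv : LeftInvOn h g (ball x₀ r ∩ closure Ω)
  h_C1 : C1UpTo (g '' (ball x₀ r ∩ Ω)) (g '' (ball x₀ r ∩ closure Ω)) h
  det_pos : ∀ x ∈ ball x₀ r ∩ closure Ω, 0 < (grad (ball x₀ r ∩ Ω) g x).det
  mapsTo_interior : MapsTo g (ball x₀ r ∩ Ω) P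
  mapsTo_frontier : MapsTo g (ball x₀ r ∩ frontier Ω) (frontier P)
  /-- Among the faces of `P` that meet the image of `g`, there is only one of lowest dimension. -/
  lowest_face : ∃ k₀ G₀, IsFace P k₀ G₀ ∧ (G₀ ∩ g '' (ball x₀ r ∩ closure Ω)).Nonempty ∧
    ∀ k G, IsFace P k G → (G ∩ g '' (ball x₀ r ∩ closure Ω)).Nonempty →
      k ≤ k₀ ∧ (k = k₀ → G = G₀)

/-- `Ω` is open, bounded and locally diffeomorphic to a polytope. -/
def LocallyDiffeoPolytope {d : ℕ} (Ω : Set (Vec d)) : Prop :=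
  IsOpen Ω ∧ Bornology.IsBounded Ω ∧ ∀ x₀ ∈ frontier Ω, Nonempty (Chart Ω x₀)

variable {d N : ℕ}

/-- The boundary point `x₀` of `Ω` is `(d-k)`-facelike: `g x₀` lies on a `(d-k)`-face of `P`, and
`d-k` is the minimum dimension of the faces in which it is found. -/
def Chart.IsFacelike {Ω : Set (Vec d)} {x₀ : Vec d} (c : Chart Ω x₀) (k : ℕ) : Prop :=
  (∃ G, IsFace c.P k G ∧ c.g x₀ ∈ G) ∧ ∀ j G, IsFace c.P j G → c.g x₀ ∈ G → j ≤ k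

/-- The gradient `∇g(x₀)`. -/
def Chart.gradAt {Ω : Set (Vec d)} {x₀ : Vec d} (c : Chart Ω x₀) : Mat d d :=
  grad (ball x₀ c.r ∩ Ω) c.g x₀

/-- The outward unit normals associated with `x₀`: the vectors `∇g(x₀)ᵀ m / |∇g(x₀)ᵀ m|`, where
`m` is an outward unit normal of a `(d-1)`-face of `P` that meets at `g(x₀)`. -/
def Chart.normals {Ω : Set (Vec d)} {x₀ : Vec d} (c : Chart Ω x₀) : Set (Vec d) :=
  (fun m => ‖ContinuousLinearMap.adjoint c.gradAt m‖⁻¹ •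
    ContinuousLinearMap.adjoint c.gradAt m) '' normalsAt c.P (c.g x₀)

/-- The part of the unit ball on the inner side of all the hyperplanes with normals in `S`. -/
def outwardRegion (S : Set (Vec d)) : Set (Vec d) :=
  {x | x ∈ ball 0 1 ∧ ∀ n ∈ S, inner ℝ x n < 0}

/-- The part of the unit ball on the inner side of some hyperplane with normal in `S`. -/
def inwardRegion (S : Set (Vec d)) : Set (Vec d) :=
  {x | x ∈ ball 0 1 ∧ ∃ n ∈ S, inner ℝ x n < 0}

/-! ### Quasiconvexity conditions -/

/-- `f` is quasiconvex at `A` in the interior. -/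
def QuasiconvexInterior (f : Mat N d → ℝ) (A : Mat N d) : Prop :=
  ∀ φ : Vec d → Vec N, ContDiff ℝ 1 φ → HasCompactSupport φ → tsupport φ ⊆ ball 0 1 →
    0 ≤ ∫ x in ball (0 : Vec d) 1, (f (A + fderiv ℝ φ x) - f A)

/-- Quasiconvexity of `f` at `A` on a part `D` of the unit ball, tested with the maps in
`C¹(closure D)` that vanish on the curved part of the boundary and are free on the rest. -/
def QuasiconvexBoundary (D : Set (Vec d)) (f : Mat N d → ℝ) (A : Mat N d) : Prop :=
  ∀ φ : Vec d → Vec N, C1UpTo D (closure D) φ → (∀ x ∈ sphere 0 1 ∩ closure D, φ x = 0) →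
    0 ≤ ∫ x in D, (f (A + fderiv ℝ φ x) - f A)

/-- `f` is quasiconvex at `A` at the facelike boundary through `x₀`. The two clauses agree if the
face is both outwards and inwards pointing, which happens for `(d-1)`-faces only. -/
def Chart.QuasiconvexFacelike {Ω : Set (Vec d)} {x₀ : Vec d} (c : Chart Ω x₀)
    (f : Mat N d → ℝ) (A : Mat N d) : Prop :=
  (IsOutwardAt c.P (c.g x₀) → QuasiconvexBoundary (outwardRegion c.normals) f A) ∧
  (IsInwardAt c.P (c.g x₀) → QuasiconvexBoundary (inwardRegion c.normals) f A)

/-! ### The variational problem -/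

/-- The functional `I(u) = ∫_Ω F(x, u(x), ∇u(x)) dx`. -/
def energy (Ω : Set (Vec d)) (F : Vec d → Vec N → Mat N d → ℝ) (u : Vec d → Vec N) : ℝ :=
  ∫ x in Ω, F x (u x) (fderiv ℝ u x)

/-- The admissible maps: `u ∈ C¹(closure Ω)` with `u = ubar` on `ΓD`. -/
def Admissible (Ω ΓD : Set (Vec d)) (ubar : Vec d → Vec N) : Set (Vec d → Vec N) :=
  {u | C1UpTo Ω (closure Ω) u ∧ ∀ x ∈ ΓD, u x = ubar x}

/-- The variations: `φ ∈ C¹(closure Ω)` with `φ = 0` on `ΓD`. -/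
def Variations (Ω ΓD : Set (Vec d)) : Set (Vec d → Vec N) :=
  {φ | C1UpTo Ω (closure Ω) φ ∧ ∀ x ∈ ΓD, φ x = 0}

/-- Strong local minimisers: minimisers among the admissible maps that are uniformly close. -/
def IsStrongLocalMin (Ω ΓD : Set (Vec d)) (ubar : Vec d → Vec N)
    (F : Vec d → Vec N → Mat N d → ℝ) (u₀ : Vec d → Vec N) : Prop :=
  ∃ ε > 0, ∀ u ∈ Admissible Ω ΓD ubar, (∀ x ∈ closure Ω, ‖u x - u₀ x‖ < ε) →
    energy Ω F u₀ ≤ energy Ω F u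

/-- The partial derivative `F_y`. -/
def dY (F : Vec d → Vec N → Mat N d → ℝ) (x : Vec d) (y : Vec N) (z : Mat N d) :
    Vec N →L[ℝ] ℝ :=
  fderiv ℝ (fun y' => F x y' z) y

/-- The partial derivative `F_z`. -/
def dZ (F : Vec d → Vec N → Mat N d → ℝ) (x : Vec d) (y : Vec N) (z : Mat N d) :
    Mat N d →L[ℝ] ℝ :=
  fderiv ℝ (fun z' => F x y z') z

/-- The partial derivative `F_yy`. -/
def dYY (F : Vec d → Vec N → Mat N d → ℝ) (x : Vec d) (y : Vec N) (z : Mat N d) :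
    Vec N →L[ℝ] Vec N →L[ℝ] ℝ :=
  fderiv ℝ (fun y' => dY F x y' z) y

/-- The partial derivative `F_yz`. -/
def dYZ (F : Vec d → Vec N → Mat N d → ℝ) (x : Vec d) (y : Vec N) (z : Mat N d) :
    Mat N d →L[ℝ] Vec N →L[ℝ] ℝ :=
  fderiv ℝ (fun z' => dY F x y z') z

/-- The partial derivative `F_zz`. -/
def dZZ (F : Vec d → Vec N → Mat N d → ℝ) (x : Vec d) (y : Vec N) (z : Mat N d) :
    Mat N d →L[ℝ] Mat N d →L[ℝ] ℝ :=
  fderiv ℝ (fun z' => dZ F x y z') z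

/-- The smoothness hypothesis: for a bounded open neighbourhood `U` of
`{(u₀(x), ∇u₀(x)) : x ∈ closure Ω}`, the partial derivatives `F_y`, `F_z`, `F_yy`, `F_yz`, `F_zz`
exist and are continuous on `closure Ω × U`. -/
def HypH0 (Ω : Set (Vec d)) (F : Vec d → Vec N → Mat N d → ℝ) (u₀ : Vec d → Vec N) : Prop :=
  ∃ U : Set (Vec N × Mat N d), IsOpen U ∧ Bornology.IsBounded U ∧
    (∀ x ∈ closure Ω, (u₀ x, grad Ω u₀ x) ∈ U) ∧
    (∀ x ∈ closure Ω, ∀ w ∈ U,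
      DifferentiableAt ℝ (fun y => F x y w.2) w.1 ∧
      DifferentiableAt ℝ (fun z => F x w.1 z) w.2 ∧
      DifferentiableAt ℝ (fun y => dY F x y w.2) w.1 ∧
      DifferentiableAt ℝ (fun z => dY F x w.1 z) w.2 ∧
      DifferentiableAt ℝ (fun z => dZ F x w.1 z) w.2) ∧
    ContinuousOn (fun v : Vec d × Vec N × Mat N d => dY F v.1 v.2.1 v.2.2) (closure Ω ×ˢ U) ∧
    ContinuousOn (fun v : Vec d × Vec N × Mat N d => dZ F v.1 v.2.1 v.2.2) (closure Ω ×ˢ U) ∧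
    ContinuousOn (fun v : Vec d × Vec N × Mat N d => dYY F v.1 v.2.1 v.2.2) (closure Ω ×ˢ U) ∧
    ContinuousOn (fun v : Vec d × Vec N × Mat N d => dYZ F v.1 v.2.1 v.2.2) (closure Ω ×ˢ U) ∧
    ContinuousOn (fun v : Vec d × Vec N × Mat N d => dZZ F v.1 v.2.1 v.2.2) (closure Ω ×ˢ U)

/-- The growth hypothesis with exponent `p`: the partial derivatives `F_y` and `F_z` exist
everywhere, and `|F|, |F_y| ≤ C(y)(1 + |z|^p)`, `|F_z| ≤ C(y)(1 + |z|^(p-1))` for a positive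
function `C` in `L^∞_loc`. -/
def HypH1 (Ω : Set (Vec d)) (F : Vec d → Vec N → Mat N d → ℝ) (p : ℝ) : Prop :=
  ∃ C : Vec N → ℝ, (∀ y, 0 < C y) ∧
    (∀ K : Set (Vec N), IsCompact K → MemLp C ⊤ (volume.restrict K)) ∧
    ∀ x ∈ closure Ω, ∀ y z,
      DifferentiableAt ℝ (fun y' => F x y' z) y ∧
      DifferentiableAt ℝ (fun z' => F x y z') z ∧
      |F x y z| ≤ C y * (1 + ‖z‖ ^ p) ∧
      ‖dZ F x y z‖ ≤ C y * (1 + ‖z‖ ^ (p - 1)) ∧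
      ‖dY F x y z‖ ≤ C y * (1 + ‖z‖ ^ p)

end

end PolyMin

/-!
Everything is obtained by comparing `u₀` with suitable competitors; as these are `C¹` up to the
boundary, `F` only sees compact sets, and bounded convergence suffices in all limits.

For the first and second variation the competitors are `u₀ + t φ` with `t > 0`. Incrementing first
`z` and then `y`, Taylor's formula expresses the increment of `F` by `F_y`, `F_z`, `F_yy`, `F_yz`
and `F_zz` at intermediate points (`exists_expansion_two`), so the energy has an expansion of
order two in `t` (`exists_energy_expansion`). The coefficient of `t` is nonnegative for `φ` and
for `-φ`, hence zero, and then the coefficient of `t²` is nonnegative.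

The quasiconvexity conditions come from a blow-up. Let `g` be a chart at `x₀` with inverse `h` and
gradient `A` at `x₀`. The competitors are `u₀ + ε ψ(A⁻¹ (g x - g x₀) / ε)`, where `ψ` lives on the
region `D` of the unit ball and vanishes near the sphere. The change of variables
`x = h (g x₀ + ε A z)` turns the increment of the energy into `ε ^ d` times an integral over the
fixed set `D` (`IsBlowUp.energy_transplant`), which converges to the increment of the energy of the
frozen integrand (`IsBlowUp.tendsto_integral`). Maps that vanish only on the sphere itself are reached by
cutting off (`quasiconvexBoundary_of_cutOff`): since they are bounded by the distance to the
sphere, the gradients of the cut-off maps stay bounded. At interior points `g` is the identity and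
`D` the unit ball; quasiconvexity in the interior extends to `closure Ω` by continuity.

At a boundary point two things have to be known. First, near `p = g x₀` the polytope is the
intersection (outwards pointing) or the union (inwards pointing) of the open half-spaces with the
normals of the faces through `p` (`IsPolytope.exists_outward`, `IsPolytope.exists_inward`). Near
`p` a polytope is a cone, its flat points are dense in its boundary, and only finitely many
normals occur; taking both points equal in the definition of outwards pointing faces shows that
the whole boundary near `p` satisfies `(x - p) · m ≤ 0` for all the normals `m`, and similarly
with `≥` for inwards pointing faces. Connectedness of half-balls and of the cone then identifies
the polytope. Secondly, the chart covers the polytope near `p` (`Chart.exists_subset_image`): its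
image is open by the inverse function theorem, and relatively closed because boundary points go to
boundary points.
-/

namespace PolyMin

/-! ### Maps that are `C¹` up to the boundary -/

section UpToBoundary

variable {n m l : ℕ} {U S : Set (Vec n)} {f f' : Vec n → Vec m} {x : Vec n}

theorem C1UpTo.tendsto_grad (h : C1UpTo U S f) (hx : x ∈ S) :
    Tendsto (fderiv ℝ f) (𝓝[U] x) (𝓝 (grad U f x)) :=
  tendsto_extendFrom (h.2.2 x hx)

theorem C1UpTo.continuousOn_grad (h : C1UpTo U S f) (hS : S ⊆ closure U) :
    ContinuousOn (grad U f) S :=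
  continuousOn_extendFrom hS h.2.2

theorem C1UpTo.contDiffAt (h : C1UpTo U S f) (hU : IsOpen U) (hx : x ∈ U) : ContDiffAt ℝ 1 f x :=
  h.1.contDiffAt (hU.mem_nhds hx)

theorem C1UpTo.differentiableAt (h : C1UpTo U S f) (hU : IsOpen U) (hx : x ∈ U) :
    DifferentiableAt ℝ f x :=
  (h.contDiffAt hU hx).differentiableAt one_ne_zero

theorem C1UpTo.continuousOn_fderiv (h : C1UpTo U S f) (hU : IsOpen U) :
    ContinuousOn (fderiv ℝ f) U :=
  h.1.continuousOn_fderiv_of_isOpen hU le_rfl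

theorem C1UpTo.grad_eq (h : C1UpTo U S f) (hU : IsOpen U) (hx : x ∈ U) :
    grad U f x = fderiv ℝ f x :=
  extendFrom_eq (subset_closure hx) ((h.continuousOn_fderiv hU) x hx)

theorem C1UpTo.mono (h : C1UpTo U S f) {U' S' : Set (Vec n)} (hU : U' ⊆ U) (hS : S' ⊆ S) :
    C1UpTo U' S' f :=
  ⟨h.1.mono hU, h.2.1.mono hS, fun x hx =>
    (h.2.2 x (hS hx)).imp fun _ hL => hL.mono_left (nhdsWithin_mono x hU)⟩

theorem C1UpTo.of_contDiff (h : ContDiff ℝ 1 f) (U S : Set (Vec n)) : C1UpTo U S f :=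
  ⟨h.contDiffOn, h.continuous.continuousOn, fun x _ =>
    ⟨fderiv ℝ f x, ((h.continuous_fderiv one_ne_zero).tendsto x).mono_left nhdsWithin_le_nhds⟩⟩

theorem C1UpTo.add (hf : C1UpTo U S f) (hf' : C1UpTo U S f') (hU : IsOpen U) :
    C1UpTo U S (fun x => f x + f' x) := by
  refine ⟨hf.1.add hf'.1, hf.2.1.add hf'.2.1, fun x hx => ?_⟩
  obtain ⟨L, hL⟩ := hf.2.2 x hx
  obtain ⟨L', hL'⟩ := hf'.2.2 x hx
  refine ⟨L + L', (hL.add hL').congr' ?_⟩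
  filter_upwards [self_mem_nhdsWithin] with y hy
  exact (fderiv_fun_add (hf.differentiableAt hU hy) (hf'.differentiableAt hU hy)).symm

/-- Scalar multiples by a function that is `C¹` on the whole space. -/
theorem C1UpTo.smul_of_contDiff {η : Vec n → ℝ} (hη : ContDiff ℝ 1 η) (hf : C1UpTo U S f)
    (hU : IsOpen U) (hUS : U ⊆ S) : C1UpTo U S (fun x => η x • f x) := by
  refine ⟨hη.contDiffOn.smul hf.1, hη.continuous.continuousOn.smul hf.2.1, fun x hx => ?_⟩
  obtain ⟨L, hL⟩ := hf.2.2 x hx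
  have hη0 : Tendsto η (𝓝[U] x) (𝓝 (η x)) :=
    (hη.continuous.tendsto x).mono_left nhdsWithin_le_nhds
  have hη1 : Tendsto (fderiv ℝ η) (𝓝[U] x) (𝓝 (fderiv ℝ η x)) :=
    ((hη.continuous_fderiv one_ne_zero).tendsto x).mono_left nhdsWithin_le_nhds
  have hf0 : Tendsto f (𝓝[U] x) (𝓝 (f x)) := (hf.2.1 x hx).mono_left (nhdsWithin_mono x hUS)
  have hcont : Tendsto (fun y => (fderiv ℝ η y).smulRight (f y)) (𝓝[U] x)
      (𝓝 ((fderiv ℝ η x).smulRight (f x))) :=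
    ((ContinuousLinearMap.smulRightL ℝ (Vec n) (Vec m)).continuous₂.tendsto
      (fderiv ℝ η x, f x)).comp (hη1.prodMk_nhds hf0)
  refine ⟨_, ((hη0.smul hL).add hcont).congr' ?_⟩
  filter_upwards [self_mem_nhdsWithin] with y hy
  exact (fderiv_fun_smul (hη.differentiable one_ne_zero y) (hf.differentiableAt hU hy)).symm

theorem C1UpTo.const_smul (hf : C1UpTo U S f) (hU : IsOpen U) (hUS : U ⊆ S) (t : ℝ) :
    C1UpTo U S (fun x => t • f x) :=
  C1UpTo.smul_of_contDiff contDiff_const hf hU hUS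

theorem C1UpTo.congr (hf : C1UpTo U S f) (hU : IsOpen U) (hUS : U ⊆ S) (h : EqOn f' f S) :
    C1UpTo U S f' := by
  refine ⟨hf.1.congr (h.mono hUS), hf.2.1.congr h, fun x hx => ?_⟩
  obtain ⟨L, hL⟩ := hf.2.2 x hx
  refine ⟨L, hL.congr' ?_⟩
  filter_upwards [self_mem_nhdsWithin] with y hy
  exact (Filter.EventuallyEq.fderiv_eq
    (eventually_of_mem (hU.mem_nhds hy) fun z hz => h (hUS hz))).symm

/-- Being `C¹` up to the boundary is a local property. -/
theorem C1UpTo.of_local (hU : IsOpen U) (hUS : U ⊆ S)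
    (h : ∀ x ∈ S, ∃ V, IsOpen V ∧ x ∈ V ∧ C1UpTo (U ∩ V) (S ∩ V) f) : C1UpTo U S f := by
  refine ⟨fun x hx => ?_, fun x hx => ?_, fun x hx => ?_⟩
  · obtain ⟨V, hV, hxV, hf⟩ := h x (hUS hx)
    exact (hf.contDiffAt (hU.inter hV) ⟨hx, hxV⟩).contDiffWithinAt
  · obtain ⟨V, hV, hxV, hf⟩ := h x hx
    have := hf.2.1 x ⟨hx, hxV⟩
    rwa [ContinuousWithinAt,
      nhdsWithin_inter_of_mem' (nhdsWithin_le_nhds (hV.mem_nhds hxV))] at this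
  · obtain ⟨V, hV, hxV, hf⟩ := h x hx
    have := hf.2.2 x ⟨hx, hxV⟩
    rwa [nhdsWithin_inter_of_mem' (nhdsWithin_le_nhds (hV.mem_nhds hxV))] at this

theorem C1UpTo.comp {D T : Set (Vec m)} {ψ : Vec m → Vec l} (hψ : C1UpTo D T ψ)
    (hf : C1UpTo U S f) (hU : IsOpen U) (hD : IsOpen D) (hUS : U ⊆ S)
    (hUD : MapsTo f U D) (hST : MapsTo f S T) : C1UpTo U S (fun x => ψ (f x)) := by
  refine ⟨hψ.1.comp hf.1 hUD, hψ.2.1.comp hf.2.1 hST, fun x hx => ?_⟩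
  obtain ⟨L, hL⟩ := hf.2.2 x hx
  obtain ⟨L', hL'⟩ := hψ.2.2 (f x) (hST hx)
  have h1 : Tendsto f (𝓝[U] x) (𝓝[D] (f x)) :=
    tendsto_nhdsWithin_iff.2 ⟨(hf.2.1 x hx).mono_left (nhdsWithin_mono x hUS),
      eventually_of_mem self_mem_nhdsWithin hUD⟩
  refine ⟨L'.comp L, ((isBoundedBilinearMap_comp.continuous.tendsto (L', L)).comp
    ((hL'.comp h1).prodMk_nhds hL)).congr' ?_⟩
  filter_upwards [self_mem_nhdsWithin] with y hy
  exact (fderiv_fun_comp y (hψ.differentiableAt hD (hUD hy)) (hf.differentiableAt hU hy)).symm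

/-- A map that is `C¹` up to the boundary of a bounded set is bounded there, as is its gradient. -/
theorem C1UpTo.exists_bound (hf : C1UpTo U (closure U) f) (hb : Bornology.IsBounded U) :
    ∃ C > 0, ∀ x ∈ closure U, ‖f x‖ ≤ C ∧ ‖grad U f x‖ ≤ C := by
  have hc : IsCompact (closure U) := hb.isCompact_closure
  obtain ⟨C₁, h₁⟩ := hc.exists_bound_of_continuousOn hf.2.1
  obtain ⟨C₂, h₂⟩ := hc.exists_bound_of_continuousOn (hf.continuousOn_grad subset_rfl)
  exact ⟨max 1 (max C₁ C₂), by positivity, fun x hx =>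
    ⟨(h₁ x hx).trans (by simp), (h₂ x hx).trans (by simp)⟩⟩

end UpToBoundary

/-- Bounded convergence on a set of finite measure, for functions continuous on that set. -/
theorem tendsto_setIntegral_of_bounded {d : ℕ} {ι : Type*} {l : Filter ι}
    [l.IsCountablyGenerated] {D : Set (Vec d)} (hD : MeasurableSet D)
    (hb : Bornology.IsBounded D) {f : ι → Vec d → ℝ} {f₀ : Vec d → ℝ} (C : ℝ)
    (hcont : ∀ᶠ i in l, ContinuousOn (f i) D) (hC : ∀ᶠ i in l, ∀ x ∈ D, |f i x| ≤ C)
    (hlim : ∀ x ∈ D, Tendsto (fun i => f i x) l (𝓝 (f₀ x))) :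
    Tendsto (fun i => ∫ x in D, f i x) l (𝓝 (∫ x in D, f₀ x)) := by
  have : IsFiniteMeasure (volume.restrict D) := ⟨by simpa using hb.measure_lt_top⟩
  refine tendsto_integral_filter_of_norm_le_const ?_ ⟨C, ?_⟩ ?_
  · filter_upwards [hcont] with i hi using hi.aestronglyMeasurable hD
  · filter_upwards [hC] with i hi
    exact (ae_restrict_iff' hD).2 (Eventually.of_forall hi)
  · exact (ae_restrict_iff' hD).2 (Eventually.of_forall hlim)

/-! ### The first and second variations -/

/-- Taylor's formula of order two, with the remainder in Lagrange's form. -/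
theorem exists_taylor_two {f f' f'' : ℝ → ℝ} {t : ℝ} (ht : 0 < t)
    (h₁ : ∀ s ∈ Icc 0 t, HasDerivAt f (f' s) s) (h₂ : ∀ s ∈ Icc 0 t, HasDerivAt f' (f'' s) s) :
    ∃ ξ ∈ Icc 0 t, f t - f 0 - t * f' 0 = t ^ 2 / 2 * f'' ξ := by
  -- Rolle's theorem, twice, for `f - f 0 - s f' 0 - c s²`, which vanishes at `0` and at `t`.
  set c : ℝ := (f t - f 0 - t * f' 0) / t ^ 2 with hc
  have hct : f t - f 0 - t * f' 0 = c * t ^ 2 := by rw [hc]; field_simp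
  let G : ℝ → ℝ := fun s => f s - f 0 - s * f' 0 - c * s ^ 2
  let G' : ℝ → ℝ := fun s => f' s - f' 0 - 2 * c * s
  have hG : ∀ s ∈ Icc 0 t, HasDerivAt G (G' s) s := fun s hs => by
    have := (((h₁ s hs).sub_const (f 0)).sub ((hasDerivAt_id s).mul_const (f' 0))).sub
      ((hasDerivAt_pow 2 s).const_mul c)
    refine this.congr_deriv ?_
    simp [G']; ring
  have hG' : ∀ s ∈ Icc 0 t, HasDerivAt G' (f'' s - 2 * c) s := fun s hs => by
    have := ((h₂ s hs).sub_const (f' 0)).sub ((hasDerivAt_id s).const_mul (2 * c))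
    refine this.congr_deriv ?_
    simp
  obtain ⟨s, hs, hs0⟩ := exists_hasDerivAt_eq_zero (f := G) (f' := G') ht
    (fun s hs => (hG s hs).continuousAt.continuousWithinAt)
    (by simp only [G]; linarith) (fun s hs => hG s (Ioo_subset_Icc_self hs))
  have hsub : Icc 0 s ⊆ Icc 0 t := Icc_subset_Icc_right hs.2.le
  obtain ⟨ξ, hξ, hξ0⟩ := exists_hasDerivAt_eq_zero (f := G') (f' := fun s => f'' s - 2 * c) hs.1
    (fun r hr => (hG' r (hsub hr)).continuousAt.continuousWithinAt)
    (by rw [hs0]; simp [G']) (fun r hr => hG' r (hsub (Ioo_subset_Icc_self hr)))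
  exact ⟨ξ, hsub (Ioo_subset_Icc_self hξ), by rw [hct]; linear_combination (-(t ^ 2) / 2) * hξ0⟩

theorem hasDerivAt_line {E G : Type*} [NormedAddCommGroup E] [NormedSpace ℝ E]
    [NormedAddCommGroup G] [NormedSpace ℝ G] {f : E → G} {a v : E} {s : ℝ}
    (hf : DifferentiableAt ℝ f (a + s • v)) :
    HasDerivAt (fun s : ℝ => f (a + s • v)) (fderiv ℝ f (a + s • v) v) s := by
  have hl : HasDerivAt (fun s : ℝ => a + s • v) v s := by
    simpa using ((hasDerivAt_id s).smul_const v).const_add a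
  exact hf.hasFDerivAt.comp_hasDerivAt s hl

theorem hasDerivAt_line_apply {E G H : Type*} [NormedAddCommGroup E] [NormedSpace ℝ E]
    [NormedAddCommGroup G] [NormedSpace ℝ G] [NormedAddCommGroup H] [NormedSpace ℝ H]
    {f : E → G →L[ℝ] H} {a v : E} {s : ℝ} (hf : DifferentiableAt ℝ f (a + s • v)) (w : G) :
    HasDerivAt (fun s : ℝ => f (a + s • v) w) (fderiv ℝ f (a + s • v) v w) s := by
  have h := (hasDerivAt_line hf).clm_apply (hasDerivAt_const s w)
  rwa [map_zero, add_zero] at h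

/-- The partial derivatives of first and second order required of the integrand at a point. -/
def PartialsAt {d N : ℕ} (F : Vec d → Vec N → Mat N d → ℝ) (x : Vec d) (w : Vec N × Mat N d) :
    Prop :=
  DifferentiableAt ℝ (fun y => F x y w.2) w.1 ∧
  DifferentiableAt ℝ (fun z => F x w.1 z) w.2 ∧
  DifferentiableAt ℝ (fun y => dY F x y w.2) w.1 ∧
  DifferentiableAt ℝ (fun z => dY F x w.1 z) w.2 ∧
  DifferentiableAt ℝ (fun z => dZ F x w.1 z) w.2

/-- The second order expansion of `F` in the direction `(φ, ψ)`. The increment is split into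
one in `z` at `y` and one in `y` at `z + t ψ`, so that neither joint differentiability nor the
mixed derivative `F_zy` is needed. -/
theorem exists_expansion_two {d N : ℕ} (F : Vec d → Vec N → Mat N d → ℝ) (x : Vec d)
    (y φ : Vec N) (z ψ : Mat N d) {t : ℝ} (ht : 0 < t)
    (h : ∀ σ ∈ Icc 0 t, ∀ τ ∈ Icc 0 t, PartialsAt F x (y + σ • φ, z + τ • ψ)) :
    ∃ σ ∈ Icc 0 t, ∃ τ ∈ Icc 0 t, ∃ ξ ∈ Icc 0 t,
      F x (y + t • φ) (z + t • ψ) - F x y z - t * (dY F x y z φ + dZ F x y z ψ) =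
        t ^ 2 * (1 / 2 * dYY F x (y + σ • φ) (z + t • ψ) φ φ + dYZ F x y (z + τ • ψ) ψ φ
          + 1 / 2 * dZZ F x y (z + ξ • ψ) ψ ψ) := by
  have h0 : (0 : ℝ) ∈ Icc 0 t := ⟨le_rfl, ht.le⟩
  have ht' : t ∈ Icc 0 t := ⟨ht.le, le_rfl⟩
  obtain ⟨σ, hσ, eσ⟩ := exists_taylor_two (f := fun s => F x (y + s • φ) (z + t • ψ))
    (f' := fun s => dY F x (y + s • φ) (z + t • ψ) φ)
    (f'' := fun s => dYY F x (y + s • φ) (z + t • ψ) φ φ) ht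
    (fun s hs => hasDerivAt_line (f := fun y => F x y (z + t • ψ)) (h s hs t ht').1)
    (fun s hs => hasDerivAt_line_apply (f := fun y => dY F x y (z + t • ψ))
      (h s hs t ht').2.2.1 φ)
  have h' : ∀ τ ∈ Icc 0 t, PartialsAt F x (y, z + τ • ψ) := fun τ hτ => by
    simpa only [zero_smul, add_zero] using h 0 h0 τ hτ
  obtain ⟨ξ, hξ, eξ⟩ := exists_taylor_two (f := fun s => F x y (z + s • ψ))
    (f' := fun s => dZ F x y (z + s • ψ) ψ) (f'' := fun s => dZZ F x y (z + s • ψ) ψ ψ) ht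
    (fun s hs => hasDerivAt_line (f := fun z => F x y z) (h' s hs).2.1)
    (fun s hs => hasDerivAt_line_apply (f := fun z => dZ F x y z) (h' s hs).2.2.2.2 ψ)
  have hd : ∀ s ∈ Icc 0 t, HasDerivAt (fun s => dY F x y (z + s • ψ) φ)
      (dYZ F x y (z + s • ψ) ψ φ) s := fun s hs =>
    hasDerivAt_line_apply (f := fun z => dY F x y z) (h' s hs).2.2.2.1 φ
  obtain ⟨τ, hτ, eτ⟩ := exists_hasDerivAt_eq_slope _ _ ht
    (fun s hs => (hd s hs).continuousAt.continuousWithinAt)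
    (fun s hs => hd s (Ioo_subset_Icc_self hs))
  refine ⟨σ, hσ, τ, Ioo_subset_Icc_self hτ, ξ, hξ, ?_⟩
  simp only [zero_smul, add_zero, sub_zero] at eσ eξ eτ
  rw [eq_div_iff ht.ne'] at eτ
  linear_combination eσ + eξ - t * eτ

section Variations

variable {d N : ℕ} {Ω ΓD : Set (Vec d)} {ubar u₀ φ : Vec d → Vec N}
  {F : Vec d → Vec N → Mat N d → ℝ}

/-- The increments of the energy along `φ`, to second order: there are functions `R t`, the second
order difference quotients of the energy, that converge to half of the second variation. -/
theorem exists_energy_expansion (hO : IsOpen Ω) (hb : Bornology.IsBounded Ω)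
    (hu₀ : C1UpTo Ω (closure Ω) u₀)
    (hF : ContinuousOn (fun v : Vec d × Vec N × Mat N d => F v.1 v.2.1 v.2.2)
      (closure Ω ×ˢ Set.univ))
    (hH0 : HypH0 Ω F u₀) (hφ : C1UpTo Ω (closure Ω) φ) :
    ∃ R : ℝ → ℝ,
      (∀ᶠ t in 𝓝[>] 0, energy Ω F (fun x => u₀ x + t • φ x) - energy Ω F u₀ =
        t * (∫ x in Ω, (dY F x (u₀ x) (fderiv ℝ u₀ x) (φ x)
          + dZ F x (u₀ x) (fderiv ℝ u₀ x) (fderiv ℝ φ x))) + t ^ 2 * R t) ∧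
      Tendsto R (𝓝[>] 0) (𝓝 (1 / 2 * ∫ x in Ω, (dYY F x (u₀ x) (fderiv ℝ u₀ x) (φ x) (φ x)
        + 2 * dYZ F x (u₀ x) (fderiv ℝ u₀ x) (fderiv ℝ φ x) (φ x)
        + dZZ F x (u₀ x) (fderiv ℝ u₀ x) (fderiv ℝ φ x) (fderiv ℝ φ x)))) := by
  obtain ⟨U, hU, -, hmem, hdiff, cY, cZ, cYY, cYZ, cZZ⟩ := hH0
  set K := closure Ω
  have hK : IsCompact K := hb.isCompact_closure
  have hΩK : Ω ⊆ K := subset_closure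
  set G₀ := grad Ω u₀
  set G := grad Ω φ
  have cG₀ : ContinuousOn G₀ K := hu₀.continuousOn_grad subset_rfl
  have cG : ContinuousOn G K := hφ.continuousOn_grad subset_rfl
  have cu₀ := hu₀.2.1
  have cφ := hφ.2.1
  have eG₀ : ∀ x ∈ Ω, fderiv ℝ u₀ x = G₀ x := fun x hx => (hu₀.grad_eq hO hx).symm
  have eG : ∀ x ∈ Ω, fderiv ℝ φ x = G x := fun x hx => (hφ.grad_eq hO hx).symm
  have hint : ∀ f : Vec d → ℝ, ContinuousOn f K → IntegrableOn f Ω := fun f hf =>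
    (hf.integrableOn_compact hK).mono_set hΩK
  -- A compact neighbourhood `K₁ ⊆ U` of the values of `(u₀, ∇u₀)`.
  have cbase : ContinuousOn (fun x => (u₀ x, G₀ x)) K := cu₀.prodMk cG₀
  have hK₀ : IsCompact ((fun x => (u₀ x, G₀ x)) '' K) := hK.image_of_continuousOn cbase
  obtain ⟨δ, hδ, hδU⟩ := hK₀.exists_cthickening_subset_open hU
    (by rintro _ ⟨x, hx, rfl⟩; exact hmem x hx)
  set K₁ := cthickening δ ((fun x => (u₀ x, G₀ x)) '' K)
  have hK₁ : IsCompact (K ×ˢ K₁) := hK.prod hK₀.cthickening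
  have hKU : K ×ˢ K₁ ⊆ K ×ˢ U := prod_mono subset_rfl hδU
  obtain ⟨M₁, hM₁⟩ := hK₁.exists_bound_of_continuousOn (cYY.mono hKU)
  obtain ⟨M₂, hM₂⟩ := hK₁.exists_bound_of_continuousOn (cYZ.mono hKU)
  obtain ⟨M₃, hM₃⟩ := hK₁.exists_bound_of_continuousOn (cZZ.mono hKU)
  obtain ⟨C, hC, hφC⟩ := hφ.exists_bound hb
  set T := δ / C
  have hT : 0 < T := by positivity
  have hTm : ∀ᶠ t in 𝓝[>] (0 : ℝ), t ∈ Ioo 0 T := Ioo_mem_nhdsGT hT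
  have hin : ∀ t ∈ Ioo 0 T, ∀ x ∈ K, ∀ σ ∈ Icc 0 t, ∀ τ ∈ Icc 0 t,
      (u₀ x + σ • φ x, G₀ x + τ • G x) ∈ K₁ := by
    intro t ht x hx σ hσ τ hτ
    have hb : ∀ s ∈ Icc 0 t, ∀ c ≤ C, |s| * c ≤ δ := fun s hs c hc => by
      rw [abs_of_nonneg hs.1]
      calc s * c ≤ T * C := by
            have := hs.2.trans ht.2.le
            have := hs.1
            nlinarith
        _ = δ := div_mul_cancel₀ _ hC.ne'
    refine mem_cthickening_of_dist_le _ (u₀ x, G₀ x) _ _ ⟨x, hx, rfl⟩ ?_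
    rw [Prod.dist_eq, dist_eq_norm, dist_eq_norm, add_sub_cancel_left, add_sub_cancel_left,
      norm_smul, norm_smul]
    exact max_le (hb σ hσ _ (hφC x hx).1) (hb τ hτ _ (hφC x hx).2)
  let E : ℝ → Vec d → ℝ := fun t x => F x (u₀ x + t • φ x) (G₀ x + t • G x)
  have cE : ∀ t, ContinuousOn (E t) K := fun t =>
    hF.comp (f := fun x => (x, u₀ x + t • φ x, G₀ x + t • G x)) (continuousOn_id.prodMk
      ((cu₀.add (cφ.const_smul t)).prodMk (cG₀.add (cG.const_smul t)))) fun x hx => ⟨hx, trivial⟩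
  have cpt : ContinuousOn (fun x => (x, u₀ x, G₀ x)) K := continuousOn_id.prodMk cbase
  have hpt : MapsTo (fun x => (x, u₀ x, G₀ x)) K (K ×ˢ U) := fun x hx => ⟨hx, hmem x hx⟩
  let L : Vec d → ℝ := fun x => dY F x (u₀ x) (G₀ x) (φ x) + dZ F x (u₀ x) (G₀ x) (G x)
  have cL : ContinuousOn L K :=
    ((cY.comp cpt hpt).clm_apply cφ).add ((cZ.comp cpt hpt).clm_apply cG)
  let Q : Vec d → ℝ := fun x => dYY F x (u₀ x) (G₀ x) (φ x) (φ x)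
    + 2 * dYZ F x (u₀ x) (G₀ x) (G x) (φ x) + dZZ F x (u₀ x) (G₀ x) (G x) (G x)
  let r : ℝ → Vec d → ℝ := fun t x => (E t x - E 0 x - t * L x) / t ^ 2
  have cr : ∀ t, ContinuousOn (r t) K := fun t =>
    (((cE t).sub (cE 0)).sub (continuousOn_const.mul cL)).div_const _
  have hexp : ∀ x ∈ K, ∀ t ∈ Ioo 0 T, ∃ σ ∈ Icc 0 t, ∃ τ ∈ Icc 0 t, ∃ ξ ∈ Icc 0 t,
      r t x = 1 / 2 * dYY F x (u₀ x + σ • φ x) (G₀ x + t • G x) (φ x) (φ x)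
        + dYZ F x (u₀ x) (G₀ x + τ • G x) (G x) (φ x)
        + 1 / 2 * dZZ F x (u₀ x) (G₀ x + ξ • G x) (G x) (G x) := by
    intro x hx t ht
    obtain ⟨σ, hσ, τ, hτ, ξ, hξ, e⟩ := exists_expansion_two F x (u₀ x) (φ x) (G₀ x) (G x) ht.1
      fun σ hσ τ hτ => hdiff x hx _ (hδU (hin t ht x hx σ hσ τ hτ))
    refine ⟨σ, hσ, τ, hτ, ξ, hξ, ?_⟩
    have ht0 : t ^ 2 ≠ 0 := pow_ne_zero _ ht.1.ne'
    simp only [r, E, L, zero_smul, add_zero]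
    rw [e, mul_div_cancel_left₀ _ ht0]
  have hlim : ∀ {H : Type _} [NormedAddCommGroup H] (f : Vec d × Vec N × Mat N d → H),
      ContinuousOn f (K ×ˢ U) → ∀ x ∈ K, ∀ σ τ : ℝ → ℝ, Tendsto σ (𝓝[>] 0) (𝓝 0) →
      Tendsto τ (𝓝[>] 0) (𝓝 0) →
      Tendsto (fun t => f (x, u₀ x + σ t • φ x, G₀ x + τ t • G x)) (𝓝[>] 0)
        (𝓝 (f (x, u₀ x, G₀ x))) := by
    intro H _ f hf x hx σ τ hσ hτ
    have h1 : Tendsto (fun t => (u₀ x + σ t • φ x, G₀ x + τ t • G x)) (𝓝[>] 0)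
        (𝓝 (u₀ x, G₀ x)) := by
      have a := (hσ.smul_const (φ x)).const_add (u₀ x)
      have b := (hτ.smul_const (G x)).const_add (G₀ x)
      rw [zero_smul, add_zero] at a b
      exact a.prodMk_nhds b
    refine (hf (x, u₀ x, G₀ x) ⟨hx, hmem x hx⟩).tendsto.comp
      (tendsto_nhdsWithin_iff.2 ⟨tendsto_const_nhds.prodMk_nhds h1, ?_⟩)
    filter_upwards [h1.eventually_mem (hU.mem_nhds (hmem x hx))] with t ht using ⟨hx, ht⟩
  have hrlim : ∀ x ∈ Ω, Tendsto (fun t => r t x) (𝓝[>] 0) (𝓝 (1 / 2 * Q x)) := by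
    intro x hx
    have hx := hΩK hx
    have h' : ∀ t, ∃ σ τ ξ : ℝ, t ∈ Ioo 0 T → σ ∈ Icc 0 t ∧ τ ∈ Icc 0 t ∧ ξ ∈ Icc 0 t ∧
        r t x = 1 / 2 * dYY F x (u₀ x + σ • φ x) (G₀ x + t • G x) (φ x) (φ x)
        + dYZ F x (u₀ x) (G₀ x + τ • G x) (G x) (φ x)
        + 1 / 2 * dZZ F x (u₀ x) (G₀ x + ξ • G x) (G x) (G x) := by
      intro t
      by_cases ht : t ∈ Ioo 0 T
      · obtain ⟨σ, hσ, τ, hτ, ξ, hξ, e⟩ := hexp x hx t ht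
        exact ⟨σ, τ, ξ, fun _ => ⟨hσ, hτ, hξ, e⟩⟩
      · exact ⟨0, 0, 0, fun h => absurd h ht⟩
    choose σ τ ξ hall using h'
    have hid : Tendsto (fun t : ℝ => t) (𝓝[>] 0) (𝓝 0) := tendsto_id.mono_left nhdsWithin_le_nhds
    have hsq : ∀ s : ℝ → ℝ, (∀ t ∈ Ioo 0 T, s t ∈ Icc 0 t) → Tendsto s (𝓝[>] 0) (𝓝 0) :=
      fun s hs => tendsto_of_tendsto_of_tendsto_of_le_of_le' tendsto_const_nhds hid
        (hTm.mono fun t ht => (hs t ht).1) (hTm.mono fun t ht => (hs t ht).2)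
    have l1 := hlim _ cYY x hx σ _ (hsq σ fun t ht => (hall t ht).1) hid
    have l2 := hlim _ cYZ x hx (fun _ => 0) τ tendsto_const_nhds
      (hsq τ fun t ht => (hall t ht).2.1)
    have l3 := hlim _ cZZ x hx (fun _ => 0) ξ tendsto_const_nhds
      (hsq ξ fun t ht => (hall t ht).2.2.1)
    simp only [zero_smul, add_zero] at l1 l2 l3
    have hap : ∀ {H₁ H₂ : Type} [NormedAddCommGroup H₁] [NormedSpace ℝ H₁]
        [NormedAddCommGroup H₂] [NormedSpace ℝ H₂] {B : ℝ → H₁ →L[ℝ] H₂ →L[ℝ] ℝ}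
        {B₀ : H₁ →L[ℝ] H₂ →L[ℝ] ℝ} (a : H₁) (b : H₂), Tendsto B (𝓝[>] 0) (𝓝 B₀) →
        Tendsto (fun t => B t a b) (𝓝[>] 0) (𝓝 (B₀ a b)) := by
      intro H₁ H₂ _ _ _ _ B B₀ a b hB
      have hc : Continuous fun B : H₁ →L[ℝ] H₂ →L[ℝ] ℝ => B a b := by fun_prop
      exact (hc.tendsto B₀).comp hB
    have l := (((hap (φ x) (φ x) l1).const_mul (1 / 2 : ℝ)).add (hap (G x) (φ x) l2)).add
      ((hap (G x) (G x) l3).const_mul (1 / 2 : ℝ))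
    have hQ : 1 / 2 * Q x = 1 / 2 * dYY F x (u₀ x) (G₀ x) (φ x) (φ x)
        + dYZ F x (u₀ x) (G₀ x) (G x) (φ x) + 1 / 2 * dZZ F x (u₀ x) (G₀ x) (G x) (G x) := by
      simp only [Q]; ring
    rw [hQ]
    refine l.congr' ?_
    filter_upwards [hTm] with t ht using (hall t ht).2.2.2.symm
  have hrbound : ∀ᶠ t in 𝓝[>] (0 : ℝ), ∀ x ∈ Ω, |r t x| ≤ (M₁ + M₂ + M₃) * C ^ 2 := by
    filter_upwards [hTm] with t ht x hx
    have hx := hΩK hx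
    obtain ⟨σ, hσ, τ, hτ, ξ, hξ, e⟩ := hexp x hx t ht
    have h0 : (0 : ℝ) ∈ Icc 0 t := ⟨le_rfl, ht.1.le⟩
    have hap : ∀ {H₁ H₂ : Type _} [NormedAddCommGroup H₁] [NormedSpace ℝ H₁]
        [NormedAddCommGroup H₂] [NormedSpace ℝ H₂] (B : H₁ →L[ℝ] H₂ →L[ℝ] ℝ) (a : H₁) (b : H₂)
        (M : ℝ), ‖B‖ ≤ M → ‖a‖ ≤ C → ‖b‖ ≤ C → |B a b| ≤ M * C ^ 2 := by
      intro H₁ H₂ _ _ _ _ B a b M hB ha hb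
      have hM := (norm_nonneg B).trans hB
      calc |B a b| ≤ ‖B‖ * ‖a‖ * ‖b‖ := B.le_opNorm₂ a b
        _ ≤ M * C * C := by gcongr
        _ = M * C ^ 2 := by ring
    have b1 := hap _ (φ x) (φ x) M₁ (hM₁ (x, _, _) ⟨hx, hin t ht x hx σ hσ t ⟨ht.1.le, le_rfl⟩⟩)
      (hφC x hx).1 (hφC x hx).1
    have b2 := hap _ (G x) (φ x) M₂ (hM₂ (x, _, _) ⟨hx, hin t ht x hx 0 h0 τ hτ⟩)
      (hφC x hx).2 (hφC x hx).1
    have b3 := hap _ (G x) (G x) M₃ (hM₃ (x, _, _) ⟨hx, hin t ht x hx 0 h0 ξ hξ⟩)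
      (hφC x hx).2 (hφC x hx).2
    simp only [zero_smul, add_zero] at b1 b2 b3
    rw [e]
    rw [abs_le] at *
    constructor <;> linarith
  have hEn : ∀ t, energy Ω F (fun x => u₀ x + t • φ x) = ∫ x in Ω, E t x := fun t =>
    setIntegral_congr_fun hO.measurableSet fun x hx => by
      have h1 := hu₀.differentiableAt hO hx
      have h2 := hφ.differentiableAt hO hx
      simp only [E]
      rw [fderiv_fun_add h1 (h2.fun_const_smul t), fderiv_fun_const_smul h2, eG₀ x hx, eG x hx]
  have hL : (∫ x in Ω, (dY F x (u₀ x) (fderiv ℝ u₀ x) (φ x)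
      + dZ F x (u₀ x) (fderiv ℝ u₀ x) (fderiv ℝ φ x))) = ∫ x in Ω, L x :=
    setIntegral_congr_fun hO.measurableSet fun x hx => by simp only [L, eG₀ x hx, eG x hx]
  have hQ : (∫ x in Ω, (dYY F x (u₀ x) (fderiv ℝ u₀ x) (φ x) (φ x)
        + 2 * dYZ F x (u₀ x) (fderiv ℝ u₀ x) (fderiv ℝ φ x) (φ x)
        + dZZ F x (u₀ x) (fderiv ℝ u₀ x) (fderiv ℝ φ x) (fderiv ℝ φ x))) = ∫ x in Ω, Q x :=
    setIntegral_congr_fun hO.measurableSet fun x hx => by simp only [Q, eG₀ x hx, eG x hx]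
  have hE0 : energy Ω F u₀ = ∫ x in Ω, E 0 x := by simpa using hEn 0
  refine ⟨fun t => ∫ x in Ω, r t x, ?_, ?_⟩
  · filter_upwards [self_mem_nhdsWithin] with t ht
    have ht0 : t ≠ 0 := (mem_Ioi.1 ht).ne'
    rw [hEn, hE0, hL, ← integral_sub (hint _ (cE t)) (hint _ (cE 0)), ← integral_const_mul,
      ← integral_const_mul, ← integral_add ((hint _ cL).const_mul _) ((hint _ (cr t)).const_mul _)]
    refine integral_congr_ae (Eventually.of_forall fun x => ?_)
    simp only [r]
    field_simp
    ring
  · rw [hQ, ← integral_const_mul]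
    exact tendsto_setIntegral_of_bounded hO.measurableSet hb _
      (Eventually.of_forall fun t => (cr t).mono hΩK) hrbound hrlim

/-- Along a variation the energy does not decrease for small `t > 0`. -/
theorem eventually_energy_le (hO : IsOpen Ω) (hb : Bornology.IsBounded Ω)
    (hu₀ : u₀ ∈ Admissible Ω ΓD ubar) (hmin : IsStrongLocalMin Ω ΓD ubar F u₀)
    (hφ : φ ∈ Variations Ω ΓD) :
    ∀ᶠ t in 𝓝[>] (0 : ℝ), energy Ω F u₀ ≤ energy Ω F (fun x => u₀ x + t • φ x) := by
  obtain ⟨ε, hε, hmin⟩ := hmin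
  obtain ⟨C, hC, hφC⟩ := hφ.1.exists_bound hb
  filter_upwards [Ioo_mem_nhdsGT (show (0 : ℝ) < ε / C by positivity)] with t ht
  refine hmin _ ⟨hu₀.1.add (hφ.1.const_smul hO subset_closure t) hO, fun x hx => ?_⟩
    fun x hx => ?_
  · simp only [hφ.2 x hx, smul_zero, add_zero, hu₀.2 x hx]
  · rw [add_sub_cancel_left, norm_smul, Real.norm_of_nonneg ht.1.le]
    calc t * ‖φ x‖ ≤ t * C := mul_le_mul_of_nonneg_left (hφC x hx).1 ht.1.le
      _ < ε := (lt_div_iff₀ hC).1 ht.2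

theorem firstVariation_nonneg (hO : IsOpen Ω) (hb : Bornology.IsBounded Ω)
    (hu₀ : u₀ ∈ Admissible Ω ΓD ubar)
    (hF : ContinuousOn (fun v : Vec d × Vec N × Mat N d => F v.1 v.2.1 v.2.2)
      (closure Ω ×ˢ Set.univ))
    (hH0 : HypH0 Ω F u₀) (hmin : IsStrongLocalMin Ω ΓD ubar F u₀) (hφ : φ ∈ Variations Ω ΓD) :
    0 ≤ ∫ x in Ω, (dY F x (u₀ x) (fderiv ℝ u₀ x) (φ x)
      + dZ F x (u₀ x) (fderiv ℝ u₀ x) (fderiv ℝ φ x)) := by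
  obtain ⟨R, hR, hlim⟩ := exists_energy_expansion hO hb hu₀.1 hF hH0 hφ.1
  have hid : Tendsto (fun t : ℝ => t) (𝓝[>] 0) (𝓝 0) := tendsto_id.mono_left nhdsWithin_le_nhds
  have h := (hid.mul hlim).const_add (∫ x in Ω, (dY F x (u₀ x) (fderiv ℝ u₀ x) (φ x)
      + dZ F x (u₀ x) (fderiv ℝ u₀ x) (fderiv ℝ φ x)))
  rw [zero_mul, add_zero] at h
  refine ge_of_tendsto h ?_
  filter_upwards [hR, eventually_energy_le hO hb hu₀ hmin hφ, self_mem_nhdsWithin] with t h1 h2 h3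
  rw [mem_Ioi] at h3
  refine nonneg_of_mul_nonneg_right (a := t) ?_ h3
  linarith

theorem firstVariation_eq_zero (hO : IsOpen Ω) (hb : Bornology.IsBounded Ω)
    (hu₀ : u₀ ∈ Admissible Ω ΓD ubar)
    (hF : ContinuousOn (fun v : Vec d × Vec N × Mat N d => F v.1 v.2.1 v.2.2)
      (closure Ω ×ˢ Set.univ))
    (hH0 : HypH0 Ω F u₀) (hmin : IsStrongLocalMin Ω ΓD ubar F u₀) (hφ : φ ∈ Variations Ω ΓD) :
    ∫ x in Ω, (dY F x (u₀ x) (fderiv ℝ u₀ x) (φ x)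
      + dZ F x (u₀ x) (fderiv ℝ u₀ x) (fderiv ℝ φ x)) = 0 := by
  refine le_antisymm ?_ (firstVariation_nonneg hO hb hu₀ hF hH0 hmin hφ)
  have hneg : (fun x => -φ x) ∈ (Variations Ω ΓD : Set (Vec d → Vec N)) := by
    refine ⟨?_, fun x hx => by simp only [hφ.2 x hx, neg_zero]⟩
    simpa using hφ.1.const_smul hO subset_closure (-1)
  have h := firstVariation_nonneg hO hb hu₀ hF hH0 hmin hneg
  simp only [fderiv_fun_neg, map_neg, ← neg_add] at h
  rw [integral_neg] at h
  linarith

theorem secondVariation_nonneg (hO : IsOpen Ω) (hb : Bornology.IsBounded Ω)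
    (hu₀ : u₀ ∈ Admissible Ω ΓD ubar)
    (hF : ContinuousOn (fun v : Vec d × Vec N × Mat N d => F v.1 v.2.1 v.2.2)
      (closure Ω ×ˢ Set.univ))
    (hH0 : HypH0 Ω F u₀) (hmin : IsStrongLocalMin Ω ΓD ubar F u₀) (hφ : φ ∈ Variations Ω ΓD) :
    0 ≤ ∫ x in Ω, (dYY F x (u₀ x) (fderiv ℝ u₀ x) (φ x) (φ x)
        + 2 * dYZ F x (u₀ x) (fderiv ℝ u₀ x) (fderiv ℝ φ x) (φ x)
        + dZZ F x (u₀ x) (fderiv ℝ u₀ x) (fderiv ℝ φ x) (fderiv ℝ φ x)) := by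
  obtain ⟨R, hR, hlim⟩ := exists_energy_expansion hO hb hu₀.1 hF hH0 hφ.1
  have h0 := firstVariation_eq_zero hO hb hu₀ hF hH0 hmin hφ
  have h := ge_of_tendsto (b := 0) hlim (by
    filter_upwards [hR, eventually_energy_le hO hb hu₀ hmin hφ, self_mem_nhdsWithin]
      with t h1 h2 h3
    rw [h0, mul_zero, zero_add] at h1
    have h3 : 0 < t ^ 2 := pow_pos (mem_Ioi.1 h3) 2
    exact nonneg_of_mul_nonneg_right (a := t ^ 2) (by linarith) h3)
  linarith

end Variations

/-! ### Polytopes near a boundary point -/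

section Flat

variable {d : ℕ} {P : Set (Vec d)} {p q m m' : Vec d}

theorem subset_or_subset_compl_closure {s : Set (Vec d)} (hs : IsPreconnected s) (hP : IsOpen P)
    (h : Disjoint s (frontier P)) : s ⊆ P ∨ s ⊆ (closure P)ᶜ := by
  refine hs.subset_or_subset hP isClosed_closure.isOpen_compl
    (disjoint_compl_right.mono_left subset_closure) fun x hx => ?_
  by_cases hxP : x ∈ P
  · exact Or.inl hxP
  · refine Or.inr fun hc => disjoint_left.1 h hx ?_
    rw [hP.frontier_eq]
    exact ⟨hc, hxP⟩

/-- Points obtained from a point of an open set by a small shift are in that set. -/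
theorem exists_add_smul_mem {O : Set (Vec d)} (hO : IsOpen O) {z : Vec d} (hz : z ∈ O)
    (v : Vec d) : ∃ s > (0 : ℝ), z + s • v ∈ O := by
  have hc : Continuous fun s : ℝ => z + s • v := by fun_prop
  have h : ∀ᶠ s in 𝓝[>] (0 : ℝ), z + s • v ∈ O :=
    nhdsWithin_le_nhds (hc.continuousAt.eventually_mem (hO.mem_nhds (by simpa using hz)))
  obtain ⟨s, hs, hs0⟩ := (h.and self_mem_nhdsWithin).exists
  exact ⟨s, hs0, hs⟩

theorem isOpen_inner_pos (p m : Vec d) : IsOpen {x : Vec d | 0 < inner ℝ (x - p) m} :=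
  isOpen_lt continuous_const (by fun_prop)

theorem isOpen_inner_neg (p m : Vec d) : IsOpen {x : Vec d | inner ℝ (x - p) m < 0} :=
  isOpen_lt (by fun_prop) continuous_const

theorem convex_inner_pos (p m : Vec d) : Convex ℝ {x : Vec d | 0 < inner ℝ (x - p) m} := by
  intro x hx y hy a b ha hb hab
  have e : a • x + b • y - p = a • (x - p) + b • (y - p) := by
    rw [smul_sub, smul_sub]
    nth_rewrite 1 [← one_smul ℝ p]
    rw [← hab, add_smul]
    abel
  simp only [mem_ofPred_eq] at *
  rw [e, inner_add_left, real_inner_smul_left, real_inner_smul_left]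
  rcases ha.eq_or_lt with rfl | ha
  · simp only [zero_add] at hab
    simpa [hab] using hy
  · have := mul_pos ha hx
    have := mul_nonneg hb hy.le
    linarith

theorem convex_inner_neg (p m : Vec d) : Convex ℝ {x : Vec d | inner ℝ (x - p) m < 0} := by
  have h := convex_inner_pos p (-m)
  simpa only [inner_neg_right, Left.neg_pos_iff] using h

/-- A local description as a half-ball characterizes the points of the flat part. -/
theorem mem_flatPart_of_eq (hP : IsOpen P) (hm : ‖m‖ = 1) {r : ℝ} (hr : 0 < r)
    (h : P ∩ ball q r = {x | x ∈ ball q r ∧ inner ℝ (x - q) m < 0}) : q ∈ flatPart P m := by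
  refine ⟨?_, hm, r, hr, h⟩
  rw [hP.frontier_eq]
  constructor
  · rw [_root_.mem_closure_iff]
    intro O hO hq
    obtain ⟨s, hs, hsO⟩ := exists_add_smul_mem (hO.inter isOpen_ball)
      (⟨hq, mem_ball_self hr⟩ : q ∈ O ∩ ball q r) (-m)
    have : q + s • -m ∈ P ∩ ball q r := by
      rw [h]
      refine ⟨hsO.2, ?_⟩
      simp [real_inner_smul_left, hm, hs]
    exact ⟨_, hsO.1, this.1⟩
  · intro hq
    have : q ∈ P ∩ ball q r := ⟨hq, mem_ball_self hr⟩
    rw [h] at this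
    simpa using this.2

theorem not_mem_closure_of_half_ball {r : ℝ}
    (h : P ∩ ball q r = {x | x ∈ ball q r ∧ inner ℝ (x - q) m < 0}) {x : Vec d}
    (hx : x ∈ ball q r) (hpos : 0 < inner ℝ (x - q) m) : x ∉ closure P := by
  intro hc
  obtain ⟨y, ⟨hy, hy'⟩, hyP⟩ := _root_.mem_closure_iff.1 hc _
    (isOpen_ball.inter (isOpen_inner_pos q m)) ⟨hx, hpos⟩
  have : y ∈ P ∩ ball q r := ⟨hyP, hy⟩
  rw [h] at this
  exact lt_asymm this.2 hy'

/-- Near a flat boundary point there are points of `P` on the inner side, and points outside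
`closure P` on the outer side. -/
theorem exists_both_sides (hq : q ∈ flatPart P m) {O : Set (Vec d)} (hO : IsOpen O)
    (hqO : q ∈ O) :
    (∃ s > (0 : ℝ), q - s • m ∈ O ∩ P) ∧ ∃ s > (0 : ℝ), q + s • m ∈ O \ closure P := by
  obtain ⟨-, hm, r, hr, h⟩ := hq
  have hqr : q ∈ O ∩ ball q r := ⟨hqO, mem_ball_self hr⟩
  constructor
  · obtain ⟨s, hs, hsO⟩ := exists_add_smul_mem (hO.inter isOpen_ball) hqr (-m)
    rw [smul_neg, ← sub_eq_add_neg] at hsO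
    have : q - s • m ∈ P ∩ ball q r := by
      rw [h]
      refine ⟨hsO.2, ?_⟩
      simp [real_inner_smul_left, hm, hs]
    exact ⟨s, hs, hsO.1, this.1⟩
  · obtain ⟨s, hs, hsO⟩ := exists_add_smul_mem (hO.inter isOpen_ball) hqr m
    refine ⟨s, hs, hsO.1, not_mem_closure_of_half_ball h hsO.2 ?_⟩
    simp [real_inner_smul_left, hm, hs]

/-- The outward normal at a flat boundary point is unique. -/
theorem flatPart_normal_unique (hq : q ∈ flatPart P m) (hq' : q ∈ flatPart P m') : m = m' := by
  obtain ⟨-, hm, r, hr, h⟩ := hq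
  obtain ⟨-, hm', r', hr', h'⟩ := hq'
  by_contra hne
  have hlt : inner ℝ m m' < 1 := (inner_lt_one_iff_real_of_norm_eq_one hm hm').2 hne
  -- The direction `m' - m` points inwards for `m` and outwards for `m'`.
  obtain ⟨s, hs, hsO⟩ := exists_add_smul_mem (isOpen_ball.inter isOpen_ball)
    (⟨mem_ball_self hr, mem_ball_self hr'⟩ : q ∈ ball q r ∩ ball q r') (m' - m)
  have h1 : q + s • (m' - m) ∈ P ∩ ball q r := by
    rw [h]
    refine ⟨hsO.1, ?_⟩
    rw [add_sub_cancel_left, real_inner_smul_left, inner_sub_left, real_inner_self_eq_norm_sq, hm,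
      real_inner_comm]
    nlinarith
  have h2 : q + s • (m' - m) ∈ P ∩ ball q r' := ⟨h1.1, hsO.2⟩
  rw [h'] at h2
  have := h2.2
  rw [add_sub_cancel_left, real_inner_smul_left, inner_sub_left, real_inner_self_eq_norm_sq,
    hm'] at this
  nlinarith

theorem inner_eq_zero_of_half_ball (hP : IsOpen P) {r : ℝ}
    (h : P ∩ ball q r = {x | x ∈ ball q r ∧ inner ℝ (x - q) m < 0}) {x : Vec d}
    (hx : x ∈ ball q r) (hxP : x ∈ frontier P) : inner ℝ (x - q) m = 0 := by
  rw [hP.frontier_eq] at hxP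
  refine le_antisymm (not_lt.1 fun hpos => not_mem_closure_of_half_ball h hx hpos hxP.1)
    (not_lt.1 fun hneg => hxP.2 ?_)
  have : x ∈ P ∩ ball q r := by rw [h]; exact ⟨hx, hneg⟩
  exact this.1

/-- The flat boundary points close to a flat boundary point have the same normal. -/
theorem eq_of_mem_half_ball (hP : IsOpen P) (hm : ‖m‖ = 1) {r : ℝ}
    (h : P ∩ ball q r = {x | x ∈ ball q r ∧ inner ℝ (x - q) m < 0}) {x : Vec d}
    (hx : x ∈ ball q r) (hxP : x ∈ flatPart P m') : m' = m := by
  have h0 := inner_eq_zero_of_half_ball hP h hx hxP.1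
  obtain ⟨s, hs, hsub⟩ := Metric.isOpen_iff.1 isOpen_ball x hx
  refine flatPart_normal_unique hxP (mem_flatPart_of_eq hP hm hs (ext fun y => ?_))
  have e : inner ℝ (y - q) m = inner ℝ (y - x) m := by
    rw [← sub_add_sub_cancel y x q, inner_add_left, h0, add_zero]
  have hy := Set.ext_iff.1 h y
  simp only [mem_inter_iff, mem_ofPred_eq, e] at hy
  constructor
  · rintro ⟨hyP, hys⟩
    exact ⟨hys, (hy.1 ⟨hyP, hsub hys⟩).2⟩
  · rintro ⟨hys, hlt⟩
    exact ⟨(hy.2 ⟨hsub hys, hlt⟩).1, hys⟩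

end Flat

/-- `P` is the interior of a closed set `S` such that membership of `S` depends only on the sides
on which a point lies of the finitely many hyperplanes `{x | x · m j = b j}`. -/
structure CutBy {d : ℕ} {ι : Type} (P S : Set (Vec d)) (m : ι → Vec d) (b : ι → ℝ) : Prop where
  norm_eq : ∀ j, ‖m j‖ = 1
  isClosed : IsClosed S
  eq_interior : P = interior S
  sides : ∀ x y, (∀ j, inner ℝ x (m j) ≤ b j ↔ inner ℝ y (m j) ≤ b j) → (x ∈ S ↔ y ∈ S)

theorem IsPolytope.exists_cutBy {d : ℕ} {P : Set (Vec d)} (hP : IsPolytope P) :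
    ∃ (ι : Type) (_ : Finite ι) (S : Set (Vec d)) (m : ι → Vec d) (b : ι → ℝ), CutBy P S m b := by
  obtain ⟨-, -, n, C, hC, rfl⟩ := hP
  choose hb q hq m b hm hCe using hC
  refine ⟨Σ i, Fin (q i), inferInstance, ⋃ i, C i, fun j => m j.1 j.2, fun j => b j.1 j.2,
    fun j => hm _ _, isClosed_iUnion_of_finite fun i => ?_, rfl, fun x y h => ?_⟩
  · rw [hCe i, ofPred_forall]
    exact isClosed_iInter fun j => isClosed_le (by fun_prop) continuous_const
  · simp only [mem_iUnion]
    refine exists_congr fun i => ?_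
    rw [hCe i]
    exact forall_congr' fun j => h ⟨i, j⟩

namespace CutBy

variable {d : ℕ} {ι : Type} {P S : Set (Vec d)} {m : ι → Vec d} {b : ι → ℝ}

theorem isOpen (h : CutBy P S m b) : IsOpen P := h.eq_interior ▸ isOpen_interior

theorem closure_subset (h : CutBy P S m b) : closure P ⊆ S :=
  h.isClosed.closure_subset_iff.2 (h.eq_interior ▸ interior_subset)

theorem interior_closure_subset (h : CutBy P S m b) : interior (closure P) ⊆ P := by
  conv_rhs => rw [h.eq_interior]
  exact interior_mono h.closure_subset

variable [Finite ι]

/-- Close to a point, the sides of the hyperplanes that avoid it are constant. -/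
theorem exists_ball_sides (m : ι → Vec d) (b : ι → ℝ) (p : Vec d) :
    ∃ ρ > 0, ∀ x ∈ ball p ρ, ∀ j, inner ℝ p (m j) ≠ b j →
      inner ℝ x (m j) ≠ b j ∧ (inner ℝ x (m j) ≤ b j ↔ inner ℝ p (m j) ≤ b j) := by
  have h : ∀ᶠ x in 𝓝 p, ∀ j, inner ℝ p (m j) ≠ b j →
      inner ℝ x (m j) ≠ b j ∧ (inner ℝ x (m j) ≤ b j ↔ inner ℝ p (m j) ≤ b j) := by
    refine eventually_all.2 fun j => ?_
    by_cases hj : inner ℝ p (m j) = b j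
    · exact Eventually.of_forall fun x hx => absurd hj hx
    have hc : Tendsto (fun x : Vec d => inner ℝ x (m j)) (𝓝 p) (𝓝 (inner ℝ p (m j))) :=
      Continuous.tendsto (by fun_prop) p
    rcases lt_or_gt_of_ne hj with hlt | hgt
    · filter_upwards [hc.eventually_lt_const hlt] with x hx _
      exact ⟨hx.ne, iff_of_true hx.le hlt.le⟩
    · filter_upwards [hc.eventually_const_lt hgt] with x hx _
      exact ⟨hx.ne', iff_of_false hx.not_ge hgt.not_ge⟩
  obtain ⟨ρ, hρ, hsub⟩ := Metric.eventually_nhds_iff_ball.1 h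
  exact ⟨ρ, hρ, hsub⟩

theorem exists_mem_hyperplane (h : CutBy P S m b) {x : Vec d} (hx : x ∈ frontier P) :
    ∃ j, inner ℝ x (m j) = b j := by
  by_contra! hne
  obtain ⟨ρ, hρ, hs⟩ := exists_ball_sides m b x
  rw [h.isOpen.frontier_eq] at hx
  refine hx.2 ?_
  rw [h.eq_interior, mem_interior_iff_mem_nhds]
  filter_upwards [ball_mem_nhds x hρ] with y hy
  exact (h.sides y x fun j => (hs y hy j (hne j)).2).2 (h.closure_subset hx.1)

/-- Near each of its points, a polytope is a cone. -/
theorem exists_cone (h : CutBy P S m b) (p : Vec d) :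
    ∃ ρ > 0, ∀ x ∈ ball p ρ, ∀ t ∈ Ioc (0 : ℝ) 1, (p + t • (x - p) ∈ P ↔ x ∈ P) := by
  obtain ⟨ρ, hρ, hs⟩ := exists_ball_sides m b p
  refine ⟨ρ, hρ, fun x hx t ht => ?_⟩
  have hball : ∀ y ∈ ball p ρ, p + t • (y - p) ∈ ball p ρ := fun y hy => by
    rw [mem_ball_iff_norm] at hy ⊢
    rw [add_sub_cancel_left, norm_smul, Real.norm_of_nonneg ht.1.le]
    exact (mul_le_of_le_one_left (norm_nonneg _) ht.2).trans_lt hy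
  have hS : ∀ y ∈ ball p ρ, (p + t • (y - p) ∈ S ↔ y ∈ S) := fun y hy =>
    h.sides _ _ fun j => by
      by_cases hj : inner ℝ p (m j) = b j
      · have e : inner ℝ y (m j) = b j + inner ℝ (y - p) (m j) := by
          rw [inner_sub_left, hj]; ring
        rw [e, inner_add_left, real_inner_smul_left, hj]
        have := ht.1
        constructor <;> intro hh <;> nlinarith
      · rw [(hs _ (hball y hy) j hj).2, (hs y hy j hj).2]
  let φ : Vec d ≃ₜ Vec d :=
    (Homeomorph.smulOfNeZero t ht.1.ne').trans (Homeomorph.addLeft (p - t • p))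
  have hφ : ∀ y, φ y = p + t • (y - p) := fun y => by
    simp only [φ, Homeomorph.trans_apply, Homeomorph.coe_addLeft, smul_sub]
    change p - t • p + t • y = _
    abel
  rw [h.eq_interior, mem_interior_iff_mem_nhds, mem_interior_iff_mem_nhds, ← hφ,
    ← φ.map_nhds_eq x, mem_map]
  refine ⟨fun hm => ?_, fun hm => ?_⟩
  · filter_upwards [hm, isOpen_ball.mem_nhds hx] with y hy hyb
    exact (hS y hyb).1 (by rw [← hφ]; exact hy)
  · filter_upwards [hm, isOpen_ball.mem_nhds hx] with y hy hyb
    rw [mem_preimage, hφ]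
    exact (hS y hyb).2 hy

end CutBy

/-- Nonempty open sets contain points off finitely many given hyperplanes. -/
theorem exists_mem_forall_inner_ne {d : ℕ} {κ : Type} [Finite κ] {O : Set (Vec d)}
    (hO : IsOpen O) (hne : O.Nonempty) (n : κ → Vec d) (c : κ → ℝ) :
    ∃ y ∈ O, ∀ k, n k ≠ 0 → inner ℝ y (n k) ≠ c k := by
  have hopen : ∀ k, IsOpen {y : Vec d | n k ≠ 0 → inner ℝ y (n k) ≠ c k} := fun k => by
    by_cases hk : n k = 0
    · simp [hk]
    · simp only [ne_eq, hk, not_false_eq_true, true_imp_iff]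
      exact isOpen_ne_fun (by fun_prop) continuous_const
  have hdense : ∀ k, Dense {y : Vec d | n k ≠ 0 → inner ℝ y (n k) ≠ c k} := fun k => by
    refine dense_iff_inter_open.2 fun V hV ⟨z, hz⟩ => ?_
    by_cases hk : n k = 0
    · exact ⟨z, hz, fun h => absurd hk h⟩
    by_cases hzc : inner ℝ z (n k) = c k
    · obtain ⟨s, hs, hsV⟩ := exists_add_smul_mem hV hz (n k)
      refine ⟨_, hsV, fun _ he => ?_⟩
      rw [inner_add_left, hzc, real_inner_smul_left, real_inner_self_eq_norm_sq] at he
      have := mul_pos hs (pow_pos (norm_pos_iff.2 hk) 2)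
      linarith
    · exact ⟨z, hz, fun _ => hzc⟩
  obtain ⟨y, hyO, hy⟩ := (dense_iInter_of_isOpen hopen hdense).inter_open_nonempty O hO hne
  exact ⟨y, hyO, fun k => mem_iInter.1 hy k⟩

section Flat

variable {d : ℕ} {P : Set (Vec d)}

theorem mem_flatPart_of_sides (hP : IsOpen P) {q m : Vec d} (hm : ‖m‖ = 1) {r : ℝ} (hr : 0 < r)
    (hin : ball q r ∩ {x | inner ℝ (x - q) m < 0} ⊆ P)
    (hout : ball q r ∩ {x | 0 < inner ℝ (x - q) m} ⊆ (closure P)ᶜ) : q ∈ flatPart P m := by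
  refine mem_flatPart_of_eq hP hm hr (Subset.antisymm ?_ fun x hx => ⟨hin hx, hx.1⟩)
  rintro x ⟨hxP, hxr⟩
  refine ⟨hxr, not_le.1 fun hge => ?_⟩
  obtain ⟨s, hs, hsO⟩ := exists_add_smul_mem (hP.inter isOpen_ball) ⟨hxP, hxr⟩ m
  refine hout ⟨hsO.2, ?_⟩ (subset_closure hsO.1)
  rw [mem_ofPred_eq, add_sub_right_comm, inner_add_left, real_inner_smul_left,
    real_inner_self_eq_norm_sq, hm]
  linarith

theorem mem_closure_half_ball (q : Vec d) {m : Vec d} (hm : ‖m‖ = 1) {r : ℝ} {x : Vec d}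
    (hx : x ∈ ball q r) (h0 : inner ℝ (x - q) m = 0) :
    x ∈ closure (ball q r ∩ {x | 0 < inner ℝ (x - q) m}) := by
  rw [_root_.mem_closure_iff]
  intro O hO hxO
  obtain ⟨s, hs, hsO⟩ := exists_add_smul_mem (hO.inter isOpen_ball) ⟨hxO, hx⟩ m
  refine ⟨_, hsO.1, hsO.2, ?_⟩
  rw [mem_ofPred_eq, add_sub_right_comm, inner_add_left, real_inner_smul_left,
    real_inner_self_eq_norm_sq, hm, h0]
  linarith

/-- A boundary point of a regular open set is flat if no other boundary points are nearby than
those of a hyperplane. -/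
theorem mem_flatPart_of_frontier_subset (hP : IsOpen P) (hreg : interior (closure P) ⊆ P)
    {q m : Vec d} (hq : q ∈ frontier P) (hm : ‖m‖ = 1) {r : ℝ} (hr : 0 < r)
    (h : ∀ x ∈ ball q r, x ∈ frontier P → inner ℝ (x - q) m = 0) :
    q ∈ flatPart P m ∨ q ∈ flatPart P (-m) := by
  have hqc : q ∈ closure P := frontier_subset_closure hq
  have hqP : q ∉ P := by rw [hP.frontier_eq] at hq; exact hq.2
  have hneg : {x : Vec d | inner ℝ (x - q) (-m) < 0} = {x | 0 < inner ℝ (x - q) m} := by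
    simp only [inner_neg_right, Left.neg_neg_iff]
  have hpos : {x : Vec d | 0 < inner ℝ (x - q) (-m)} = {x | inner ℝ (x - q) m < 0} := by
    simp only [inner_neg_right, Left.neg_pos_iff]
  have h1 := subset_or_subset_compl_closure (s := ball q r ∩ {x | 0 < inner ℝ (x - q) m})
    (((convex_ball q r).inter (convex_inner_pos q m)).isPreconnected) hP
    (disjoint_left.2 fun x hx hxP => hx.2.ne' (h x hx.1 hxP))
  have h2 := subset_or_subset_compl_closure (s := ball q r ∩ {x | inner ℝ (x - q) m < 0})
    (((convex_ball q r).inter (convex_inner_neg q m)).isPreconnected) hP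
    (disjoint_left.2 fun x hx hxP => hx.2.ne (h x hx.1 hxP))
  rcases h1 with h1 | h1 <;> rcases h2 with h2 | h2
  · -- Both sides in `P` is excluded, as `P` is the interior of its closure.
    refine absurd (hreg ?_) hqP
    rw [mem_interior_iff_mem_nhds]
    filter_upwards [ball_mem_nhds q hr] with x hx
    rcases lt_trichotomy (inner ℝ (x - q) m) 0 with h0 | h0 | h0
    · exact subset_closure (h2 ⟨hx, h0⟩)
    · exact closure_mono h1 (mem_closure_half_ball q hm hx h0)
    · exact subset_closure (h1 ⟨hx, h0⟩)
  · exact Or.inr (mem_flatPart_of_sides hP (by rwa [norm_neg]) hr (by rwa [hneg])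
      (by rwa [hpos]))
  · exact Or.inl (mem_flatPart_of_sides hP hm hr h2 h1)
  · -- Both sides outside is excluded, as `P` is open with `q` in its closure.
    obtain ⟨x, hx, hxP⟩ := _root_.mem_closure_iff.1 hqc _ isOpen_ball (mem_ball_self hr)
    exfalso
    rcases lt_trichotomy (inner ℝ (x - q) m) 0 with h0 | h0 | h0
    · exact h2 ⟨hx, h0⟩ (subset_closure hxP)
    · obtain ⟨y, hyP, hy⟩ := _root_.mem_closure_iff.1 (mem_closure_half_ball q hm hx h0) P hP hxP
      exact h1 hy (subset_closure hyP)
    · exact h1 ⟨hx, h0⟩ (subset_closure hxP)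

end Flat

namespace CutBy

variable {d : ℕ} {ι : Type} [Finite ι] {P S : Set (Vec d)} {m : ι → Vec d} {b : ι → ℝ}

/-- Flat points are dense in the boundary of a polytope, with normals from a finite list: a
segment from the outside to the inside, in general position, leaves through a point that lies on
one of the hyperplanes only. -/
theorem exists_mem_flatPart (h : CutBy P S m b) {O : Set (Vec d)} (hO : IsOpen O) {a : Vec d}
    (haO : a ∈ O) (ha : a ∈ frontier P) :
    ∃ q ∈ O, ∃ j, q ∈ flatPart P (m j) ∨ q ∈ flatPart P (-m j) := by
  obtain ⟨r, hr, hrO⟩ := Metric.isOpen_iff.1 hO a haO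
  have haP : a ∉ P := by rw [h.isOpen.frontier_eq] at ha; exact ha.2
  have hout : (ball a r ∩ (closure P)ᶜ).Nonempty := by
    by_contra hne
    refine haP (h.interior_closure_subset (mem_interior_iff_mem_nhds.2 ?_))
    filter_upwards [ball_mem_nhds a hr] with x hx
    by_contra hxc
    exact hne ⟨x, hx, hxc⟩
  have hin : (ball a r ∩ P).Nonempty :=
    _root_.mem_closure_iff.1 (frontier_subset_closure ha) _ isOpen_ball (mem_ball_self hr)
  have hm0 : ∀ j, m j ≠ 0 := fun j h0 => by simpa [h0] using h.norm_eq j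
  obtain ⟨x, ⟨hxr, hxP⟩, hx⟩ := exists_mem_forall_inner_ne
    (isOpen_ball.inter isClosed_closure.isOpen_compl) hout m b
  let c : ι → ℝ := fun j => inner ℝ x (m j) - b j
  have hc : ∀ j, c j ≠ 0 := fun j => sub_ne_zero.2 (hx j (hm0 j))
  -- If the hyperplanes `i` and `j` are not parallel, `y` avoids the hyperplane through `x` and
  -- their intersection.
  obtain ⟨y, ⟨hyr, hyP⟩, hy⟩ := exists_mem_forall_inner_ne (isOpen_ball.inter h.isOpen) hin
    (fun k : ι × ι => c k.2 • m k.1 - c k.1 • m k.2) (fun k => c k.2 * b k.1 - c k.1 * b k.2)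
  have hseg : (segment ℝ x y ∩ frontier P).Nonempty := by
    by_contra hne
    rcases subset_or_subset_compl_closure (convex_segment x y).isPreconnected h.isOpen
      (disjoint_iff_inter_eq_empty.2 (not_nonempty_iff_eq_empty.1 hne)) with h1 | h1
    · exact hxP (subset_closure (h1 (left_mem_segment ℝ x y)))
    · exact h1 (right_mem_segment ℝ x y) (subset_closure hyP)
  obtain ⟨q, hqs, hqP⟩ := hseg
  have hqr : q ∈ ball a r := (convex_ball a r).segment_subset hxr hyr hqs
  rw [segment_eq_image'] at hqs
  obtain ⟨τ, -, rfl⟩ := hqs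
  obtain ⟨i, hi⟩ := h.exists_mem_hyperplane hqP
  -- All the hyperplanes through `q` are parallel to the hyperplane `i`.
  have hpar : ∀ j, inner ℝ (x + τ • (y - x)) (m j) = b j → c j • m i = c i • m j := by
    intro j hj
    by_contra hne
    refine hy (i, j) (sub_ne_zero.2 hne) ?_
    simp only [inner_add_left, real_inner_smul_left, inner_sub_left] at hi hj
    simp only [inner_sub_right, real_inner_smul_right]
    have hτ : τ ≠ 0 := by
      rintro rfl
      exact hc i (by simp only [c]; linarith)
    refine mul_left_cancel₀ hτ ?_
    simp only [c]
    linear_combination (inner ℝ x (m j) - b j) * hi - (inner ℝ x (m i) - b i) * hj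
  obtain ⟨ρ, hρ, hs⟩ := exists_ball_sides m b (x + τ • (y - x))
  refine ⟨_, hrO hqr, i, mem_flatPart_of_frontier_subset h.isOpen h.interior_closure_subset hqP
    (h.norm_eq i) hρ fun z hz hzP => ?_⟩
  obtain ⟨j, hj⟩ := h.exists_mem_hyperplane hzP
  have hqj : inner ℝ (x + τ • (y - x)) (m j) = b j := by
    by_contra hne
    exact (hs z hz j hne).1 hj
  have h0 : c j * inner ℝ (z - (x + τ • (y - x))) (m i) = 0 := by
    rw [← real_inner_smul_right, hpar j hqj, real_inner_smul_right, inner_sub_left, hj, hqj,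
      sub_self, mul_zero]
  exact (mul_eq_zero.1 h0).resolve_left (hc j)

theorem finite_normals (h : CutBy P S m b) : {n | (flatPart P n).Nonempty}.Finite := by
  refine ((finite_range m).union (finite_range fun j => -m j)).subset ?_
  rintro n ⟨q, hq, hn, r, hr, hqr⟩
  obtain ⟨x, hx, j, hj | hj⟩ := h.exists_mem_flatPart isOpen_ball (mem_ball_self hr) hq
  · exact Or.inl ⟨j, eq_of_mem_half_ball h.isOpen hn hqr hx hj⟩
  · exact Or.inr ⟨j, eq_of_mem_half_ball h.isOpen hn hqr hx hj⟩

end CutBy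

section Local

variable {d : ℕ} {P : Set (Vec d)} {p : Vec d}

/-- The properties of a polytope near `p` on which the local description rests: it is a cone in
`ball p ρ`, and its flat points are dense in the boundary. -/
structure IsConeNear (P : Set (Vec d)) (p : Vec d) (ρ : ℝ) : Prop where
  isOpen : IsOpen P
  finite : (normalsAt P p).Finite
  cone : ∀ x ∈ ball p ρ, ∀ t ∈ Ioc (0 : ℝ) 1, (p + t • (x - p) ∈ P ↔ x ∈ P)
  dense : ∀ O : Set (Vec d), IsOpen O → (O ∩ frontier P).Nonempty →
    ∃ q ∈ O, ∃ m, q ∈ flatPart P m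

theorem exists_flat_of_mem_normalsAt {m : Vec d} (hm : m ∈ normalsAt P p) {ρ : ℝ} (hρ : 0 < ρ) :
    ∃ q ∈ ball p ρ, q ∈ flatPart P m := by
  obtain ⟨G, ⟨q₀, hq₀, rfl⟩, hp⟩ := hm
  obtain ⟨q, hq, hqc⟩ := _root_.mem_closure_iff.1 hp _ isOpen_ball (mem_ball_self hρ)
  exact ⟨q, hq, connectedComponentIn_subset _ _ hqc⟩

theorem IsPolytope.exists_isConeNear (hP : IsPolytope P) (p : Vec d) :
    ∃ ρ > 0, IsConeNear P p ρ := by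
  obtain ⟨ι, _, S, m, b, h⟩ := hP.exists_cutBy
  obtain ⟨ρ, hρ, hcone⟩ := h.exists_cone p
  refine ⟨ρ, hρ, h.isOpen, h.finite_normals.subset fun n hn => ?_, hcone, fun O hO hne => ?_⟩
  · obtain ⟨q, -, hq⟩ := exists_flat_of_mem_normalsAt hn one_pos
    exact ⟨q, hq⟩
  · obtain ⟨a, haO, ha⟩ := hne
    obtain ⟨q, hq, j, hj | hj⟩ := h.exists_mem_flatPart hO haO ha
    exacts [⟨q, hq, _, hj⟩, ⟨q, hq, _, hj⟩]

namespace IsConeNear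

variable {ρ : ℝ} {q m : Vec d}

theorem mono (h : IsConeNear P p ρ) {ρ' : ℝ} (hρ : ρ' ≤ ρ) : IsConeNear P p ρ' :=
  ⟨h.isOpen, h.finite, fun x hx => h.cone x (ball_subset_ball hρ hx), h.dense⟩

theorem mem_flatPart (h : IsConeNear P p ρ) (hq : q ∈ ball p ρ) (hqm : q ∈ flatPart P m) {t : ℝ}
    (ht : t ∈ Ioc (0 : ℝ) 1) : p + t • (q - p) ∈ flatPart P m := by
  obtain ⟨-, hm, r, hr, hqr⟩ := hqm
  obtain ⟨s, hs, hsub⟩ := Metric.isOpen_iff.1 (isOpen_ball.inter isOpen_ball) q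
    (⟨hq, mem_ball_self hr⟩ : q ∈ ball p ρ ∩ ball q r)
  refine mem_flatPart_of_eq h.isOpen hm (mul_pos ht.1 hs) (ext fun y => ?_)
  obtain ⟨x, rfl⟩ : ∃ x, y = p + t • (x - p) := by
    refine ⟨p + t⁻¹ • (y - p), ?_⟩
    rw [add_sub_cancel_left, smul_inv_smul₀ ht.1.ne', add_sub_cancel]
  have e : p + t • (x - p) - (p + t • (q - p)) = t • (x - q) := by
    rw [add_sub_add_left_eq_sub, ← smul_sub, sub_sub_sub_cancel_right]
  have hb : p + t • (x - p) ∈ ball (p + t • (q - p)) (t * s) ↔ x ∈ ball q s := by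
    rw [mem_ball_iff_norm, mem_ball_iff_norm, e, norm_smul, Real.norm_of_nonneg ht.1.le,
      mul_lt_mul_iff_right₀ ht.1]
  simp only [mem_inter_iff, mem_ofPred_eq, hb, e, real_inner_smul_left]
  rw [and_comm]
  refine and_congr_right fun hx => ?_
  rw [h.cone x (hsub hx).1 t ht, mul_neg_iff]
  have := Set.ext_iff.1 hqr x
  simp only [mem_inter_iff, mem_ofPred_eq, (hsub hx).2, and_true, true_and] at this
  simp [this, ht.1, ht.1.not_gt]

/-- The hyperplane of a flat point near `p` passes through `p`. -/
theorem inner_eq_zero (h : IsConeNear P p ρ) (hq : q ∈ ball p ρ) (hqm : q ∈ flatPart P m) :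
    inner ℝ (q - p) m = 0 := by
  obtain ⟨-, hm, r, hr, hqr⟩ := id hqm
  obtain ⟨s, hs, hsr⟩ := exists_add_smul_mem (isOpen_ball (x := q) (ε := r)) (mem_ball_self hr)
    (p - q)
  -- Points `p + t (q - p)`, `t < 1`, close to `q` are boundary points, hence on its hyperplane.
  have hs' : 0 < min s (1 / 2) := by positivity
  have hball : q + min s (1 / 2) • (p - q) ∈ ball q r := by
    rw [mem_ball_iff_norm, add_sub_cancel_left, norm_smul] at hsr ⊢
    refine lt_of_le_of_lt ?_ hsr
    gcongr
    rw [Real.norm_of_nonneg hs'.le, Real.norm_of_nonneg hs.le]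
    exact min_le_left _ _
  have hfl := h.mem_flatPart hq hqm (t := 1 - min s (1 / 2))
    ⟨by have := min_le_right s (1 / 2); linarith, by linarith⟩
  have e : p + (1 - min s (1 / 2)) • (q - p) = q + min s (1 / 2) • (p - q) := by
    rw [sub_smul, one_smul, ← neg_sub p q, smul_neg]; abel
  rw [e] at hfl
  have h0 := inner_eq_zero_of_half_ball h.isOpen hqr hball hfl.1
  rw [add_sub_cancel_left, real_inner_smul_left] at h0
  have := (mul_eq_zero.1 h0).resolve_left hs'.ne'
  rw [← neg_sub, inner_neg_left, this, neg_zero]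

/-- The faces that come close to `p` contain `p`. -/
theorem exists_isFacet (h : IsConeNear P p ρ) (hq : q ∈ ball p ρ) (hqm : q ∈ flatPart P m) :
    ∃ G, IsFacet P m G ∧ p ∈ G ∧ q ∈ G := by
  refine ⟨_, ⟨q, hqm, rfl⟩, ?_, subset_closure (mem_connectedComponentIn hqm)⟩
  have hcont : Continuous fun t : ℝ => p + t • (q - p) := by fun_prop
  have hsub : (fun t : ℝ => p + t • (q - p)) '' Ioc 0 1 ⊆
      connectedComponentIn (flatPart P m) q := by
    refine IsPreconnected.subset_connectedComponentIn
      (isPreconnected_Ioc.image _ hcont.continuousOn) ⟨1, by simp, by simp⟩ ?_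
    rintro _ ⟨t, ht, rfl⟩
    exact h.mem_flatPart hq hqm ht
  refine closure_mono hsub ?_
  have h0 : (0 : ℝ) ∈ closure (Ioc 0 1) := by
    rw [closure_Ioc zero_ne_one]; exact ⟨le_rfl, zero_le_one⟩
  simpa using image_closure_subset_closure_image hcont ⟨0, h0, rfl⟩

theorem mem_normalsAt (h : IsConeNear P p ρ) (hq : q ∈ ball p ρ) (hqm : q ∈ flatPart P m) :
    m ∈ normalsAt P p := by
  obtain ⟨G, hG, hp, -⟩ := h.exists_isFacet hq hqm
  exact ⟨G, hG, hp⟩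

theorem mem_facetsThrough (h : IsConeNear P p ρ) (hq : q ∈ ball p ρ) (hqm : q ∈ flatPart P m) :
    q ∈ facetsThrough P p := by
  obtain ⟨G, hG, hp, hqG⟩ := h.exists_isFacet hq hqm
  exact ⟨m, G, hG, hp, hqG⟩

end IsConeNear

/-- Near an outwards pointing face, a polytope is the intersection of the half-spaces given by
its normals. -/
theorem IsPolytope.exists_outward (hP : IsPolytope P) (hp : p ∈ frontier P)
    (hout : IsOutwardAt P p) :
    ∃ ρ > 0, ∀ ρ' ∈ Ioc 0 ρ, IsPreconnected (P ∩ ball p ρ') ∧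
      ∀ x ∈ ball p ρ', x ∈ P ↔ ∀ m ∈ normalsAt P p, inner ℝ (x - p) m < 0 := by
  obtain ⟨ρ₁, hρ₁, hcone⟩ := hP.exists_isConeNear p
  obtain ⟨V, hV, hV'⟩ := hout
  obtain ⟨ρ₂, hρ₂, hρV⟩ := Metric.mem_nhds_iff.1 hV
  refine ⟨min ρ₁ ρ₂, lt_min hρ₁ hρ₂, fun ρ hρ => ?_⟩
  have h := hcone.mono (hρ.2.trans (min_le_left _ _))
  have hsubV : ball p ρ ⊆ V := (ball_subset_ball (hρ.2.trans (min_le_right _ _))).trans hρV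
  have hflat : ∀ q ∈ ball p ρ, ∀ m, q ∈ flatPart P m → ∀ m' ∈ normalsAt P p,
      inner ℝ (q - p) m' ≤ 0 := fun q hq m hqm m' hm' =>
    hV' q ⟨h.mem_facetsThrough hq hqm, hsubV hq⟩ q ⟨h.mem_facetsThrough hq hqm, hsubV hq⟩ q
      (left_mem_segment ℝ q q) m' hm'
  -- The outer half-balls are disjoint from the boundary and contain exterior points.
  have hle : ∀ x ∈ ball p ρ, x ∈ P → ∀ m ∈ normalsAt P p, inner ℝ (x - p) m < 0 := by
    intro x hx hxP m hm
    obtain ⟨q, hq, hqm⟩ := exists_flat_of_mem_normalsAt hm hρ.1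
    have hm1 : ‖m‖ = 1 := hqm.2.1
    have hdisj : Disjoint (ball p ρ ∩ {x | 0 < inner ℝ (x - p) m}) (frontier P) := by
      rw [disjoint_iff_inter_eq_empty]
      by_contra hne
      obtain ⟨q', hq', m', hm'⟩ := h.dense _ (isOpen_ball.inter (isOpen_inner_pos p m))
        (nonempty_iff_ne_empty.2 hne)
      exact (hflat q' hq'.1 m' hm' m hm).not_gt hq'.2
    obtain ⟨s, hs, hsO, hsP⟩ := (exists_both_sides hqm isOpen_ball hq).2
    have hext := (subset_or_subset_compl_closure
      ((convex_ball p ρ).inter (convex_inner_pos p m)).isPreconnected h.isOpen hdisj).resolve_left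
      fun hsub => hsP (subset_closure (hsub ⟨hsO, by
        rw [mem_ofPred_eq, add_sub_right_comm, inner_add_left, h.inner_eq_zero hq hqm,
          real_inner_smul_left, real_inner_self_eq_norm_sq, hm1]
        linarith⟩))
    by_contra hge
    obtain ⟨t, ht, htO⟩ := exists_add_smul_mem (h.isOpen.inter isOpen_ball) ⟨hxP, hx⟩ m
    refine hext ⟨htO.2, ?_⟩ (subset_closure htO.1)
    rw [mem_ofPred_eq, add_sub_right_comm, inner_add_left, real_inner_smul_left,
      real_inner_self_eq_norm_sq, hm1]
    linarith [not_lt.1 hge]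
  let C : Set (Vec d) := ball p ρ ∩ ⋂ m ∈ normalsAt P p, {x | inner ℝ (x - p) m < 0}
  have hCconv : Convex ℝ C :=
    (convex_ball p ρ).inter (convex_iInter₂ fun m _ => convex_inner_neg p m)
  have hCopen : IsOpen C :=
    isOpen_ball.inter (h.finite.isOpen_biInter fun m _ => isOpen_inner_neg p m)
  have hPC : P ∩ ball p ρ ⊆ C := fun x hx => ⟨hx.2, mem_iInter₂.2 fun m hm => hle x hx.2 hx.1 m hm⟩
  have hdisj : Disjoint C (frontier P) := by
    rw [disjoint_iff_inter_eq_empty]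
    by_contra hne
    obtain ⟨q, hq, m, hm⟩ := h.dense _ hCopen (nonempty_iff_ne_empty.2 hne)
    have := mem_iInter₂.1 hq.2 m (h.mem_normalsAt hq.1 hm)
    exact this.ne (h.inner_eq_zero hq.1 hm)
  have hCP : C ⊆ P := by
    refine (subset_or_subset_compl_closure hCconv.isPreconnected h.isOpen hdisj).resolve_right
      fun hsub => ?_
    obtain ⟨x, hx, hxP⟩ := _root_.mem_closure_iff.1 (frontier_subset_closure hp) _ isOpen_ball
      (mem_ball_self hρ.1)
    exact hsub (hPC ⟨hxP, hx⟩) (subset_closure hxP)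
  have hPCeq : P ∩ ball p ρ = C := hPC.antisymm fun x hx => ⟨hCP hx, hx.1⟩
  exact ⟨hPCeq ▸ hCconv.isPreconnected, fun x hx =>
    ⟨hle x hx, fun hall => hCP ⟨hx, mem_iInter₂.2 hall⟩⟩⟩

/-- Near an inwards pointing face, a polytope is the union of the half-spaces given by its
normals: its complement is the convex cone on the outer side of all of them. -/
theorem IsPolytope.exists_inward (hP : IsPolytope P) (hp : p ∈ frontier P)
    (hin : IsInwardAt P p) :
    ∃ ρ > 0, ∀ ρ' ∈ Ioc 0 ρ, IsPreconnected (P ∩ ball p ρ') ∧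
      ∀ x ∈ ball p ρ', x ∈ P ↔ ∃ m ∈ normalsAt P p, inner ℝ (x - p) m < 0 := by
  obtain ⟨ρ₁, hρ₁, hcone⟩ := hP.exists_isConeNear p
  obtain ⟨V, hV, hV'⟩ := hin
  obtain ⟨ρ₂, hρ₂, hρV⟩ := Metric.mem_nhds_iff.1 hV
  refine ⟨min ρ₁ ρ₂, lt_min hρ₁ hρ₂, fun ρ hρ => ?_⟩
  have h := hcone.mono (hρ.2.trans (min_le_left _ _))
  have hsubV : ball p ρ ⊆ V := (ball_subset_ball (hρ.2.trans (min_le_right _ _))).trans hρV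
  have hflat : ∀ q ∈ ball p ρ, ∀ m, q ∈ flatPart P m → ∀ m' ∈ normalsAt P p,
      0 ≤ inner ℝ (q - p) m' := fun q hq m hqm m' hm' =>
    hV' q ⟨h.mem_facetsThrough hq hqm, hsubV hq⟩ q ⟨h.mem_facetsThrough hq hqm, hsubV hq⟩ q
      (left_mem_segment ℝ q q) m' hm'
  have hhalf : ∀ m ∈ normalsAt P p, ball p ρ ∩ {x | inner ℝ (x - p) m < 0} ⊆ P := by
    intro m hm
    obtain ⟨q, hq, hqm⟩ := exists_flat_of_mem_normalsAt hm hρ.1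
    have hm1 : ‖m‖ = 1 := hqm.2.1
    have hdisj : Disjoint (ball p ρ ∩ {x | inner ℝ (x - p) m < 0}) (frontier P) := by
      rw [disjoint_iff_inter_eq_empty]
      by_contra hne
      obtain ⟨q', hq', m', hm'⟩ := h.dense _ (isOpen_ball.inter (isOpen_inner_neg p m))
        (nonempty_iff_ne_empty.2 hne)
      exact (hflat q' hq'.1 m' hm' m hm).not_gt hq'.2
    obtain ⟨s, hs, hsO, hsP⟩ := (exists_both_sides hqm isOpen_ball hq).1
    refine (subset_or_subset_compl_closure
      ((convex_ball p ρ).inter (convex_inner_neg p m)).isPreconnected h.isOpen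
      hdisj).resolve_right fun hsub => hsub ⟨hsO, ?_⟩ (subset_closure hsP)
    rw [mem_ofPred_eq, sub_right_comm, inner_sub_left, h.inner_eq_zero hq hqm,
      real_inner_smul_left, real_inner_self_eq_norm_sq, hm1]
    linarith
  let D : Set (Vec d) := ball p ρ ∩ ⋂ m ∈ normalsAt P p, {x | 0 < inner ℝ (x - p) m}
  have hDconv : Convex ℝ D :=
    (convex_ball p ρ).inter (convex_iInter₂ fun m _ => convex_inner_pos p m)
  have hDopen : IsOpen D :=
    isOpen_ball.inter (h.finite.isOpen_biInter fun m _ => isOpen_inner_pos p m)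
  have hdisj : Disjoint D (frontier P) := by
    rw [disjoint_iff_inter_eq_empty]
    by_contra hne
    obtain ⟨q, hq, m, hm⟩ := h.dense _ hDopen (nonempty_iff_ne_empty.2 hne)
    have := mem_iInter₂.1 hq.2 m (h.mem_normalsAt hq.1 hm)
    exact this.ne' (h.inner_eq_zero hq.1 hm)
  -- An exterior point near `p`; it lies in `D`.
  obtain ⟨e, heρ, heP, heD⟩ : ∃ e ∈ ball p ρ, e ∉ closure P ∧ e ∈ D := by
    obtain ⟨q, hq, m, hqm⟩ := h.dense _ isOpen_ball ⟨p, mem_ball_self hρ.1, hp⟩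
    obtain ⟨s, hs, hsO, hsP⟩ := (exists_both_sides hqm isOpen_ball hq).2
    refine ⟨_, hsO, hsP, hsO, mem_iInter₂.2 fun m' hm' => ?_⟩
    rw [mem_ofPred_eq]
    by_contra hle
    have hm1 : ‖m'‖ = 1 := by
      obtain ⟨q', -, hq'⟩ := exists_flat_of_mem_normalsAt hm' hρ.1
      exact hq'.2.1
    obtain ⟨t, ht, htO, htP⟩ := exists_add_smul_mem
      (isOpen_ball.inter isClosed_closure.isOpen_compl) ⟨hsO, hsP⟩ (-m')
    refine htP (subset_closure (hhalf m' hm' ⟨htO, ?_⟩))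
    rw [mem_ofPred_eq, add_sub_right_comm, inner_add_left, real_inner_smul_left, inner_neg_left,
      real_inner_self_eq_norm_sq, hm1]
    linarith [not_lt.1 hle]
  have hDP : D ⊆ (closure P)ᶜ :=
    (subset_or_subset_compl_closure hDconv.isPreconnected h.isOpen hdisj).resolve_left
      fun hsub => heP (subset_closure (hsub heD))
  have hiff : ∀ x ∈ ball p ρ, x ∈ P ↔ ∃ m ∈ normalsAt P p, inner ℝ (x - p) m < 0 := by
    intro x hx
    refine ⟨fun hxP => ?_, fun ⟨m, hm, hneg⟩ => hhalf m hm ⟨hx, hneg⟩⟩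
    by_contra! hge
    -- Otherwise a small shift of `x` in the direction `e - p` leads into `D`.
    obtain ⟨t, ht, htO⟩ := exists_add_smul_mem (h.isOpen.inter isOpen_ball) ⟨hxP, hx⟩ (e - p)
    refine hDP ⟨htO.2, mem_iInter₂.2 fun m hm => ?_⟩ (subset_closure htO.1)
    rw [mem_ofPred_eq, add_sub_right_comm, inner_add_left, real_inner_smul_left]
    have h1 := mul_pos ht (mem_iInter₂.1 heD.2 m hm)
    have h2 := hge m hm
    linarith
  refine ⟨?_, hiff⟩
  -- The half-balls have the reflection of `e` in common.
  have hunion : P ∩ ball p ρ =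
      ⋃ m ∈ normalsAt P p, ball p ρ ∩ {x | inner ℝ (x - p) m < 0} := by
    ext x
    simp only [mem_iUnion₂, mem_inter_iff, mem_ofPred_eq]
    exact ⟨fun hx => ((hiff x hx.2).1 hx.1).imp fun m hm => ⟨hm.1, hx.2, hm.2⟩,
      fun ⟨m, hm, hx, hneg⟩ => ⟨hhalf m hm ⟨hx, hneg⟩, hx⟩⟩
  rw [hunion, biUnion_eq_iUnion]
  refine isPreconnected_iUnion ⟨p - (e - p), mem_iInter.2 fun m => ⟨?_, ?_⟩⟩ fun m =>
    ((convex_ball p ρ).inter (convex_inner_neg p m)).isPreconnected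
  · rw [mem_ball_iff_norm] at heρ ⊢
    rwa [sub_right_comm, sub_self, zero_sub, norm_neg]
  · rw [mem_ofPred_eq, sub_right_comm, sub_self, zero_sub, inner_neg_left, Left.neg_neg_iff]
    exact mem_iInter₂.1 heD.2 m m.2

end Local

/-! ### Blowing up a domain at a point -/

/-- The data for a blow-up of `Ω` at `x₀`: a map `g` with inverse `h`, `C¹` up to the boundary near
`x₀`, with gradient `A` at `x₀`, such that the rescalings `z ↦ A⁻¹ (g x - g x₀) / ε` carry the part
of `Ω` near `x₀` where they take values in the unit ball onto one and the same open set `D`. -/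
structure IsBlowUp {d : ℕ} (Ω : Set (Vec d)) (x₀ : Vec d) (D : Set (Vec d))
    (g h : Vec d → Vec d) (A : Vec d ≃L[ℝ] Vec d) (r ε₀ : ℝ) : Prop where
  r_pos : 0 < r
  ε_pos : 0 < ε₀
  mem : x₀ ∈ closure Ω
  g_C1 : C1UpTo (ball x₀ r ∩ Ω) (ball x₀ r ∩ closure Ω) g
  leftInv : LeftInvOn h g (ball x₀ r ∩ closure Ω)
  h_C1 : C1UpTo (g '' (ball x₀ r ∩ Ω)) (g '' (ball x₀ r ∩ closure Ω)) h
  image_open : IsOpen (g '' (ball x₀ r ∩ Ω))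
  grad_eq : grad (ball x₀ r ∩ Ω) g x₀ = A
  D_open : IsOpen D
  D_subset : D ⊆ ball 0 1
  to_image : ∀ ε ∈ Ioo 0 ε₀, ∀ z ∈ D, g x₀ + ε • A z ∈ g '' (ball x₀ r ∩ Ω)
  of_image : ∀ ε ∈ Ioo 0 ε₀, ∀ x ∈ ball x₀ r ∩ Ω, ∀ z ∈ ball (0 : Vec d) 1,
    g x = g x₀ + ε • A z → z ∈ D

/-- The rescaled chart `x ↦ A⁻¹ (g x - g x₀) / ε`. -/
noncomputable def rescale {d : ℕ} (g : Vec d → Vec d) (A : Vec d ≃L[ℝ] Vec d) (x₀ : Vec d) (ε : ℝ)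
    (x : Vec d) : Vec d :=
  ε⁻¹ • A.symm (g x - g x₀)

/-- The variation obtained by transplanting `ψ` to `Ω` with the rescaled chart. -/
noncomputable def transplant {d N : ℕ} (g : Vec d → Vec d) (A : Vec d ≃L[ℝ] Vec d) (x₀ : Vec d)
    (r ε : ℝ) (ψ : Vec d → Vec N) : Vec d → Vec N :=
  (ball x₀ r).indicator fun x => ε • ψ (rescale g A x₀ ε x)

section BlowUp

variable {d N : ℕ} {Ω D : Set (Vec d)} {x₀ x : Vec d} {g h : Vec d → Vec d}
  {A : Vec d ≃L[ℝ] Vec d} {r r₁ ε₀ ε δ : ℝ} {ψ : Vec d → Vec N}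

theorem eq_add_rescale (g : Vec d → Vec d) (A : Vec d ≃L[ℝ] Vec d) (x₀ x : Vec d) (hε : ε ≠ 0) :
    g x = g x₀ + ε • A (rescale g A x₀ ε x) := by
  simp [rescale, smul_inv_smul₀ hε]

theorem rescale_eq {z : Vec d} (hε : ε ≠ 0) (e : g x = g x₀ + ε • A z) :
    rescale g A x₀ ε x = z := by
  simp [rescale, e, inv_smul_smul₀ hε]

namespace IsBlowUp

theorem mem_ball_closure (B : IsBlowUp Ω x₀ D g h A r ε₀) : x₀ ∈ ball x₀ r ∩ closure Ω :=
  ⟨mem_ball_self B.r_pos, B.mem⟩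

theorem subset_ball_closure : ball x₀ r ∩ Ω ⊆ ball x₀ r ∩ closure Ω :=
  inter_subset_inter_right _ subset_closure

theorem rescale_C1 (B : IsBlowUp Ω x₀ D g h A r ε₀) (hO : IsOpen Ω) (ε : ℝ) :
    C1UpTo (ball x₀ r ∩ Ω) (ball x₀ r ∩ closure Ω) (rescale g A x₀ ε) := by
  have haff : ContDiff ℝ 1 fun y : Vec d => ε⁻¹ • A.symm (y - g x₀) :=
    ((A.symm : Vec d →L[ℝ] Vec d).contDiff.comp (contDiff_id.sub contDiff_const)).const_smul ε⁻¹
  exact (C1UpTo.of_contDiff haff univ univ).comp B.g_C1 (isOpen_ball.inter hO) isOpen_univ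
    subset_ball_closure (mapsTo_univ _ _) (mapsTo_univ _ _)

theorem rescale_mem (B : IsBlowUp Ω x₀ D g h A r ε₀) (hε : ε ∈ Ioo 0 ε₀)
    (hx : x ∈ ball x₀ r ∩ Ω) (hz : ‖rescale g A x₀ ε x‖ < 1) : rescale g A x₀ ε x ∈ D :=
  B.of_image ε hε x hx _ (by simpa using hz) (eq_add_rescale g A x₀ x hε.1.ne')

theorem exists_nhds_rescale (B : IsBlowUp Ω x₀ D g h A r ε₀) (hO : IsOpen Ω)
    (hx : x ∈ ball x₀ r ∩ closure Ω) {W : Set (Vec d)} (hW : IsOpen W)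
    (hxW : rescale g A x₀ ε x ∈ W) :
    ∃ V, IsOpen V ∧ x ∈ V ∧ V ⊆ ball x₀ r ∧ ∀ y ∈ V ∩ closure Ω, rescale g A x₀ ε y ∈ W := by
  obtain ⟨V, hV, hxV, hsub⟩ := mem_nhdsWithin.1
    ((B.rescale_C1 hO ε).2.1 x hx (hW.mem_nhds hxW))
  exact ⟨V ∩ ball x₀ r, hV.inter isOpen_ball, ⟨hxV, hx.1⟩, inter_subset_right,
    fun y hy => hsub ⟨hy.1.1, hy.1.2, hy.2⟩⟩

theorem rescale_mem_closure (B : IsBlowUp Ω x₀ D g h A r ε₀) (hO : IsOpen Ω)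
    (hε : ε ∈ Ioo 0 ε₀) (hx : x ∈ ball x₀ r ∩ closure Ω) (hz : ‖rescale g A x₀ ε x‖ < 1) :
    rescale g A x₀ ε x ∈ closure D := by
  obtain ⟨V, hV, hxV, hVr, hVW⟩ := B.exists_nhds_rescale hO hx
    (isOpen_lt continuous_norm continuous_const) hz
  have hxc : x ∈ closure (V ∩ Ω) := hV.inter_closure ⟨hxV, hx.2⟩
  refine (((B.rescale_C1 hO ε).2.1 x hx).mono fun y hy =>
    ⟨hVr hy.1, subset_closure hy.2⟩).mem_closure hxc fun y hy => ?_
  exact B.rescale_mem hε ⟨hVr hy.1, hy.2⟩ (hVW y ⟨hy.1, subset_closure hy.2⟩)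

theorem transplant_eq_zero (hψ : ∀ z, 1 - δ ≤ ‖z‖ → ψ z = 0) (hδ : 0 < δ)
    (hx : x ∈ ball x₀ r → 1 ≤ ‖rescale g A x₀ ε x‖) : transplant g A x₀ r ε ψ x = 0 := by
  by_cases hr : x ∈ ball x₀ r
  · rw [transplant, indicator_of_mem hr, hψ _ (by linarith [hx hr]), smul_zero]
  · exact indicator_of_notMem hr _

theorem transplant_C1 (B : IsBlowUp Ω x₀ D g h A r ε₀) (hO : IsOpen Ω) (hε : ε ∈ Ioo 0 ε₀)
    (hr₁ : r₁ < r)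
    (hsmall : ∀ x ∈ ball x₀ r ∩ closure Ω, ‖rescale g A x₀ ε x‖ < 1 → x ∈ ball x₀ r₁)
    (hψ : C1UpTo D (closure D) ψ) (hδ : 0 < δ) (hψ0 : ∀ z, 1 - δ ≤ ‖z‖ → ψ z = 0) :
    C1UpTo Ω (closure Ω) (transplant g A x₀ r ε ψ) := by
  have hzero : ∀ V, IsOpen V → EqOn (transplant g A x₀ r ε ψ) (fun _ => 0) (closure Ω ∩ V) →
      C1UpTo (Ω ∩ V) (closure Ω ∩ V) (transplant g A x₀ r ε ψ) := fun V hV h0 =>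
    (C1UpTo.of_contDiff (contDiff_const (c := (0 : Vec N))) _ _).congr (hO.inter hV)
      (inter_subset_inter_left _ subset_closure) h0
  refine C1UpTo.of_local hO subset_closure fun x hx => ?_
  by_cases hxr : x ∈ closedBall x₀ r₁
  · have hxr : x ∈ ball x₀ r := closedBall_subset_ball hr₁ hxr
    rcases lt_or_ge ‖rescale g A x₀ ε x‖ 1 with hlt | hge
    · obtain ⟨V, hV, hxV, hVr, hVW⟩ := B.exists_nhds_rescale hO ⟨hxr, hx⟩
        (isOpen_lt continuous_norm continuous_const) hlt
      refine ⟨V, hV, hxV, ?_⟩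
      have hsub : Ω ∩ V ⊆ closure Ω ∩ V := inter_subset_inter_left _ subset_closure
      have hζ : C1UpTo (Ω ∩ V) (closure Ω ∩ V) (rescale g A x₀ ε) :=
        (B.rescale_C1 hO ε).mono (fun y hy => ⟨hVr hy.2, hy.1⟩) fun y hy => ⟨hVr hy.2, hy.1⟩
      have hcomp := (hψ.comp hζ (hO.inter hV) B.D_open hsub
        (fun y hy => B.rescale_mem hε ⟨hVr hy.2, hy.1⟩ (hVW y ⟨hy.2, subset_closure hy.1⟩))
        fun y hy => B.rescale_mem_closure hO hε ⟨hVr hy.2, hy.1⟩ (hVW y ⟨hy.2, hy.1⟩))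
      refine (hcomp.const_smul (hO.inter hV) hsub ε).congr (hO.inter hV) hsub fun y hy => ?_
      exact indicator_of_mem (hVr hy.2) _
    · obtain ⟨V, hV, hxV, hVr, hVW⟩ := B.exists_nhds_rescale hO ⟨hxr, hx⟩
        (isOpen_lt continuous_const continuous_norm : IsOpen {z : Vec d | 1 - δ < ‖z‖})
        (show 1 - δ < _ by linarith)
      refine ⟨V, hV, hxV, hzero V hV fun y hy => ?_⟩
      rw [transplant, indicator_of_mem (hVr hy.2), hψ0 _ (hVW y ⟨hy.2, hy.1⟩).le, smul_zero]
  · refine ⟨(closedBall x₀ r₁)ᶜ, isClosed_closedBall.isOpen_compl, hxr,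
      hzero _ isClosed_closedBall.isOpen_compl fun y hy => ?_⟩
    refine transplant_eq_zero hψ0 hδ fun hyr => not_lt.1 fun hlt => hy.2 ?_
    exact ball_subset_closedBall (hsmall y ⟨hyr, hy.1⟩ hlt)

/-- On the part of `Ω` that corresponds to `D` the gradient of the transplanted map is of order
one. -/
theorem fderiv_transplant (B : IsBlowUp Ω x₀ D g h A r ε₀) (hO : IsOpen Ω) (hε : ε ∈ Ioo 0 ε₀)
    (hψ : C1UpTo D (closure D) ψ) (hx : x ∈ ball x₀ r ∩ Ω) (hz : rescale g A x₀ ε x ∈ D) :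
    fderiv ℝ (transplant g A x₀ r ε ψ) x =
      (fderiv ℝ ψ (rescale g A x₀ ε x)).comp
        ((A.symm : Vec d →L[ℝ] Vec d).comp (fderiv ℝ g x)) := by
  have hloc : transplant g A x₀ r ε ψ =ᶠ[𝓝 x] fun x => ε • ψ (rescale g A x₀ ε x) := by
    filter_upwards [isOpen_ball.mem_nhds hx.1] with y hy using indicator_of_mem hy _
  have hg : HasFDerivAt g (fderiv ℝ g x) x :=
    (B.g_C1.differentiableAt (isOpen_ball.inter hO) hx).hasFDerivAt
  have hζ : HasFDerivAt (rescale g A x₀ ε)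
      (ε⁻¹ • (A.symm : Vec d →L[ℝ] Vec d).comp (fderiv ℝ g x)) x :=
    ((A.symm : Vec d →L[ℝ] Vec d).hasFDerivAt.comp x (hg.sub_const (g x₀))).const_smul ε⁻¹
  have hψz := (hψ.differentiableAt B.D_open hz).hasFDerivAt
  have hall : HasFDerivAt (fun x => ε • ψ (rescale g A x₀ ε x)) _ x :=
    (hψz.comp x hζ).const_smul ε
  rw [hloc.fderiv_eq, hall.fderiv, ContinuousLinearMap.comp_smul, smul_inv_smul₀ hε.1.ne']

theorem fderiv_transplant_eq_zero (B : IsBlowUp Ω x₀ D g h A r ε₀) (hO : IsOpen Ω)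
    (hr₁ : r₁ < r)
    (hsmall : ∀ x ∈ ball x₀ r ∩ closure Ω, ‖rescale g A x₀ ε x‖ < 1 → x ∈ ball x₀ r₁)
    (hδ : 0 < δ) (hψ0 : ∀ z, 1 - δ ≤ ‖z‖ → ψ z = 0)
    (hx : x ∈ Ω) (hxr : x ∈ ball x₀ r → 1 ≤ ‖rescale g A x₀ ε x‖) :
    fderiv ℝ (transplant g A x₀ r ε ψ) x = 0 := by
  have hloc : transplant g A x₀ r ε ψ =ᶠ[𝓝 x] fun _ => 0 := by
    by_cases hr : x ∈ closedBall x₀ r₁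
    · have hr := closedBall_subset_ball hr₁ hr
      obtain ⟨V, hV, hxV, hVr, hVW⟩ := B.exists_nhds_rescale hO ⟨hr, subset_closure hx⟩
        (isOpen_lt continuous_const continuous_norm : IsOpen {z : Vec d | 1 - δ < ‖z‖})
        (show 1 - δ < _ by linarith [hxr hr])
      filter_upwards [hV.mem_nhds hxV, hO.mem_nhds hx] with y hyV hy
      rw [transplant, indicator_of_mem (hVr hyV), hψ0 _ (hVW y ⟨hyV, subset_closure hy⟩).le,
        smul_zero]
    · filter_upwards [isClosed_closedBall.isOpen_compl.mem_nhds hr, hO.mem_nhds hx] with y hyr hy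
      refine transplant_eq_zero hψ0 hδ fun hyb => not_lt.1 fun hlt => hyr ?_
      exact ball_subset_closedBall (hsmall y ⟨hyb, subset_closure hy⟩ hlt)
  rw [hloc.fderiv_eq, fderiv_fun_const, Pi.zero_apply]

theorem norm_smul_apply_lt {ε η : ℝ} (hε : 0 < ε)
    (h : ε < η / (‖(A : Vec d →L[ℝ] Vec d)‖ + 1)) {z : Vec d} (hz : ‖z‖ < 1) :
    ‖ε • A z‖ < η := by
  have hc : 0 < ‖(A : Vec d →L[ℝ] Vec d)‖ + 1 := by positivity
  have h1 : ‖A z‖ ≤ ‖(A : Vec d →L[ℝ] Vec d)‖ * ‖z‖ := (A : Vec d →L[ℝ] Vec d).le_opNorm z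
  have h2 := mul_le_of_le_one_right (norm_nonneg (A : Vec d →L[ℝ] Vec d)) hz.le
  rw [norm_smul, Real.norm_of_nonneg hε.le]
  calc ε * ‖A z‖ ≤ ε * (‖(A : Vec d →L[ℝ] Vec d)‖ + 1) :=
        mul_le_mul_of_nonneg_left (by linarith) hε.le
    _ < η := (lt_div_iff₀ hc).1 h

/-- Properties that hold near `g x₀` in the image of the chart hold, for small `ε`, at all points
that correspond to `D`. -/
theorem eventually_forall (B : IsBlowUp Ω x₀ D g h A r ε₀) {Q : Vec d → Prop}
    (hQ : ∀ᶠ y in 𝓝[g '' (ball x₀ r ∩ Ω)] (g x₀), Q y) :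
    ∀ᶠ ε in 𝓝[>] (0 : ℝ), ∀ z ∈ D, Q (g x₀ + ε • A z) := by
  obtain ⟨η, hη, hsub⟩ := Metric.mem_nhdsWithin_iff.1 hQ
  filter_upwards [Ioo_mem_nhdsGT (show (0 : ℝ) < min ε₀ (η / (‖(A : Vec d →L[ℝ] Vec d)‖ + 1)) from
    lt_min B.ε_pos (by positivity))] with ε hε z hz
  refine hsub ⟨?_, B.to_image ε ⟨hε.1, hε.2.trans_le (min_le_left _ _)⟩ z hz⟩
  rw [mem_ball_iff_norm, add_sub_cancel_left]
  exact norm_smul_apply_lt hε.1 (hε.2.trans_le (min_le_right _ _)) (by simpa using B.D_subset hz)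

theorem eventually_small (B : IsBlowUp Ω x₀ D g h A r ε₀) (hr₁ : 0 < r₁) :
    ∀ᶠ ε in 𝓝[>] (0 : ℝ), ∀ x ∈ ball x₀ r ∩ closure Ω, ‖rescale g A x₀ ε x‖ < 1 →
      x ∈ ball x₀ r₁ := by
  have hx₀ := B.mem_ball_closure
  have hmem : Tendsto h (𝓝[g '' (ball x₀ r ∩ closure Ω)] (g x₀)) (𝓝 (h (g x₀))) :=
    B.h_C1.2.1 (g x₀) (mem_image_of_mem g hx₀)
  rw [B.leftInv hx₀] at hmem
  have hev := hmem.eventually_mem (ball_mem_nhds x₀ hr₁)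
  obtain ⟨η, hη, hsub⟩ := Metric.mem_nhdsWithin_iff.1 hev
  filter_upwards [Ioo_mem_nhdsGT (show (0 : ℝ) < η / (‖(A : Vec d →L[ℝ] Vec d)‖ + 1) by
    positivity)] with ε hε x hx hz
  have hd : ‖g x - g x₀‖ < η := by
    have e := eq_add_rescale g A x₀ x hε.1.ne'
    rw [← sub_eq_iff_eq_add'] at e
    rw [e]
    exact norm_smul_apply_lt hε.1 hε.2 hz
  have hgx : h (g x) ∈ ball x₀ r₁ := hsub ⟨mem_ball_iff_norm.2 hd, mem_image_of_mem g hx⟩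
  exact B.leftInv hx ▸ hgx

/-- The gradient of `h` is the inverse of that of `g`, also in the limit at `x₀`. -/
theorem grad_comp (B : IsBlowUp Ω x₀ D g h A r ε₀) (hO : IsOpen Ω) :
    (grad (g '' (ball x₀ r ∩ Ω)) h (g x₀)).comp (A : Vec d →L[ℝ] Vec d) =
      ContinuousLinearMap.id ℝ (Vec d) := by
  have hO' := (isOpen_ball (x := x₀) (ε := r)).inter hO
  have hx₀ := B.mem_ball_closure
  have : (𝓝[ball x₀ r ∩ Ω] x₀).NeBot := mem_closure_iff_nhdsWithin_neBot.1
    (isOpen_ball.inter_closure hx₀)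
  have hg : Tendsto g (𝓝[ball x₀ r ∩ Ω] x₀) (𝓝[g '' (ball x₀ r ∩ Ω)] (g x₀)) :=
    tendsto_nhdsWithin_iff.2 ⟨(B.g_C1.2.1 x₀ hx₀).mono_left (nhdsWithin_mono _ subset_ball_closure),
      eventually_of_mem self_mem_nhdsWithin fun x hx => mem_image_of_mem g hx⟩
  have h1 := (B.h_C1.tendsto_grad (mem_image_of_mem g hx₀)).comp hg
  have h2 := B.g_C1.tendsto_grad hx₀
  rw [B.grad_eq] at h2
  have h3 := (isBoundedBilinearMap_comp.continuous.tendsto (grad (g '' (ball x₀ r ∩ Ω)) h (g x₀),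
    (A : Vec d →L[ℝ] Vec d))).comp (h1.prodMk_nhds h2)
  refine tendsto_nhds_unique (h3.congr' ?_) tendsto_const_nhds
  filter_upwards [self_mem_nhdsWithin] with x hx
  have hh := (B.h_C1.differentiableAt B.image_open (mem_image_of_mem g hx)).hasFDerivAt
  have hgx := (B.g_C1.differentiableAt hO' hx).hasFDerivAt
  have hid : HasFDerivAt (fun x => x) ((fderiv ℝ h (g x)).comp (fderiv ℝ g x)) x := by
    refine (hh.comp x hgx).congr_of_eventuallyEq ?_
    filter_upwards [hO'.mem_nhds hx] with y hy
    exact (B.leftInv (subset_ball_closure hy)).symm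
  exact hid.unique (hasFDerivAt_id x)

end IsBlowUp

end BlowUp

section Energy

variable {d N : ℕ} {Ω ΓD D : Set (Vec d)} {ubar u₀ u w : Vec d → Vec N} {x₀ : Vec d}
  {F : Vec d → Vec N → Mat N d → ℝ} {g h : Vec d → Vec d}
  {A : Vec d ≃L[ℝ] Vec d} {r r₁ ε₀ ε δ : ℝ} {ψ : Vec d → Vec N}

theorem integrableOn_energy (hO : IsOpen Ω) (hb : Bornology.IsBounded Ω)
    (hF : ContinuousOn (fun v : Vec d × Vec N × Mat N d => F v.1 v.2.1 v.2.2)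
      (closure Ω ×ˢ Set.univ)) (hu : C1UpTo Ω (closure Ω) u) :
    IntegrableOn (fun x => F x (u x) (fderiv ℝ u x)) Ω := by
  have hc : ContinuousOn (fun x => F x (u x) (grad Ω u x)) (closure Ω) :=
    hF.comp (f := fun x => (x, u x, grad Ω u x))
      (continuousOn_id.prodMk (hu.2.1.prodMk (hu.continuousOn_grad subset_rfl)))
      fun x hx => ⟨hx, trivial⟩
  refine ((hc.integrableOn_compact hb.isCompact_closure).mono_set subset_closure).congr_fun
    (fun x hx => ?_) hO.measurableSet
  simp only [hu.grad_eq hO hx]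

theorem energy_add_sub_energy (hO : IsOpen Ω) (hb : Bornology.IsBounded Ω)
    (hF : ContinuousOn (fun v : Vec d × Vec N × Mat N d => F v.1 v.2.1 v.2.2)
      (closure Ω ×ˢ Set.univ)) (hu : C1UpTo Ω (closure Ω) u) (hw : C1UpTo Ω (closure Ω) w) :
    energy Ω F (fun x => u x + w x) - energy Ω F u =
      ∫ x in Ω, (F x (u x + w x) (grad Ω u x + fderiv ℝ w x) - F x (u x) (grad Ω u x)) := by
  rw [energy, energy, ← integral_sub (integrableOn_energy hO hb hF (hu.add hw hO))
    (integrableOn_energy hO hb hF hu)]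
  refine setIntegral_congr_fun hO.measurableSet fun x hx => ?_
  simp only [fderiv_fun_add (hu.differentiableAt hO hx) (hw.differentiableAt hO hx),
    hu.grad_eq hO hx]

namespace IsBlowUp

/-- The integrand obtained from the energy density by the change of variables
`x = h (g x₀ + ε A z)`, divided by `ε ^ d`. -/
noncomputable def blowUpIntegrand (Ω : Set (Vec d)) (F : Vec d → Vec N → Mat N d → ℝ)
    (u₀ : Vec d → Vec N) (x₀ : Vec d) (g h : Vec d → Vec d) (A : Vec d ≃L[ℝ] Vec d)
    (ψ : Vec d → Vec N) (ε : ℝ) (z : Vec d) : ℝ :=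
  let y := g x₀ + ε • A z
  |((fderiv ℝ h y).comp (A : Vec d →L[ℝ] Vec d)).det| *
    (F (h y) (u₀ (h y) + ε • ψ z) (grad Ω u₀ (h y) +
      (fderiv ℝ ψ z).comp ((A.symm : Vec d →L[ℝ] Vec d).comp (fderiv ℝ g (h y)))) -
    F (h y) (u₀ (h y)) (grad Ω u₀ (h y)))

theorem exists_preimage (B : IsBlowUp Ω x₀ D g h A r ε₀) (hε : ε ∈ Ioo 0 ε₀) {z : Vec d}
    (hz : z ∈ D) : h (g x₀ + ε • A z) ∈ ball x₀ r ∩ Ω ∧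
      g (h (g x₀ + ε • A z)) = g x₀ + ε • A z ∧ rescale g A x₀ ε (h (g x₀ + ε • A z)) = z := by
  obtain ⟨x, hx, hgx⟩ := B.to_image ε hε z hz
  rw [← hgx, B.leftInv (subset_ball_closure hx)]
  exact ⟨hx, rfl, rescale_eq hε.1.ne' hgx⟩

/-- The change of variables `x = h (g x₀ + ε A z)` in the increment of the energy. -/
theorem energy_transplant (B : IsBlowUp Ω x₀ D g h A r ε₀) (hO : IsOpen Ω)
    (hb : Bornology.IsBounded Ω)
    (hF : ContinuousOn (fun v : Vec d × Vec N × Mat N d => F v.1 v.2.1 v.2.2)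
      (closure Ω ×ˢ Set.univ)) (hu : C1UpTo Ω (closure Ω) u₀)
    (hε : ε ∈ Ioo 0 ε₀) (hr₁ : r₁ < r)
    (hsmall : ∀ x ∈ ball x₀ r ∩ closure Ω, ‖rescale g A x₀ ε x‖ < 1 → x ∈ ball x₀ r₁)
    (hψ : C1UpTo D (closure D) ψ) (hδ : 0 < δ) (hψ0 : ∀ z, 1 - δ ≤ ‖z‖ → ψ z = 0) :
    energy Ω F (fun x => u₀ x + transplant g A x₀ r ε ψ x) - energy Ω F u₀ =
      ε ^ d * ∫ z in D, blowUpIntegrand Ω F u₀ x₀ g h A ψ ε z := by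
  rw [energy_add_sub_energy hO hb hF hu (B.transplant_C1 hO hε hr₁ hsmall hψ hδ hψ0)]
  set Φ : Vec d → Vec d := fun z => h (g x₀ + ε • A z)
  have hΦ := fun z (hz : z ∈ D) => B.exists_preimage hε hz
  have hsub : Φ '' D ⊆ Ω := by rintro _ ⟨z, hz, rfl⟩; exact (hΦ z hz).1.2
  rw [setIntegral_eq_of_subset_of_forall_sdiff_eq_zero hO.measurableSet hsub]
  swap
  · rintro x ⟨hx, hxΦ⟩
    have hfar : x ∈ ball x₀ r → 1 ≤ ‖rescale g A x₀ ε x‖ := fun hxr => not_lt.1 fun hlt =>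
      hxΦ ⟨_, B.rescale_mem hε ⟨hxr, hx⟩ hlt, by
        simp only [Φ]
        rw [← eq_add_rescale g A x₀ x hε.1.ne', B.leftInv (subset_ball_closure ⟨hxr, hx⟩)]⟩
    rw [transplant_eq_zero hψ0 hδ hfar,
      B.fderiv_transplant_eq_zero hO hr₁ hsmall hδ hψ0 hx hfar, add_zero, add_zero, sub_self]
  have hderiv : ∀ z ∈ D, HasFDerivWithinAt Φ
      ((fderiv ℝ h (g x₀ + ε • A z)).comp (ε • (A : Vec d →L[ℝ] Vec d))) D z := fun z hz => by
    have h1 := (B.h_C1.differentiableAt B.image_open (B.to_image ε hε z hz)).hasFDerivAt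
    have h2 : HasFDerivAt (fun z => g x₀ + ε • A z) (ε • (A : Vec d →L[ℝ] Vec d)) z :=
      ((A : Vec d →L[ℝ] Vec d).hasFDerivAt.const_smul ε).const_add (g x₀)
    exact (h1.comp z h2).hasFDerivWithinAt
  have hinj : InjOn Φ D := fun z hz z' hz' e => by
    have e1 := (hΦ z hz).2.2
    have e2 := (hΦ z' hz').2.2
    simp only [Φ] at e
    rw [← e1, ← e2, e]
  rw [integral_image_eq_integral_abs_det_fderiv_smul volume B.D_open.measurableSet hderiv hinj,
    ← integral_const_mul]
  refine setIntegral_congr_fun B.D_open.measurableSet fun z hz => ?_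
  obtain ⟨hx, -, hresc⟩ := hΦ z hz
  have hval : transplant g A x₀ r ε ψ (Φ z) = ε • ψ z := by
    rw [transplant, indicator_of_mem hx.1, hresc]
  have hder := B.fderiv_transplant hO hε hψ hx (hresc.symm ▸ hz)
  rw [hresc] at hder
  have hdet : ((fderiv ℝ h (g x₀ + ε • A z)).comp (ε • (A : Vec d →L[ℝ] Vec d))).det =
      ε ^ d * ((fderiv ℝ h (g x₀ + ε • A z)).comp (A : Vec d →L[ℝ] Vec d)).det := by
    rw [ContinuousLinearMap.comp_smul, ContinuousLinearMap.det,
      ContinuousLinearMap.toLinearMap_smul, LinearMap.det_smul, finrank_euclideanSpace_fin]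
  simp only [hdet, abs_mul, abs_of_pos (pow_pos hε.1 d), hval, smul_eq_mul, blowUpIntegrand]
  simp only [Φ] at hder ⊢
  rw [hder, mul_assoc]

end IsBlowUp

end Energy

namespace IsBlowUp

variable {d N : ℕ} {Ω ΓD D : Set (Vec d)} {ubar u₀ : Vec d → Vec N} {x₀ : Vec d}
  {F : Vec d → Vec N → Mat N d → ℝ} {g h : Vec d → Vec d}
  {A : Vec d ≃L[ℝ] Vec d} {r r₁ ε₀ ε δ : ℝ} {ψ : Vec d → Vec N}

theorem tendsto_h (B : IsBlowUp Ω x₀ D g h A r ε₀) :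
    Tendsto h (𝓝[g '' (ball x₀ r ∩ Ω)] (g x₀)) (𝓝[ball x₀ r ∩ Ω] x₀) := by
  have hx₀ := B.mem_ball_closure
  refine tendsto_nhdsWithin_iff.2 ⟨?_, ?_⟩
  · have hmem : Tendsto h (𝓝[g '' (ball x₀ r ∩ closure Ω)] (g x₀)) (𝓝 (h (g x₀))) :=
      B.h_C1.2.1 (g x₀) (mem_image_of_mem g hx₀)
    rw [B.leftInv hx₀] at hmem
    exact hmem.mono_left (nhdsWithin_mono _ (image_mono subset_ball_closure))
  · filter_upwards [self_mem_nhdsWithin]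
    rintro _ ⟨x, hx, rfl⟩
    rwa [B.leftInv (subset_ball_closure hx)]

/-- As `ε → 0`, the increments of the energy, divided by `ε ^ d`, converge to the increment of the
energy of the frozen integrand on `D`. -/
theorem tendsto_integral (B : IsBlowUp Ω x₀ D g h A r ε₀) (hO : IsOpen Ω)
    (hb : Bornology.IsBounded Ω)
    (hF : ContinuousOn (fun v : Vec d × Vec N × Mat N d => F v.1 v.2.1 v.2.2)
      (closure Ω ×ˢ Set.univ)) (hu : C1UpTo Ω (closure Ω) u₀) (hψ : C1UpTo D (closure D) ψ) :
    Tendsto (fun ε => ∫ z in D, blowUpIntegrand Ω F u₀ x₀ g h A ψ ε z) (𝓝[>] 0)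
      (𝓝 (∫ z in D, (F x₀ (u₀ x₀) (grad Ω u₀ x₀ + fderiv ℝ ψ z) -
        F x₀ (u₀ x₀) (grad Ω u₀ x₀)))) := by
  have hO' : IsOpen (ball x₀ r ∩ Ω) := isOpen_ball.inter hO
  have hx₀ := B.mem_ball_closure
  have hDb : Bornology.IsBounded D := isBounded_ball.subset B.D_subset
  set Q := g '' (ball x₀ r ∩ Ω)
  set p := g x₀
  set G₀ := grad Ω u₀
  have cG₀ : ContinuousOn G₀ (closure Ω) := hu.continuousOn_grad subset_rfl
  have hεm : ∀ᶠ ε in 𝓝[>] (0 : ℝ), ε ∈ Ioo 0 (min ε₀ 1) :=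
    Ioo_mem_nhdsGT (lt_min B.ε_pos one_pos)
  have hhQ : ∀ y ∈ Q, h y ∈ ball x₀ r ∩ Ω := by
    rintro _ ⟨x, hx, rfl⟩
    rwa [B.leftInv (subset_ball_closure hx)]
  have hΩ : ∀ y ∈ Q, h y ∈ closure Ω := fun y hy => subset_closure (hhQ y hy).2
  -- Limits of the geometric quantities as `y → g x₀`.
  have lJ : Tendsto (fun y => |((fderiv ℝ h y).comp (A : Vec d →L[ℝ] Vec d)).det|) (𝓝[Q] p)
      (𝓝 1) := by
    have l1 := B.h_C1.tendsto_grad (mem_image_of_mem g hx₀)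
    have hc : Continuous fun T : Vec d →L[ℝ] Vec d =>
        |(T.comp (A : Vec d →L[ℝ] Vec d)).det| :=
      (ContinuousLinearMap.continuous_det.comp (continuous_id.clm_comp continuous_const)).abs
    have l2 := (hc.tendsto _).comp l1
    rw [B.grad_comp hO] at l2
    simpa [ContinuousLinearMap.det, Function.comp_def] using l2
  have lg : Tendsto (fun y => fderiv ℝ g (h y)) (𝓝[Q] p) (𝓝 (A : Vec d →L[ℝ] Vec d)) := by
    have := B.g_C1.tendsto_grad hx₀
    rw [B.grad_eq] at this
    exact this.comp B.tendsto_h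
  have lh : Tendsto h (𝓝[Q] p) (𝓝[closure Ω] x₀) :=
    B.tendsto_h.mono_right (nhdsWithin_mono _ fun x hx => subset_closure hx.2)
  have lu : Tendsto (fun y => u₀ (h y)) (𝓝[Q] p) (𝓝 (u₀ x₀)) := (hu.2.1 x₀ B.mem).tendsto.comp lh
  have lG : Tendsto (fun y => G₀ (h y)) (𝓝[Q] p) (𝓝 (G₀ x₀)) := (cG₀ x₀ B.mem).tendsto.comp lh
  -- Bounds.
  obtain ⟨C, hC, huC⟩ := hu.exists_bound hb
  obtain ⟨C', hC', hψC⟩ := hψ.exists_bound hDb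
  have hψC : ∀ z ∈ D, ‖ψ z‖ ≤ C' ∧ ‖fderiv ℝ ψ z‖ ≤ C' := fun z hz => by
    rw [← hψ.grad_eq B.D_open hz]
    exact hψC z (subset_closure hz)
  set a := ‖(A : Vec d →L[ℝ] Vec d)‖ + 1
  set a' := ‖(A.symm : Vec d →L[ℝ] Vec d)‖
  obtain ⟨M, hM⟩ := (hb.isCompact_closure.prod ((isCompact_closedBall (0 : Vec N) (C + C')).prod
    (isCompact_closedBall (0 : Mat N d) (C + C' * (a' * a))))).exists_bound_of_continuousOn
    (hF.mono (prod_mono subset_rfl (subset_univ _)))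
  refine tendsto_setIntegral_of_bounded B.D_open.measurableSet hDb (2 * (M + M)) ?_ ?_ ?_
  · filter_upwards [hεm] with ε hε
    have hε : ε ∈ Ioo 0 ε₀ := ⟨hε.1, hε.2.trans_le (min_le_left _ _)⟩
    have cy : ContinuousOn (fun z => p + ε • A z) D :=
      (continuous_const.add (A.continuous.const_smul ε)).continuousOn
    have my : MapsTo (fun z => p + ε • A z) D Q := fun z hz => B.to_image ε hε z hz
    have ch : ContinuousOn (fun z => h (p + ε • A z)) D := B.h_C1.1.continuousOn.comp cy my
    have mh : MapsTo (fun z => h (p + ε • A z)) D (closure Ω) := fun z hz => hΩ _ (my hz)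
    have cJ : ContinuousOn (fun z => fderiv ℝ h (p + ε • A z)) D :=
      (B.h_C1.continuousOn_fderiv B.image_open).comp cy my
    have cg : ContinuousOn (fun z => fderiv ℝ g (h (p + ε • A z))) D :=
      (B.g_C1.continuousOn_fderiv hO').comp ch fun z hz => hhQ _ (my hz)
    have cu := hu.2.1.comp ch mh
    have cG := cG₀.comp ch mh
    have cF1 := hF.comp (f := fun z => (h (p + ε • A z), u₀ (h (p + ε • A z)) + ε • ψ z,
        G₀ (h (p + ε • A z)) + (fderiv ℝ ψ z).comp ((A.symm : Vec d →L[ℝ] Vec d).comp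
          (fderiv ℝ g (h (p + ε • A z))))))
      (ch.prodMk ((cu.add (hψ.1.continuousOn.const_smul ε)).prodMk (cG.add
        ((hψ.continuousOn_fderiv B.D_open).clm_comp (continuousOn_const.clm_comp cg)))))
      fun z hz => ⟨mh hz, trivial⟩
    have cF2 := hF.comp (f := fun z => (h (p + ε • A z), u₀ (h (p + ε • A z)),
        G₀ (h (p + ε • A z)))) (ch.prodMk (cu.prodMk cG)) fun z hz => ⟨mh hz, trivial⟩
    exact ((ContinuousLinearMap.continuous_det.comp_continuousOn
      (cJ.clm_comp continuousOn_const)).abs).mul (cF1.sub cF2)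
  · have hev : ∀ᶠ y in 𝓝[Q] p, y ∈ Q ∧
        |((fderiv ℝ h y).comp (A : Vec d →L[ℝ] Vec d)).det| < 2 ∧ ‖fderiv ℝ g (h y)‖ < a :=
      eventually_mem_nhdsWithin.and ((lJ.eventually_lt_const one_lt_two).and
        (lg.norm.eventually_lt_const (lt_add_one _)))
    filter_upwards [hεm, B.eventually_forall hev] with ε hε hall z hz
    obtain ⟨hy, hJ, hg⟩ := hall z hz
    have b1 : |F (h (p + ε • A z)) (u₀ (h (p + ε • A z)) + ε • ψ z) (G₀ (h (p + ε • A z)) +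
        (fderiv ℝ ψ z).comp ((A.symm : Vec d →L[ℝ] Vec d).comp
          (fderiv ℝ g (h (p + ε • A z)))))| ≤ M := by
      refine hM (_, _, _) ⟨hΩ _ hy, mem_closedBall_zero_iff.2 ?_, mem_closedBall_zero_iff.2 ?_⟩
      · refine (norm_add_le _ _).trans (add_le_add (huC _ (hΩ _ hy)).1 ?_)
        rw [norm_smul, Real.norm_of_nonneg hε.1.le]
        exact (mul_le_of_le_one_left (norm_nonneg _)
          (hε.2.le.trans (min_le_right _ _))).trans (hψC z hz).1
      · refine (norm_add_le _ _).trans (add_le_add (huC _ (hΩ _ hy)).2 ?_)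
        refine (ContinuousLinearMap.opNorm_comp_le _ _).trans ?_
        refine mul_le_mul (hψC z hz).2 ?_ (norm_nonneg _) hC'.le
        refine (ContinuousLinearMap.opNorm_comp_le _ _).trans ?_
        exact mul_le_mul_of_nonneg_left hg.le (norm_nonneg _)
    have b2 : |F (h (p + ε • A z)) (u₀ (h (p + ε • A z))) (G₀ (h (p + ε • A z)))| ≤ M := by
      refine hM (_, _, _) ⟨hΩ _ hy, mem_closedBall_zero_iff.2 ?_, mem_closedBall_zero_iff.2 ?_⟩
      · exact (huC _ (hΩ _ hy)).1.trans (le_add_of_nonneg_right hC'.le)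
      · exact (huC _ (hΩ _ hy)).2.trans (le_add_of_nonneg_right (by positivity))
    simp only [blowUpIntegrand]
    rw [abs_mul, abs_abs]
    exact mul_le_mul hJ.le ((abs_sub _ _).trans (add_le_add b1 b2)) (abs_nonneg _) zero_le_two
  · intro z hz
    have ly : Tendsto (fun ε : ℝ => p + ε • A z) (𝓝[>] 0) (𝓝[Q] p) := by
      refine tendsto_nhdsWithin_iff.2 ⟨?_, ?_⟩
      · have hc : Continuous fun ε : ℝ => p + ε • A z := by fun_prop
        have := hc.tendsto 0
        rw [zero_smul, add_zero] at this
        exact this.mono_left nhdsWithin_le_nhds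
      · filter_upwards [hεm] with ε hε
        exact B.to_image ε ⟨hε.1, hε.2.trans_le (min_le_left _ _)⟩ z hz
    have lε : Tendsto (fun ε : ℝ => ε • ψ z) (𝓝[>] 0) (𝓝 0) := by
      have hc : Continuous fun ε : ℝ => ε • ψ z := by fun_prop
      have := hc.tendsto 0
      rw [zero_smul] at this
      exact this.mono_left nhdsWithin_le_nhds
    have lu' := (lu.comp ly).add lε
    rw [add_zero] at lu'
    have hcc : Continuous fun T : Vec d →L[ℝ] Vec d =>
        (fderiv ℝ ψ z).comp ((A.symm : Vec d →L[ℝ] Vec d).comp T) :=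
      continuous_const.clm_comp (continuous_const.clm_comp continuous_id)
    have lT := (hcc.tendsto _).comp (lg.comp ly)
    have hid : (fderiv ℝ ψ z).comp ((A.symm : Vec d →L[ℝ] Vec d).comp
        (A : Vec d →L[ℝ] Vec d)) = fderiv ℝ ψ z := by
      ext v; simp
    rw [hid] at lT
    have hmem : ∀ᶠ ε in 𝓝[>] (0 : ℝ), h (p + ε • A z) ∈ closure Ω :=
      (ly.eventually eventually_mem_nhdsWithin).mono fun ε hε => hΩ _ hε
    have lh' : Tendsto (fun ε : ℝ => h (p + ε • A z)) (𝓝[>] 0) (𝓝 x₀) :=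
      (tendsto_nhdsWithin_iff.1 (lh.comp ly)).1
    have l1 := (hF (x₀, u₀ x₀, G₀ x₀ + fderiv ℝ ψ z) ⟨B.mem, trivial⟩).tendsto.comp
      (tendsto_nhdsWithin_iff.2 ⟨lh'.prodMk_nhds (lu'.prodMk_nhds ((lG.comp ly).add lT)),
        hmem.mono fun ε hε => ⟨hε, trivial⟩⟩)
    have l2 := (hF (x₀, u₀ x₀, G₀ x₀) ⟨B.mem, trivial⟩).tendsto.comp
      (tendsto_nhdsWithin_iff.2 ⟨lh'.prodMk_nhds ((lu.comp ly).prodMk_nhds (lG.comp ly)),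
        hmem.mono fun ε hε => ⟨hε, trivial⟩⟩)
    have l := (lJ.comp ly).mul (l1.sub l2)
    rw [one_mul] at l
    exact l

theorem norm_transplant_le (B : IsBlowUp Ω x₀ D g h A r ε₀) (hO : IsOpen Ω)
    (hε : ε ∈ Ioo 0 ε₀) {C : ℝ} (hC : 0 ≤ C) (hψC : ∀ z ∈ closure D, ‖ψ z‖ ≤ C) (hδ : 0 < δ)
    (hψ0 : ∀ z, 1 - δ ≤ ‖z‖ → ψ z = 0) {x : Vec d} (hx : x ∈ closure Ω) :
    ‖transplant g A x₀ r ε ψ x‖ ≤ ε * C := by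
  by_cases hr : x ∈ ball x₀ r ∧ ‖rescale g A x₀ ε x‖ < 1
  · rw [transplant, indicator_of_mem hr.1, norm_smul, Real.norm_of_nonneg hε.1.le]
    exact mul_le_mul_of_nonneg_left
      (hψC _ (B.rescale_mem_closure hO hε ⟨hr.1, hx⟩ hr.2)) hε.1.le
  · rw [transplant_eq_zero hψ0 hδ fun hxr => not_lt.1 fun hlt => hr ⟨hxr, hlt⟩, norm_zero]
    exact mul_nonneg hε.1.le hC

/-- The quasiconvexity inequality on the blow-up `D`, for maps that vanish near the sphere. -/
theorem integral_nonneg (B : IsBlowUp Ω x₀ D g h A r ε₀) (hO : IsOpen Ω)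
    (hb : Bornology.IsBounded Ω) (hΓD : ΓD ⊆ closure Ω) (hx₀ : x₀ ∉ closure ΓD)
    (hF : ContinuousOn (fun v : Vec d × Vec N × Mat N d => F v.1 v.2.1 v.2.2)
      (closure Ω ×ˢ Set.univ)) (hu : u₀ ∈ Admissible Ω ΓD ubar)
    (hmin : IsStrongLocalMin Ω ΓD ubar F u₀)
    (hψ : C1UpTo D (closure D) ψ) (hδ : 0 < δ) (hψ0 : ∀ z, 1 - δ ≤ ‖z‖ → ψ z = 0) :
    0 ≤ ∫ z in D, (F x₀ (u₀ x₀) (grad Ω u₀ x₀ + fderiv ℝ ψ z) -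
      F x₀ (u₀ x₀) (grad Ω u₀ x₀)) := by
  refine ge_of_tendsto (B.tendsto_integral hO hb hF hu.1 hψ) ?_
  obtain ⟨η, hη, hmin⟩ := hmin
  obtain ⟨C, hC, hψC⟩ := hψ.exists_bound (isBounded_ball.subset B.D_subset)
  obtain ⟨s, hs, hsΓ⟩ := Metric.isOpen_iff.1 isClosed_closure.isOpen_compl x₀ hx₀
  have hr₁ : 0 < min s (r / 2) := lt_min hs (half_pos B.r_pos)
  have hr₁r : min s (r / 2) < r := (min_le_right _ _).trans_lt (half_lt_self B.r_pos)
  filter_upwards [Ioo_mem_nhdsGT (show (0 : ℝ) < min ε₀ (η / C) from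
    lt_min B.ε_pos (by positivity)), B.eventually_small hr₁] with ε hε hsmall
  have hε' : ε ∈ Ioo 0 ε₀ := ⟨hε.1, hε.2.trans_le (min_le_left _ _)⟩
  have key := B.energy_transplant hO hb hF hu.1 hε' hr₁r hsmall hψ hδ hψ0
  have hle := hmin (fun x => u₀ x + transplant g A x₀ r ε ψ x)
    ⟨hu.1.add (B.transplant_C1 hO hε' hr₁r hsmall hψ hδ hψ0) hO, fun x hx => ?_⟩ fun x hx => ?_
  · have hpos : 0 < ε ^ d := pow_pos hε.1 d
    exact nonneg_of_mul_nonneg_right (a := ε ^ d) (by linarith) hpos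
  · have h0 : transplant g A x₀ r ε ψ x = 0 :=
      transplant_eq_zero hψ0 hδ fun hxr => not_lt.1 fun hlt =>
        hsΓ (ball_subset_ball (min_le_left _ _) (hsmall x ⟨hxr, hΓD hx⟩ hlt)) (subset_closure hx)
    simp only [h0, add_zero, hu.2 x hx]
  · rw [add_sub_cancel_left]
    refine (B.norm_transplant_le hO hε' hC.le (fun z hz => (hψC z hz).1) hδ hψ0 hx).trans_lt ?_
    exact (lt_div_iff₀ hC).1 (hε.2.trans_le (min_le_right _ _))

end IsBlowUp

/-! ### Blow-ups at interior points and at facelike boundary points -/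

section Charts

variable {d N : ℕ} {Ω D : Set (Vec d)} {x₀ : Vec d}

theorem exists_isBlowUp_id (hO : IsOpen Ω) (hx₀ : x₀ ∈ Ω) :
    ∃ r, IsBlowUp Ω x₀ (ball 0 1) id id (ContinuousLinearEquiv.refl ℝ (Vec d)) r r := by
  obtain ⟨r, hr, hsub⟩ := Metric.isOpen_iff.1 hO x₀ hx₀
  have hC1 : ∀ U S : Set (Vec d), C1UpTo U S id := fun U S =>
    C1UpTo.of_contDiff contDiff_id U S
  refine ⟨r, hr, hr, subset_closure hx₀, hC1 _ _, fun _ _ => rfl, hC1 _ _, ?_, ?_, isOpen_ball,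
    subset_rfl, fun ε hε z hz => ?_, fun _ _ _ _ z hz _ => hz⟩
  · rw [image_id]
    exact isOpen_ball.inter hO
  · rw [(hC1 _ (ball x₀ r ∩ closure Ω)).grad_eq (isOpen_ball.inter hO) ⟨mem_ball_self hr, hx₀⟩,
      fderiv_id]
    rfl
  · rw [image_id]
    have hmem : x₀ + ε • z ∈ ball x₀ r := by
      rw [mem_ball_iff_norm, add_sub_cancel_left, norm_smul, Real.norm_of_nonneg hε.1.le]
      have hz1 : ‖z‖ < 1 := by simpa using hz
      exact (mul_le_of_le_one_right hε.1.le hz1.le).trans_lt hε.2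
    exact ⟨hmem, hsub hmem⟩

namespace Chart

theorem isOpen_image (c : Chart Ω x₀) (hO : IsOpen Ω) : IsOpen (c.g '' (ball x₀ c.r ∩ Ω)) := by
  have hO' : IsOpen (ball x₀ c.r ∩ Ω) := isOpen_ball.inter hO
  rw [isOpen_iff_mem_nhds]
  rintro _ ⟨x, hx, rfl⟩
  have hdet := c.det_pos x ⟨hx.1, subset_closure hx.2⟩
  rw [c.g_C1.grad_eq hO' hx] at hdet
  have hstrict : HasStrictFDerivAt c.g
      (((fderiv ℝ c.g x).toContinuousLinearEquivOfDetNeZero hdet.ne' :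
        Vec d ≃L[ℝ] Vec d) : Vec d →L[ℝ] Vec d) x := by
    rw [ContinuousLinearMap.coe_toContinuousLinearEquivOfDetNeZero]
    exact (c.g_C1.contDiffAt hO' hx).hasStrictFDerivAt one_ne_zero
  rw [← hstrict.map_nhds_eq_of_equiv]
  exact image_mem_map (hO'.mem_nhds hx)

/-- The image of the chart fills the polytope near `g x₀`: it is relatively closed there, since
boundary points of `Ω` are mapped to boundary points of `P`. -/
theorem exists_subset_image (c : Chart Ω x₀) (hO : IsOpen Ω) (hx₀ : x₀ ∈ frontier Ω) {ρ₀ : ℝ}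
    (hρ₀ : 0 < ρ₀) (hpre : ∀ ρ ∈ Ioc 0 ρ₀, IsPreconnected (c.P ∩ ball (c.g x₀) ρ)) :
    ∃ ρ ∈ Ioc 0 ρ₀, c.P ∩ ball (c.g x₀) ρ ⊆ c.g '' (ball x₀ c.r ∩ Ω) := by
  have hmem₀ : x₀ ∈ ball x₀ c.r ∩ closure Ω :=
    ⟨mem_ball_self c.r_pos, frontier_subset_closure hx₀⟩
  have hsub : ball x₀ c.r ∩ Ω ⊆ ball x₀ c.r ∩ closure Ω :=
    inter_subset_inter_right _ subset_closure
  have hlim : Tendsto c.h (𝓝[c.g '' (ball x₀ c.r ∩ closure Ω)] (c.g x₀)) (𝓝 (c.h (c.g x₀))) :=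
    c.h_C1.2.1 (c.g x₀) (mem_image_of_mem c.g hmem₀)
  rw [c.leftInv hmem₀] at hlim
  obtain ⟨η, hη, hηsub⟩ := Metric.mem_nhdsWithin_iff.1
    (hlim.eventually_mem (ball_mem_nhds x₀ (half_pos c.r_pos)))
  have hρ : 0 < min ρ₀ η := lt_min hρ₀ hη
  refine ⟨min ρ₀ η, ⟨hρ, min_le_left _ _⟩, ?_⟩
  refine (hpre _ ⟨hρ, min_le_left _ _⟩).subset_of_closure_inter_subset (c.isOpen_image hO) ?_ ?_
  · -- Points of `Ω` close to `x₀` are mapped close to `g x₀`.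
    have hcont : Tendsto c.g (𝓝[ball x₀ c.r ∩ Ω] x₀) (𝓝 (c.g x₀)) :=
      (c.g_C1.2.1 x₀ hmem₀).mono_left (nhdsWithin_mono _ hsub)
    have : (𝓝[ball x₀ c.r ∩ Ω] x₀).NeBot :=
      mem_closure_iff_nhdsWithin_neBot.1 (isOpen_ball.inter_closure hmem₀)
    obtain ⟨x, hx, hxb⟩ := ((hcont.eventually_mem (ball_mem_nhds _ hρ)).and
      self_mem_nhdsWithin).exists
    exact ⟨c.g x, ⟨c.mapsTo_interior hxb, hx⟩, mem_image_of_mem c.g hxb⟩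
  · rintro y ⟨hyc, hyP, hyb⟩
    have hK : IsCompact (closedBall x₀ (c.r / 2) ∩ closure Ω) :=
      (isCompact_closedBall x₀ (c.r / 2)).inter_right isClosed_closure
    have hKsub : closedBall x₀ (c.r / 2) ∩ closure Ω ⊆ ball x₀ c.r ∩ closure Ω :=
      inter_subset_inter_left _ (closedBall_subset_ball (half_lt_self c.r_pos))
    have hZ : IsClosed (c.g '' (closedBall x₀ (c.r / 2) ∩ closure Ω)) :=
      (hK.image_of_continuousOn (c.g_C1.2.1.mono hKsub)).isClosed
    have hinto : ball (c.g x₀) (min ρ₀ η) ∩ c.g '' (ball x₀ c.r ∩ Ω) ⊆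
        c.g '' (closedBall x₀ (c.r / 2) ∩ closure Ω) := by
      rintro _ ⟨hb, x, hx, rfl⟩
      have hhx : c.h (c.g x) ∈ ball x₀ (c.r / 2) :=
        hηsub ⟨ball_subset_ball (min_le_right _ _) hb, mem_image_of_mem c.g (hsub hx)⟩
      rw [c.leftInv (hsub hx)] at hhx
      exact ⟨x, ⟨ball_subset_closedBall hhx, subset_closure hx.2⟩, rfl⟩
    obtain ⟨x, hx, rfl⟩ := hZ.closure_subset_iff.2 hinto (isOpen_ball.inter_closure ⟨hyb, hyc⟩)
    have hxr := hKsub hx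
    refine ⟨x, ⟨hxr.1, ?_⟩, rfl⟩
    by_contra hxΩ
    have hfr := c.mapsTo_frontier ⟨hxr.1, by rw [hO.frontier_eq]; exact ⟨hxr.2, hxΩ⟩⟩
    rw [c.isPolytope.1.frontier_eq] at hfr
    exact hfr.2 hyP

theorem gradAt_det_pos (c : Chart Ω x₀) (hx₀ : x₀ ∈ frontier Ω) : 0 < c.gradAt.det :=
  c.det_pos x₀ ⟨mem_ball_self c.r_pos, frontier_subset_closure hx₀⟩

/-- A chart is a blow-up onto `D` if near `g x₀` the polytope is the cone over the image of `D`
under the gradient of the chart. -/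
theorem exists_isBlowUp (c : Chart Ω x₀) (hO : IsOpen Ω) (hx₀ : x₀ ∈ frontier Ω)
    (hDsub : D ⊆ ball 0 1) {ρ₀ : ℝ} (hρ₀ : 0 < ρ₀)
    (hpre : ∀ ρ ∈ Ioc 0 ρ₀, IsPreconnected (c.P ∩ ball (c.g x₀) ρ))
    (hD : ∀ z ∈ ball (0 : Vec d) 1, ∀ ε > (0 : ℝ), c.g x₀ + ε • c.gradAt z ∈ ball (c.g x₀) ρ₀ →
      (c.g x₀ + ε • c.gradAt z ∈ c.P ↔ z ∈ D)) :
    ∃ (A : Vec d ≃L[ℝ] Vec d) (r ε₀ : ℝ), IsBlowUp Ω x₀ D c.g c.h A r ε₀ := by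
  obtain ⟨ρ, hρ, hsub⟩ := c.exists_subset_image hO hx₀ hρ₀ hpre
  have hdet := c.gradAt_det_pos hx₀
  obtain ⟨A, hA⟩ : ∃ A : Vec d ≃L[ℝ] Vec d, (A : Vec d →L[ℝ] Vec d) = c.gradAt :=
    ⟨_, c.gradAt.coe_toContinuousLinearEquivOfDetNeZero hdet.ne'⟩
  have hAz : ∀ z, A z = c.gradAt z := fun z => by rw [← hA]; rfl
  set ε₀ := ρ / (‖(A : Vec d →L[ℝ] Vec d)‖ + 1)
  have hε₀ : 0 < ε₀ := div_pos hρ.1 (by positivity)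
  have hball : ∀ ε ∈ Ioo 0 ε₀, ∀ z ∈ ball (0 : Vec d) 1,
      c.g x₀ + ε • A z ∈ ball (c.g x₀) ρ := fun ε hε z hz => by
    rw [mem_ball_iff_norm, add_sub_cancel_left]
    exact IsBlowUp.norm_smul_apply_lt hε.1 hε.2 (by simpa using hz)
  have hiff : ∀ ε ∈ Ioo 0 ε₀, ∀ z ∈ ball (0 : Vec d) 1, (c.g x₀ + ε • A z ∈ c.P ↔ z ∈ D) :=
    fun ε hε z hz => by
      have hb := ball_subset_ball hρ.2 (hball ε hε z hz)
      rw [hAz] at hb ⊢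
      exact hD z hz ε hε.1 hb
  refine ⟨A, c.r, ε₀, c.r_pos, hε₀, frontier_subset_closure hx₀, c.g_C1, c.leftInv, c.h_C1,
    c.isOpen_image hO, hA.symm, ?_, hDsub, fun ε hε z hz => ?_, fun ε hε x hx z hz e => ?_⟩
  · have hhalf : ε₀ / 2 ∈ Ioo 0 ε₀ := ⟨half_pos hε₀, half_lt_self hε₀⟩
    have hDeq : D = ball 0 1 ∩ (fun z => c.g x₀ + (ε₀ / 2) • A z) ⁻¹' c.P := by
      ext z
      exact ⟨fun hz => ⟨hDsub hz, (hiff _ hhalf z (hDsub hz)).2 hz⟩,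
        fun hz => (hiff _ hhalf z hz.1).1 hz.2⟩
    rw [hDeq]
    have hc : Continuous fun z : Vec d => c.g x₀ + (ε₀ / 2) • A z :=
      continuous_const.add (A.continuous.const_smul (ε₀ / 2))
    exact isOpen_ball.inter (c.isPolytope.1.preimage hc)
  · exact hsub ⟨(hiff ε hε z (hDsub hz)).2 hz, hball ε hε z (hDsub hz)⟩
  · refine (hiff ε hε z hz).1 ?_
    rw [← e]
    exact c.mapsTo_interior hx

/-- The sign of `z · n`, for the normal `n` associated with `m`, is that of `∇g(x₀) z · m`. -/
theorem inner_normal_neg_iff (c : Chart Ω x₀) (hx₀ : x₀ ∈ frontier Ω) {m : Vec d} (hm : ‖m‖ = 1)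
    (z : Vec d) :
    inner ℝ z (‖ContinuousLinearMap.adjoint c.gradAt m‖⁻¹ •
      ContinuousLinearMap.adjoint c.gradAt m) < 0 ↔ inner ℝ (c.gradAt z) m < 0 := by
  have hne : ContinuousLinearMap.adjoint c.gradAt m ≠ 0 := by
    intro h0
    obtain ⟨A, hA⟩ : ∃ A : Vec d ≃L[ℝ] Vec d, (A : Vec d →L[ℝ] Vec d) = c.gradAt :=
      ⟨_, c.gradAt.coe_toContinuousLinearEquivOfDetNeZero (c.gradAt_det_pos hx₀).ne'⟩
    have h1 : inner ℝ (A.symm m) (ContinuousLinearMap.adjoint c.gradAt m) = ‖m‖ ^ 2 := by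
      rw [ContinuousLinearMap.adjoint_inner_right]
      have : c.gradAt (A.symm m) = m := by rw [← hA]; exact A.apply_symm_apply m
      rw [this, real_inner_self_eq_norm_sq]
    rw [h0, inner_zero_right, hm] at h1
    norm_num at h1
  have hpos : 0 < ‖ContinuousLinearMap.adjoint c.gradAt m‖⁻¹ := inv_pos.2 (norm_pos_iff.2 hne)
  rw [real_inner_smul_right, ContinuousLinearMap.adjoint_inner_right, mul_neg_iff]
  simp [hpos, hpos.not_gt]

theorem norm_of_mem_normalsAt {P : Set (Vec d)} {p m : Vec d} (hm : m ∈ normalsAt P p) :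
    ‖m‖ = 1 := by
  obtain ⟨q, -, hq⟩ := exists_flat_of_mem_normalsAt hm one_pos
  exact hq.2.1

theorem exists_isBlowUp_outward (c : Chart Ω x₀) (hO : IsOpen Ω) (hx₀ : x₀ ∈ frontier Ω)
    (hout : IsOutwardAt c.P (c.g x₀)) :
    ∃ (A : Vec d ≃L[ℝ] Vec d) (r ε₀ : ℝ),
      IsBlowUp Ω x₀ (outwardRegion c.normals) c.g c.h A r ε₀ := by
  have hp : c.g x₀ ∈ frontier c.P := c.mapsTo_frontier ⟨mem_ball_self c.r_pos, hx₀⟩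
  obtain ⟨ρ, hρ, hloc⟩ := c.isPolytope.exists_outward hp hout
  refine c.exists_isBlowUp hO hx₀ (fun z hz => hz.1) hρ (fun ρ' hρ' => (hloc ρ' hρ').1)
    fun z hz ε hε hb => ?_
  rw [(hloc ρ ⟨hρ, le_rfl⟩).2 _ hb, outwardRegion, normals]
  simp only [mem_ofPred_eq, forall_mem_image, hz, true_and, add_sub_cancel_left,
    real_inner_smul_left]
  refine forall₂_congr fun m hm => ?_
  rw [c.inner_normal_neg_iff hx₀ (norm_of_mem_normalsAt hm), mul_neg_iff]
  simp [hε, hε.not_gt]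

theorem exists_isBlowUp_inward (c : Chart Ω x₀) (hO : IsOpen Ω) (hx₀ : x₀ ∈ frontier Ω)
    (hin : IsInwardAt c.P (c.g x₀)) :
    ∃ (A : Vec d ≃L[ℝ] Vec d) (r ε₀ : ℝ),
      IsBlowUp Ω x₀ (inwardRegion c.normals) c.g c.h A r ε₀ := by
  have hp : c.g x₀ ∈ frontier c.P := c.mapsTo_frontier ⟨mem_ball_self c.r_pos, hx₀⟩
  obtain ⟨ρ, hρ, hloc⟩ := c.isPolytope.exists_inward hp hin
  refine c.exists_isBlowUp hO hx₀ (fun z hz => hz.1) hρ (fun ρ' hρ' => (hloc ρ' hρ').1)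
    fun z hz ε hε hb => ?_
  rw [(hloc ρ ⟨hρ, le_rfl⟩).2 _ hb, inwardRegion, normals]
  simp only [mem_ofPred_eq, exists_mem_image, hz, true_and, add_sub_cancel_left,
    real_inner_smul_left]
  refine exists_congr fun m => and_congr_right fun hm => ?_
  rw [c.inner_normal_neg_iff hx₀ (norm_of_mem_normalsAt hm), mul_neg_iff]
  simp [hε, hε.not_gt]

end Chart

end Charts

/-! ### Cut-off near the sphere -/

section CutOff

variable {d N : ℕ} {D : Set (Vec d)}

/-- The cut-off function that vanishes where `1 - ‖z‖² ≤ 1 / n` and is one where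
`1 - ‖z‖² ≥ 2 / n`. -/
noncomputable def cutOff (d n : ℕ) (z : Vec d) : ℝ :=
  Real.smoothTransition (n * (1 - ‖z‖ ^ 2) - 1)

theorem contDiff_cutOff (n : ℕ) : ContDiff ℝ 1 (cutOff d n) :=
  Real.smoothTransition.contDiff.comp
    ((contDiff_const.mul (contDiff_const.sub (contDiff_norm_sq ℝ))).sub contDiff_const)

theorem cutOff_eq_zero {n : ℕ} (hn : 1 ≤ n) {z : Vec d} (hz : 1 - 1 / (2 * n : ℝ) ≤ ‖z‖) :
    cutOff d n z = 0 := by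
  refine Real.smoothTransition.zero_of_nonpos ?_
  have hn' : (1 : ℝ) ≤ n := by exact_mod_cast hn
  have h1 : 1 / (2 * n : ℝ) ≤ 1 / 2 := by
    apply one_div_le_one_div_of_le <;> linarith
  have h2 : (1 - 1 / (2 * n : ℝ)) ^ 2 ≤ ‖z‖ ^ 2 := pow_le_pow_left₀ (by linarith) hz 2
  have h3 : (n : ℝ) * (1 / (2 * n : ℝ)) = 1 / 2 := by field_simp
  have h4 : (0 : ℝ) ≤ n * (1 / (2 * n : ℝ)) ^ 2 := by positivity
  nlinarith

theorem eventually_cutOff_eq_one {z : Vec d} (hz : ‖z‖ < 1) :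
    ∀ᶠ n : ℕ in atTop, cutOff d n =ᶠ[𝓝 z] fun _ => 1 := by
  have hpos : 0 < 1 - ‖z‖ ^ 2 := by nlinarith [norm_nonneg z]
  have hlim : Tendsto (fun n : ℕ => (n : ℝ) * (1 - ‖z‖ ^ 2) - 1) atTop atTop :=
    tendsto_atTop_add_const_right _ _ (tendsto_natCast_atTop_atTop.atTop_mul_const hpos)
  filter_upwards [hlim.eventually_gt_atTop 1] with n hn
  have hc : Continuous fun z : Vec d => (n : ℝ) * (1 - ‖z‖ ^ 2) - 1 := by fun_prop
  filter_upwards [hc.continuousAt.eventually_const_lt hn] with y hy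
  exact Real.smoothTransition.one_of_one_le hy.le

/-- The gradient of the cut-off function is of order `n`, and it vanishes unless
`1 - ‖z‖² ≤ 2 / n`. -/
theorem exists_cutOff_bound (d : ℕ) : ∃ C ≥ 0, ∀ n : ℕ, ∀ z ∈ ball (0 : Vec d) 1,
    ‖fderiv ℝ (cutOff d n) z‖ ≤ C * n ∧
      (2 < (n : ℝ) * (1 - ‖z‖ ^ 2) → fderiv ℝ (cutOff d n) z = 0) := by
  have hsm : ContDiff ℝ 1 Real.smoothTransition := Real.smoothTransition.contDiff
  obtain ⟨C, hC⟩ := (isCompact_Icc (a := (-1 : ℝ)) (b := 1)).exists_bound_of_continuousOn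
    (hsm.continuous_deriv le_rfl).continuousOn
  have hC0 : 0 ≤ C := (norm_nonneg _).trans (hC 0 (by norm_num))
  refine ⟨2 * C, by positivity, fun n z hz => ?_⟩
  have hz1 : ‖z‖ < 1 := by simpa using hz
  have hzero : 2 < (n : ℝ) * (1 - ‖z‖ ^ 2) → fderiv ℝ (cutOff d n) z = 0 := by
    intro h
    have hc : Continuous fun z : Vec d => (n : ℝ) * (1 - ‖z‖ ^ 2) := by fun_prop
    have : cutOff d n =ᶠ[𝓝 z] fun _ => 1 := by
      filter_upwards [hc.continuousAt.eventually_const_lt h] with y hy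
      exact Real.smoothTransition.one_of_one_le (by linarith)
    rw [this.fderiv_eq, fderiv_fun_const, Pi.zero_apply]
  refine ⟨?_, hzero⟩
  rcases lt_or_ge 2 ((n : ℝ) * (1 - ‖z‖ ^ 2)) with h | h
  · rw [hzero h, norm_zero]; positivity
  · have hs : (n : ℝ) * (1 - ‖z‖ ^ 2) - 1 ∈ Icc (-1 : ℝ) 1 := by
      have : 0 ≤ (n : ℝ) * (1 - ‖z‖ ^ 2) :=
        mul_nonneg n.cast_nonneg (by nlinarith [norm_nonneg z])
      constructor <;> linarith
    have hin : HasFDerivAt (fun z : Vec d => (n : ℝ) * (1 - ‖z‖ ^ 2) - 1)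
        ((n : ℝ) • -((2 : ℕ) • (innerSL ℝ z : Vec d →L[ℝ] ℝ))) z :=
      (((hasStrictFDerivAt_norm_sq z).hasFDerivAt.const_sub 1).const_mul (n : ℝ)).sub_const 1
    have hcomp := (hsm.differentiable one_ne_zero _).hasDerivAt.comp_hasFDerivAt z hin
    have e : fderiv ℝ (cutOff d n) z = _ := hcomp.fderiv
    rw [e, norm_smul, norm_smul, norm_neg, ← Nat.cast_smul_eq_nsmul ℝ, norm_smul,
      innerSL_apply_norm, Real.norm_natCast, Real.norm_natCast]
    calc _ ≤ C * (n * ((2 : ℕ) * 1)) := by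
          gcongr
          exact hC _ hs
      _ = 2 * C * n := by push_cast; ring

/-- Maps that vanish on the sphere are bounded by the distance to the sphere: integrate the gradient
along the ray from the origin. -/
theorem norm_le_of_eq_zero_sphere (hD : IsOpen D) (hDsub : D ⊆ ball 0 1)
    (hstar : ∀ z ∈ D, ∀ t > (0 : ℝ), t • z ∈ ball (0 : Vec d) 1 → t • z ∈ D)
    {φ : Vec d → Vec N} (hφ : C1UpTo D (closure D) φ)
    (hφ0 : ∀ x ∈ sphere 0 1 ∩ closure D, φ x = 0) {L : ℝ} (hL : ∀ z ∈ D, ‖fderiv ℝ φ z‖ ≤ L)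
    {z : Vec d} (hz : z ∈ D) (hz0 : z ≠ 0) : ‖φ z‖ ≤ L * (1 - ‖z‖) := by
  have hzpos : 0 < ‖z‖ := norm_pos_iff.2 hz0
  have hz1 : ‖z‖ < 1 := by simpa using hDsub hz
  have hL0 : 0 ≤ L := (norm_nonneg _).trans (hL z hz)
  have hT : 1 < ‖z‖⁻¹ := (one_lt_inv₀ hzpos).2 hz1
  have hmem : ∀ t ∈ Ico 1 ‖z‖⁻¹, t • z ∈ D := fun t ht => by
    have ht0 : 0 < t := one_pos.trans_le ht.1
    refine hstar z hz t ht0 ?_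
    rw [mem_ball_zero_iff, norm_smul, Real.norm_of_nonneg ht0.le]
    exact (lt_inv_mul_iff₀' hzpos).1 (by simpa using ht.2)
  have hmean : ∀ t ∈ Ico 1 ‖z‖⁻¹, ‖φ (t • z) - φ z‖ ≤ L * (1 - ‖z‖) := fun t ht => by
    have hseg : segment ℝ z (t • z) ⊆ D := by
      rintro _ ⟨a, b, ha, hb, hab, rfl⟩
      have e : a • z + b • t • z = (a + b * t) • z := by rw [smul_smul, add_smul]
      rw [e]
      refine hmem _ ⟨?_, ?_⟩
      · nlinarith [ht.1]
      · refine lt_of_le_of_lt ?_ ht.2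
        nlinarith [ht.1]
    have h1 := (convex_segment z (t • z)).norm_image_sub_le_of_norm_fderiv_le (𝕜 := ℝ) (f := φ)
      (fun x hx => hφ.differentiableAt hD (hseg hx)) (fun x hx => hL x (hseg hx))
      (left_mem_segment ℝ _ _) (right_mem_segment ℝ _ _)
    refine h1.trans (mul_le_mul_of_nonneg_left ?_ hL0)
    have e : t • z - z = (t - 1) • z := by rw [sub_smul, one_smul]
    rw [e, norm_smul, Real.norm_of_nonneg (by linarith [ht.1]), sub_mul, one_mul]
    have : t * ‖z‖ ≤ 1 := by
      have := mul_le_mul_of_nonneg_right ht.2.le hzpos.le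
      rwa [inv_mul_cancel₀ hzpos.ne'] at this
    linarith
  have hne : (𝓝[<] ‖z‖⁻¹).NeBot := inferInstance
  have hev : ∀ᶠ t in 𝓝[<] ‖z‖⁻¹, t ∈ Ico 1 ‖z‖⁻¹ := by
    filter_upwards [Ioo_mem_nhdsLT hT] with t ht using ⟨ht.1.le, ht.2⟩
  have hray : Tendsto (fun t : ℝ => t • z) (𝓝[<] ‖z‖⁻¹) (𝓝[D] (‖z‖⁻¹ • z)) := by
    refine tendsto_nhdsWithin_iff.2 ⟨?_, hev.mono hmem⟩
    have hc : Continuous fun t : ℝ => t • z := by fun_prop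
    exact (hc.tendsto _).mono_left nhdsWithin_le_nhds
  have hcl : ‖z‖⁻¹ • z ∈ closure D := mem_closure_iff_nhdsWithin_neBot.2 (hne.map _ |>.mono hray)
  have hsph : ‖z‖⁻¹ • z ∈ sphere (0 : Vec d) 1 := by
    rw [mem_sphere_zero_iff_norm, norm_smul, norm_inv, norm_norm, inv_mul_cancel₀ hzpos.ne']
  have hlim := (hφ.2.1 _ hcl).tendsto.comp (hray.mono_right (nhdsWithin_mono _ subset_closure))
  rw [hφ0 _ ⟨hsph, hcl⟩] at hlim
  have hlim' := (hlim.sub_const (φ z)).norm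
  rw [zero_sub, norm_neg] at hlim'
  exact le_of_tendsto hlim' (hev.mono hmean)

/-- It suffices to test quasiconvexity with maps that vanish near the sphere: multiplication with
the cut-off functions leaves the gradients bounded. -/
theorem quasiconvexBoundary_of_cutOff (hD : IsOpen D) (hDsub : D ⊆ ball 0 1)
    (hstar : ∀ z ∈ D, ∀ t > (0 : ℝ), t • z ∈ ball (0 : Vec d) 1 → t • z ∈ D)
    {f : Mat N d → ℝ} (hf : Continuous f) {A : Mat N d}
    (h : ∀ ψ : Vec d → Vec N, C1UpTo D (closure D) ψ →
      ∀ δ > 0, (∀ z, 1 - δ ≤ ‖z‖ → ψ z = 0) → 0 ≤ ∫ z in D, (f (A + fderiv ℝ ψ z) - f A)) :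
    QuasiconvexBoundary D f A := by
  intro φ hφ hφ0
  have hDb : Bornology.IsBounded D := isBounded_ball.subset hDsub
  obtain ⟨L, hL, hφL⟩ := hφ.exists_bound hDb
  have hφL' : ∀ z ∈ D, ‖fderiv ℝ φ z‖ ≤ L := fun z hz => by
    rw [← hφ.grad_eq hD hz]
    exact (hφL z (subset_closure hz)).2
  obtain ⟨C, hC, hcut⟩ := exists_cutOff_bound d
  let ψ : ℕ → Vec d → Vec N := fun n z => cutOff d n z • φ z
  have hψ : ∀ n, C1UpTo D (closure D) (ψ n) := fun n =>
    C1UpTo.smul_of_contDiff (contDiff_cutOff n) hφ hD subset_closure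
  have hbound : ∀ n ≥ 3, ∀ z ∈ D, ‖fderiv ℝ (ψ n) z‖ ≤ L + C * (2 * L) := by
    intro n hn z hz
    have hz1 : ‖z‖ < 1 := by simpa using hDsub hz
    have e : fderiv ℝ (ψ n) z = cutOff d n z • fderiv ℝ φ z +
        (fderiv ℝ (cutOff d n) z).smulRight (φ z) :=
      fderiv_fun_smul ((contDiff_cutOff n).differentiable one_ne_zero z)
        (hφ.differentiableAt hD hz)
    rw [e]
    refine (norm_add_le _ _).trans (add_le_add ?_ ?_)
    · rw [norm_smul, Real.norm_of_nonneg (show 0 ≤ cutOff d n z from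
        Real.smoothTransition.nonneg _)]
      exact (mul_le_of_le_one_left (norm_nonneg _) (Real.smoothTransition.le_one _)).trans
        (hφL' z hz)
    · rw [ContinuousLinearMap.norm_smulRight_apply]
      obtain ⟨h1, h2⟩ := hcut n z (hDsub hz)
      rcases lt_or_ge 2 ((n : ℝ) * (1 - ‖z‖ ^ 2)) with hlt | hle
      · rw [h2 hlt, norm_zero, zero_mul]
        positivity
      · have hn' : (3 : ℝ) ≤ n := by exact_mod_cast hn
        have hz0 : z ≠ 0 := by
          rintro rfl
          rw [norm_zero] at hle
          linarith
        have hφz := norm_le_of_eq_zero_sphere hD hDsub hstar hφ hφ0 hφL' hz hz0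
        have h3 : (n : ℝ) * (1 - ‖z‖) ≤ 2 := by
          refine le_trans ?_ hle
          have : 1 - ‖z‖ ≤ 1 - ‖z‖ ^ 2 := by nlinarith [norm_nonneg z]
          gcongr
        calc ‖fderiv ℝ (cutOff d n) z‖ * ‖φ z‖ ≤ C * n * (L * (1 - ‖z‖)) := by gcongr
          _ = C * L * (n * (1 - ‖z‖)) := by ring
          _ ≤ C * L * 2 := by gcongr
          _ = C * (2 * L) := by ring
  obtain ⟨M, hM⟩ := (isCompact_closedBall (0 : Mat N d)
    (‖A‖ + (L + C * (2 * L)))).exists_bound_of_continuousOn hf.continuousOn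
  have hlim : Tendsto (fun n => ∫ z in D, (f (A + fderiv ℝ (ψ n) z) - f A)) atTop
      (𝓝 (∫ z in D, (f (A + fderiv ℝ φ z) - f A))) := by
    refine tendsto_setIntegral_of_bounded hD.measurableSet hDb (M + M)
      (Eventually.of_forall fun n => ?_) ?_ fun z hz => ?_
    · exact (hf.comp_continuousOn (continuousOn_const.add
        ((hψ n).continuousOn_fderiv hD))).sub continuousOn_const
    · filter_upwards [eventually_ge_atTop 3] with n hn z hz
      refine (abs_sub _ _).trans (add_le_add (hM _ ?_) (hM _ ?_))
      · rw [mem_closedBall_zero_iff]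
        exact (norm_add_le _ _).trans (by gcongr; exact hbound n hn z hz)
      · rw [mem_closedBall_zero_iff]
        exact le_add_of_nonneg_right (by positivity)
    · refine tendsto_const_nhds.congr' ?_
      filter_upwards [eventually_cutOff_eq_one (by simpa using hDsub hz : ‖z‖ < 1)] with n hn
      have e : ψ n =ᶠ[𝓝 z] φ := hn.mono fun y hy => by simp only [ψ, hy, one_smul]
      rw [e.fderiv_eq]
  refine ge_of_tendsto hlim ?_
  filter_upwards [eventually_ge_atTop 1] with n hn
  refine h (ψ n) (hψ n) (1 / (2 * n)) (by positivity) fun z hz => ?_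
  simp only [ψ, cutOff_eq_zero hn hz, zero_smul]

end CutOff

/-! ### Quasiconvexity conditions -/

section Quasiconvexity

variable {d N : ℕ} {Ω ΓD : Set (Vec d)} {ubar u₀ : Vec d → Vec N} {x₀ : Vec d}
  {F : Vec d → Vec N → Mat N d → ℝ}

theorem smul_mem_outwardRegion {S : Set (Vec d)} {z : Vec d} (hz : z ∈ outwardRegion S) {t : ℝ}
    (ht : 0 < t) (htz : t • z ∈ ball (0 : Vec d) 1) : t • z ∈ outwardRegion S :=
  ⟨htz, fun n hn => by
    rw [real_inner_smul_left]
    exact mul_neg_of_pos_of_neg ht (hz.2 n hn)⟩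

theorem smul_mem_inwardRegion {S : Set (Vec d)} {z : Vec d} (hz : z ∈ inwardRegion S) {t : ℝ}
    (ht : 0 < t) (htz : t • z ∈ ball (0 : Vec d) 1) : t • z ∈ inwardRegion S := by
  obtain ⟨-, n, hn, hneg⟩ := hz
  refine ⟨htz, n, hn, ?_⟩
  rw [real_inner_smul_left]
  exact mul_neg_of_pos_of_neg ht hneg

theorem continuous_frozen
    (hF : ContinuousOn (fun v : Vec d × Vec N × Mat N d => F v.1 v.2.1 v.2.2)
      (closure Ω ×ˢ Set.univ)) (hx₀ : x₀ ∈ closure Ω) (y : Vec N) : Continuous (F x₀ y) := by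
  rw [← continuousOn_univ]
  exact hF.comp (f := fun z => (x₀, y, z)) (by fun_prop) fun z _ => ⟨hx₀, trivial⟩

/-- Quasiconvexity on a blow-up of `Ω` that is a cone. -/
theorem IsBlowUp.quasiconvexBoundary {D : Set (Vec d)} {g h : Vec d → Vec d}
    {A : Vec d ≃L[ℝ] Vec d} {r ε₀ : ℝ} (B : IsBlowUp Ω x₀ D g h A r ε₀) (hO : IsOpen Ω)
    (hb : Bornology.IsBounded Ω) (hΓD : ΓD ⊆ closure Ω) (hx₀ : x₀ ∉ closure ΓD)
    (hF : ContinuousOn (fun v : Vec d × Vec N × Mat N d => F v.1 v.2.1 v.2.2)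
      (closure Ω ×ˢ Set.univ)) (hu : u₀ ∈ Admissible Ω ΓD ubar)
    (hmin : IsStrongLocalMin Ω ΓD ubar F u₀)
    (hstar : ∀ z ∈ D, ∀ t > (0 : ℝ), t • z ∈ ball (0 : Vec d) 1 → t • z ∈ D) :
    QuasiconvexBoundary D (F x₀ (u₀ x₀)) (grad Ω u₀ x₀) :=
  quasiconvexBoundary_of_cutOff B.D_open B.D_subset hstar (continuous_frozen hF B.mem _)
    fun _ hψ _ hδ hψ0 => B.integral_nonneg hO hb hΓD hx₀ hF hu hmin hψ hδ hψ0

theorem quasiconvexInterior_of_mem (hO : IsOpen Ω) (hb : Bornology.IsBounded Ω)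
    (hΓD : ΓD ⊆ frontier Ω)
    (hF : ContinuousOn (fun v : Vec d × Vec N × Mat N d => F v.1 v.2.1 v.2.2)
      (closure Ω ×ˢ Set.univ)) (hu : u₀ ∈ Admissible Ω ΓD ubar)
    (hmin : IsStrongLocalMin Ω ΓD ubar F u₀) (hx₀ : x₀ ∈ Ω) :
    QuasiconvexInterior (F x₀ (u₀ x₀)) (grad Ω u₀ x₀) := by
  intro φ hφ _ hsupp
  obtain ⟨r, B⟩ := exists_isBlowUp_id hO hx₀
  have hx₀Γ : x₀ ∉ closure ΓD := fun hx => by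
    have := isClosed_frontier.closure_subset_iff.2 hΓD hx
    rw [hO.frontier_eq] at this
    exact this.2 hx₀
  obtain ⟨s, hs, hsub⟩ := exists_lt_subset_ball (isClosed_tsupport φ) hsupp
  refine B.integral_nonneg hO hb (hΓD.trans frontier_subset_closure) hx₀Γ hF hu hmin
    (C1UpTo.of_contDiff hφ _ _) (sub_pos.2 hs) fun z hz => ?_
  refine image_eq_zero_of_notMem_tsupport fun hz' => ?_
  have := mem_ball_zero_iff.1 (hsub hz')
  linarith

/-- Quasiconvexity in the interior carries over to boundary points by continuity. -/
theorem quasiconvexInterior_of_mem_closure (hO : IsOpen Ω) (hb : Bornology.IsBounded Ω)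
    (hΓD : ΓD ⊆ frontier Ω)
    (hF : ContinuousOn (fun v : Vec d × Vec N × Mat N d => F v.1 v.2.1 v.2.2)
      (closure Ω ×ˢ Set.univ)) (hu : u₀ ∈ Admissible Ω ΓD ubar)
    (hmin : IsStrongLocalMin Ω ΓD ubar F u₀) (hx₀ : x₀ ∈ closure Ω) :
    QuasiconvexInterior (F x₀ (u₀ x₀)) (grad Ω u₀ x₀) := by
  intro φ hφ hcomp hsupp
  have : (𝓝[Ω] x₀).NeBot := mem_closure_iff_nhdsWithin_neBot.1 hx₀
  have cG : ContinuousOn (grad Ω u₀) (closure Ω) := hu.1.continuousOn_grad subset_rfl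
  have hle : 𝓝[Ω] x₀ ≤ 𝓝[closure Ω] x₀ := nhdsWithin_mono _ subset_closure
  have hφ' : Continuous (fderiv ℝ φ) := hφ.continuous_fderiv one_ne_zero
  obtain ⟨C, hC, huC⟩ := hu.1.exists_bound hb
  obtain ⟨C', hC'⟩ := (isCompact_closedBall (0 : Vec d) 1).exists_bound_of_continuousOn
    hφ'.continuousOn
  have hC'0 : 0 ≤ C' := (norm_nonneg _).trans (hC' 0 (by simp))
  obtain ⟨M, hM⟩ := (hb.isCompact_closure.prod ((isCompact_closedBall (0 : Vec N) C).prod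
    (isCompact_closedBall (0 : Mat N d) (C + C')))).exists_bound_of_continuousOn
    (hF.mono (prod_mono subset_rfl (subset_univ _)))
  have hmem : ∀ᶠ x in 𝓝[Ω] x₀, x ∈ Ω := eventually_mem_nhdsWithin
  have lim : Tendsto (fun x => ∫ z in ball (0 : Vec d) 1,
      (F x (u₀ x) (grad Ω u₀ x + fderiv ℝ φ z) - F x (u₀ x) (grad Ω u₀ x))) (𝓝[Ω] x₀)
      (𝓝 (∫ z in ball (0 : Vec d) 1,
        (F x₀ (u₀ x₀) (grad Ω u₀ x₀ + fderiv ℝ φ z) - F x₀ (u₀ x₀) (grad Ω u₀ x₀)))) := by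
    refine tendsto_setIntegral_of_bounded measurableSet_ball isBounded_ball (M + M) ?_ ?_ ?_
    · filter_upwards [hmem] with x hx
      have hf := continuous_frozen hF (subset_closure hx) (u₀ x)
      exact ((hf.comp (continuous_const.add hφ')).sub continuous_const).continuousOn
    · filter_upwards [hmem] with x hx z hz
      have hx := subset_closure hx
      have hu1 := mem_closedBall_zero_iff.2 (huC x hx).1
      refine (abs_sub _ _).trans (add_le_add
        (hM (x, u₀ x, _) ⟨hx, hu1, mem_closedBall_zero_iff.2 ?_⟩)
        (hM (x, u₀ x, _) ⟨hx, hu1, mem_closedBall_zero_iff.2 ?_⟩))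
      · exact (norm_add_le _ _).trans
          (add_le_add (huC x hx).2 (hC' z (ball_subset_closedBall hz)))
      · exact (huC x hx).2.trans (le_add_of_nonneg_right hC'0)
    · intro z _
      have lx : Tendsto (fun x : Vec d => x) (𝓝[Ω] x₀) (𝓝 x₀) :=
        tendsto_id.mono_left nhdsWithin_le_nhds
      have lu := (hu.1.2.1 x₀ hx₀).tendsto.mono_left hle
      have lG := (cG x₀ hx₀).tendsto.mono_left hle
      have hΩ : ∀ᶠ x in 𝓝[Ω] x₀, x ∈ closure Ω := hmem.mono fun x hx => subset_closure hx
      have l1 := (hF (x₀, u₀ x₀, grad Ω u₀ x₀ + fderiv ℝ φ z) ⟨hx₀, trivial⟩).tendsto.comp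
        (tendsto_nhdsWithin_iff.2 ⟨lx.prodMk_nhds (lu.prodMk_nhds (lG.add_const (fderiv ℝ φ z))),
          hΩ.mono fun x hx => ⟨hx, trivial⟩⟩)
      have l2 := (hF (x₀, u₀ x₀, grad Ω u₀ x₀) ⟨hx₀, trivial⟩).tendsto.comp
        (tendsto_nhdsWithin_iff.2 ⟨lx.prodMk_nhds (lu.prodMk_nhds lG),
          hΩ.mono fun x hx => ⟨hx, trivial⟩⟩)
      exact l1.sub l2
  refine ge_of_tendsto lim ?_
  filter_upwards [hmem] with x hx
  exact quasiconvexInterior_of_mem hO hb hΓD hF hu hmin hx φ hφ hcomp hsupp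

end Quasiconvexity

end PolyMin

open PolyMin in
theorem theorem3p1 {d N : ℕ} (Ω ΓD : Set (Vec d)) (hΩ : LocallyDiffeoPolytope Ω)
    (hΓD : ΓD ⊆ frontier Ω)
    (ubar : Vec d → Vec N)
    (hubar : ∃ W : Set (Vec d), IsOpen W ∧ closure ΓD ⊆ W ∧ ContDiffOn ℝ 1 ubar W)
    (u₀ : Vec d → Vec N) (hu₀ : u₀ ∈ Admissible Ω ΓD ubar)
    (F : Vec d → Vec N → Mat N d → ℝ)
    (hF : ContinuousOn (fun v : Vec d × Vec N × Mat N d => F v.1 v.2.1 v.2.2)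
      (closure Ω ×ˢ Set.univ))
    (p : ℝ) (hp : 2 ≤ p) (hH0 : HypH0 Ω F u₀) (hH1 : HypH1 Ω F p)
    (hmin : IsStrongLocalMin Ω ΓD ubar F u₀) :
    -- the weak Euler-Lagrange equations
    (∀ φ ∈ (Variations Ω ΓD : Set (Vec d → Vec N)),
      (∫ x in Ω, (dY F x (u₀ x) (fderiv ℝ u₀ x) (φ x)
        + dZ F x (u₀ x) (fderiv ℝ u₀ x) (fderiv ℝ φ x))) = 0) ∧
    -- non-negativity of the second variation
    (∀ φ ∈ (Variations Ω ΓD : Set (Vec d → Vec N)),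
      0 ≤ ∫ x in Ω, (dYY F x (u₀ x) (fderiv ℝ u₀ x) (φ x) (φ x)
        + 2 * dYZ F x (u₀ x) (fderiv ℝ u₀ x) (fderiv ℝ φ x) (φ x)
        + dZZ F x (u₀ x) (fderiv ℝ u₀ x) (fderiv ℝ φ x) (fderiv ℝ φ x))) ∧
    -- quasiconvexity in the interior
    (∀ x₀ ∈ closure Ω, QuasiconvexInterior (F x₀ (u₀ x₀)) (grad Ω u₀ x₀)) ∧
    -- quasiconvexity at the facelike points of the free boundary
    (∀ k : ℕ, 1 ≤ k → k ≤ d → ∀ x₀ ∈ frontier Ω \ closure ΓD, ∀ c : Chart Ω x₀,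
      c.IsFacelike k → c.QuasiconvexFacelike (F x₀ (u₀ x₀)) (grad Ω u₀ x₀)) := by

  obtain ⟨hO, hb, -⟩ := hΩ
  have hΓ : ΓD ⊆ closure Ω := hΓD.trans frontier_subset_closure
  refine ⟨fun φ hφ => firstVariation_eq_zero hO hb hu₀ hF hH0 hmin hφ,
    fun φ hφ => secondVariation_nonneg hO hb hu₀ hF hH0 hmin hφ,
    fun x₀ hx₀ => quasiconvexInterior_of_mem_closure hO hb hΓD hF hu₀ hmin hx₀,
    fun k _ _ x₀ hx₀ c _ => ⟨fun hout => ?_, fun hin => ?_⟩⟩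
  · obtain ⟨A, r, ε₀, B⟩ := c.exists_isBlowUp_outward hO hx₀.1 hout
    exact B.quasiconvexBoundary hO hb hΓ hx₀.2 hF hu₀ hmin fun z hz t ht htz =>
      smul_mem_outwardRegion hz ht htz
  · obtain ⟨A, r, ε₀, B⟩ := c.exists_isBlowUp_inward hO hx₀.1 hin
    exact B.quasiconvexBoundary hO hb hΓ hx₀.2 hF hu₀ hmin fun z hz t ht htz =>
      smul_mem_inwardRegion hz ht htz
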